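/- **Theorem (Presentation of $\bigoplus_s\Omega_{s,2}(H)$).** Let $\Bbbk$ be a field of characteristic $0$ and $H$ a $\Bbbk$-vector space (for instance $H=H_1(\Sigma_{g,1};\Bbbk)$). *The space $\Omega_{s,r}(H)$.* A hairy graph is a union of $k$ unitrivalent trees, with a cyclic order at each trivalent vertex and the trees numbered $1,\dots,k$, some of whose univalent vertices are joined in pairs by directed external edges, while each remaining univalent vertex (a hair) is labelled by an element of $H$. Let $C_{k,r,s}$ be the space spanned by the connected hairy graphs with $k$ trees, first Betti number $r$ and $s$ hairs, modulo IHX and AS within the trees, multilinearity in the hair labels, the rule that reversing an external edge changes the sign, and the rule that renumbering the trees multiplies by the sign of the permutation. For a graph with two trees, $\partial$ is the sum over the external edges joining the two trees of the graph obtained by contracting this edge, with sign $+$ if the edge is directed from tree $1$ to tree $2$ and $-$ otherwise. Let $S_{2,r,s}\subset C_{2,r,s}$ be spanned by the graphs one of whose trees is a tripod that either is joined to the other tree by three of its legs, or is joined to it by two of its legs and has a hair as third leg, or has two legs joined to each other by an external edge and the third leg joined to the other tree. Then $\Omega_{s,r}(H)=C_{1,r,s}/\partial S_{2,r,s}$.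 *The algebraic side.* Let $T(H)$ be the tensor algebra, $T^+(H)$ its positive degree part, $\rho\colon T(H)\to T(H)$, $\rho(v_1\cdots v_m)=\overline{v_1\cdots v_m}=(-1)^m v_m\cdots v_1$, and let $\Delta(v_K)=\sum_{K=I\sqcup J}v_I\otimes v_J$, the algebra homomorphism $T(H)\to T(H)\otimes T(H)$ with $\Delta(v)=v\otimes 1+1\otimes v$ for $v\in H$. Let $\mathbb Z_2\times\mathbb Z_2$ act on $T^+(H)\otimes T^+(H)$ through the two commuting involutions $v_I\otimes w_J\mapsto \overline{v_I}\otimes\overline{w_J}$ and $v_I\otimes w_J\mapsto\overline{w_J}\otimes\overline{v_I}$ (so that the group is also generated by $\rho\otimes\rho$ and the swap of the two factors). Let $\mathrm{Rel}$ be the subspace of the coinvariants spanned by the classes of the following elements, for $v_I,w_J\in T^+(H)$ and $v_0\in H$, where terms lying in $1\otimes T(H)$ or $T(H)\otimes 1$ are read as zero: 1. $-(v_0\otimes1+1\otimes v_0)(v_I\otimes w_J)+(v_I\otimes w_J)(v_0\otimes1+1\otimes v_0)$; 2. $(\rho\otimes1)\bigl(\Delta(v_I)(1\otimes w_J)\bigr)+v_I\otimes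 w_J+(1\otimes\rho)\bigl((v_I\otimes1)\Delta(w_J)\bigr)$. Then there is an isomorphism of vector spaces $$\bigoplus_{s\ge0}\Omega_{s,2}(H)\;\cong\;[T^+(H)\otimes T^+(H)]_{\mathbb Z_2\times\mathbb Z_2}/\mathrm{Rel}$$ that sends the class $[v_1\cdots v_m\,|\,w_1\cdots w_n]\in\Omega_{m+n,2}(H)$ of the theta graph to the class of $v_1\cdots v_m\otimes w_1\cdots w_n$ (which is zero if $m=0$ or $n=0$), for all $v_1,\dots,v_m,w_1,\dots,w_n\in H$. Here the theta graph has a single tree, formed by two rooted planar binary trees $A$ and $B$ whose roots are joined to one edge, and two external edges $e,f$, with tails $e^-,f^-$ in $A$ and heads $e^+,f^+$ in $B$: $$A=\bigl[[v_1,[v_2,\dots,[v_m,e^-]\cdots]],\,f^-\bigr],\qquad B=\bigl[e^+,\,[w_1,[w_2,\dots,[w_n,f^+]\cdots]]\bigr],$$ where $[X,Y]$ is the rooted tree with branches $X,Y$ and cyclic order (root, $X$, $Y$) at its first vertex. -/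

import Mathlib

open scoped TensorProduct DirectSum

namespace HairyGraph

universe u v

/-! ### Hairy graphs -/

/-- Decorations of the univalent vertices of the trees of a hairy graph with external edges
numbered by `Fin n`: either a hair labelled by a vector `h : H`, or one of the two ends of an
external edge. Every external edge `e` is directed: `edge e false` is its tail (initial end) and
`edge e true` its head (terminal end). -/
inductive Leaf (H : Type v) (n : ℕ) : Type v
  | hair (h : H) : Leaf H n
  | edge (e : Fin n) (b : Bool) : Leaf H n

/-- A unitrivalent tree with a cyclic order at each trivalent vertex, univalent vertices decorated
by `X`, and one marked edge: cutting the marked edge gives two rooted planar binary trees.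
At an internal vertex `A * B` of a rooted tree the cyclic order is (root edge, `A`, `B`). The tree
itself, without the mark, is obtained by the relations `mark_symm` and `mark_move` below. -/
abbrev Tree (X : Type v) : Type v := FreeMagma X × FreeMagma X

/-- The multiset of leaves of a rooted planar binary tree. -/
def rootedLeaves {X : Type v} : FreeMagma X → Multiset X
  | .of x => {x}
  | .mul A B => rootedLeaves A + rootedLeaves B

/-- The multiset of decorations of the univalent vertices of a tree. -/
def Tree.leaves {X : Type v} (t : Tree X) : Multiset X := rootedLeaves t.1 + rootedLeaves t.2

/-- Change the decorations of the univalent vertices. -/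
def Tree.relabel {X Y : Type v} (f : X → Y) (t : Tree X) : Tree Y :=
  (FreeMagma.map f t.1, FreeMagma.map f t.2)

/-- The univalent vertices with decorations `m` form a hairy graph with `n` external edges and `s`
hairs: each of the two ends of each external edge occurs exactly once, and the remaining univalent
vertices are `s` labelled hairs. -/
def IsHairy {H : Type v} {n : ℕ} (s : ℕ) (m : Multiset (Leaf H n)) : Prop :=
  ∃ hs : Multiset H, hs.card = s ∧
    m = hs.map Leaf.hair +
      (Finset.univ : Finset (Fin n × Bool)).val.map (fun p => Leaf.edge p.1 p.2)

/-- Generators of `C_{1,r,s}`: hairy graphs with a single tree, `r` external edges (so that the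
first Betti number is `r`) and `s` hairs. -/
def Graph (H : Type v) (r s : ℕ) : Type v :=
  {t : Tree (Leaf H r) // IsHairy s t.leaves}

section Chains

variable (k : Type u) [Field k] {H : Type v} [AddCommGroup H] [Module k H]

open Classical in
/-- The generator given by a tree, and zero if the tree is not a hairy graph with `r` external
edges and `s` hairs. -/
noncomputable def gen (r s : ℕ) (t : Tree (Leaf H r)) : Graph H r s →₀ k :=
  if h : IsHairy s t.leaves then Finsupp.single ⟨t, h⟩ 1 else 0

/-- Reverse the direction of the external edge `e`. -/
def Leaf.reverse {n : ℕ} (e : Fin n) : Leaf H n → Leaf H n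
  | .hair h => .hair h
  | .edge f b => .edge f (if f = e then !b else b)

/-- Renumber the external edges. -/
def Leaf.renumber {n : ℕ} (π : Equiv.Perm (Fin n)) : Leaf H n → Leaf H n
  | .hair h => .hair h
  | .edge f b => .edge (π f) b

/-- The relations of `C_{1,r,s}`. As the marked edge can be moved anywhere in the tree, it is
enough to write the local relations next to the marked edge. -/
inductive ChainRel (r s : ℕ) : (Graph H r s →₀ k) → Prop
  /-- the marked edge has no direction -/
  | mark_symm (A B : FreeMagma (Leaf H r)) :
      ChainRel r s (gen k r s (A, B) - gen k r s (B, A))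
  /-- the marked edge can be moved across a trivalent vertex -/
  | mark_move (A B C : FreeMagma (Leaf H r)) :
      ChainRel r s (gen k r s (A * B, C) - gen k r s (A, B * C))
  /-- the external edges are not numbered -/
  | renumber (π : Equiv.Perm (Fin r)) (t : Tree (Leaf H r)) :
      ChainRel r s (gen k r s (t.relabel (Leaf.renumber π)) - gen k r s t)
  /-- switching the direction of an external edge gives a minus sign -/
  | reverse (e : Fin r) (t : Tree (Leaf H r)) :
      ChainRel r s (gen k r s (t.relabel (Leaf.reverse e)) + gen k r s t)
  /-- AS -/
  | antisymm (A B C : FreeMagma (Leaf H r)) :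
      ChainRel r s (gen k r s (A * B, C) + gen k r s (B * A, C))
  /-- IHX -/
  | ihx (A B C D : FreeMagma (Leaf H r)) :
      ChainRel r s (gen k r s ((A * B) * C, D) + gen k r s ((B * C) * A, D)
        + gen k r s ((C * A) * B, D))
  /-- multilinearity in the labels of the hairs -/
  | hair_add (h h' : H) (B : FreeMagma (Leaf H r)) :
      ChainRel r s (gen k r s (.of (.hair (h + h')), B) - gen k r s (.of (.hair h), B)
        - gen k r s (.of (.hair h'), B))
  | hair_smul (c : k) (h : H) (B : FreeMagma (Leaf H r)) :
      ChainRel r s (gen k r s (.of (.hair (c • h)), B) - c • gen k r s (.of (.hair h), B))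

variable (H) in
/-- `C_{1,r,s}`: the space of connected hairy graphs with one tree, first Betti number `r` and `s`
hairs. -/
abbrev Chains (r s : ℕ) : Type (max u v) :=
  (Graph H r s →₀ k) ⧸ Submodule.span k {x | ChainRel k r s x}

/-- The class of a hairy graph in `C_{1,r,s}`. -/
noncomputable def chain (r s : ℕ) (t : Tree (Leaf H r)) : Chains k H r s :=
  Submodule.Quotient.mk (gen k r s t)

end Chains

/-! ### The boundary of a hairy graph with two trees -/

open Classical in
/-- `cutAux x A C` looks in `A` for the univalent vertex `x` of the tree `(A, C)` and returns the
same tree rooted at `x`. -/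
noncomputable def cutAux {X : Type v} (x : X) : FreeMagma X → FreeMagma X → Option (FreeMagma X)
  | .of y, C => if y = x then some C else none
  | .mul A B, C => cutAux x A (B * C) <|> cutAux x B (C * A)

/-- The tree `t` rooted at its univalent vertex `x`; `none` if there is no such vertex. -/
noncomputable def Tree.cut {X : Type v} (x : X) (t : Tree X) : Option (FreeMagma X) :=
  cutAux x t.1 t.2 <|> cutAux x t.2 t.1

/-- In a rooted tree without ends of the external edge `e`, renumber the other external edges
monotonically by `Fin n`. -/
def dropEdge {H : Type v} {n : ℕ} (e : Fin (n + 1)) :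
    FreeMagma (Leaf H (n + 1)) → Option (FreeMagma (Leaf H n))
  | .of (.hair h) => some (.of (.hair h))
  | .of (.edge f b) => (finSuccEquiv' e f).map fun g => .of (.edge g b)
  | .mul A B => Option.map₂ (· * ·) (dropEdge e A) (dropEdge e B)

/-- Join two trees along the external edge `e`, whose end `b` lies on `t₁` and whose other end lies
on `t₂`; `none` if this is not where the ends of `e` are. -/
noncomputable def join {H : Type v} {n : ℕ} (e : Fin (n + 1)) (b : Bool)
    (t₁ t₂ : Tree (Leaf H (n + 1))) : Option (Tree (Leaf H n)) :=
  Option.map₂ Prod.mk ((t₁.cut (.edge e b)).bind (dropEdge e))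
    ((t₂.cut (.edge e !b)).bind (dropEdge e))

section Omega

variable (k : Type u) [Field k] {H : Type v} [AddCommGroup H] [Module k H]

/-- The boundary of the hairy graph with trees `t₁` (numbered 1) and `t₂` (numbered 2), `r + 1`
external edges and `s` hairs: the sum over the external edges that join the two trees of the hairy
graph in which this edge is contracted, with sign `+` if it is directed from `t₁` to `t₂` and `-`
if it is directed from `t₂` to `t₁`. -/
noncomputable def boundary (r s : ℕ) (t₁ t₂ : Tree (Leaf H (r + 1))) : Chains k H r s :=
  ∑ e : Fin (r + 1),
    ((join e false t₁ t₂).elim 0 (chain k r s) - (join e true t₁ t₂).elim 0 (chain k r s))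

/-- The tripod with univalent vertices `x`, `y`, `z` in this cyclic order. -/
def tripod {X : Type v} (x y z : X) : Tree X := (.of x, .of y * .of z)

/-- The tripods that occur in generators of `S₂`. In a hairy graph with two trees, one of them such
a tripod, the ends of external edges that do not pair on the tripod are joined to the other
tree. Up to rotation the tripod
* is joined to the other tree by all three legs, or
* is joined to it by two legs and has a hair, or
* has two legs joined to each other and is joined to the other tree by the third. -/
inductive IsS₂Tripod {H : Type v} {n : ℕ} : Tree (Leaf H n) → Prop
  | three (e f g : Fin n) (a b c : Bool) (hef : e ≠ f) (heg : e ≠ g) (hfg : f ≠ g) :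
      IsS₂Tripod (tripod (.edge e a) (.edge f b) (.edge g c))
  | two (e f : Fin n) (a b : Bool) (h : H) (hef : e ≠ f) :
      IsS₂Tripod (tripod (.edge e a) (.edge f b) (.hair h))
  | loop (e f : Fin n) (a b : Bool) (hef : e ≠ f) :
      IsS₂Tripod (tripod (.edge e a) (.edge f b) (.edge f !b))

variable (H) in
/-- `∂ S_{2,r,s}`. A connected hairy graph with two trees has first Betti number `r` when it has
`r + 1` external edges. Exchanging the numbers of the two trees changes the sign of the boundary,
so the tripod may be numbered 1. -/
noncomputable def boundaryS₂ (r s : ℕ) : Submodule k (Chains k H r s) :=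
  Submodule.span k {x | ∃ t₁ t₂ : Tree (Leaf H (r + 1)),
    IsHairy s (t₁.leaves + t₂.leaves) ∧ IsS₂Tripod t₁ ∧ x = boundary k r s t₁ t₂}

variable (H) in
/-- `Ω_{s,r}(H) = C_{1,r,s} / ∂ S_{2,r,s}`. -/
def Omega (s r : ℕ) : Type (max u v) := Chains k H r s ⧸ boundaryS₂ k H r s

noncomputable instance (s r : ℕ) : AddCommGroup (Omega k H s r) :=
  inferInstanceAs (AddCommGroup (Chains k H r s ⧸ boundaryS₂ k H r s))

noncomputable instance (s r : ℕ) : Module k (Omega k H s r) :=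
  inferInstanceAs (Module k (Chains k H r s ⧸ boundaryS₂ k H r s))

/-- The projection `C_{1,r,s} → Ω_{s,r}(H)`. -/
noncomputable def toOmega (s r : ℕ) : Chains k H r s →ₗ[k] Omega k H s r :=
  (boundaryS₂ k H r s).mkQ

/-- The rooted tree `v₁ * (v₂ * (⋯ * (v_m * x)))`: hairs `v₁, …, v_m` along the edge to `x`. -/
def comb {n : ℕ} (v : List H) (x : Leaf H n) : FreeMagma (Leaf H n) :=
  v.foldr (fun h A => .of (.hair h) * A) (.of x)

/-- The theta graph with hairs `v₁, …, v_m` along the first external edge, near its tail, and hairs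
`w₁, …, w_n` along the second one, near its head; both external edges are directed from the first
trivalent vertex of the core to the second one. -/
def thetaTree (v w : List H) : Tree (Leaf H 2) :=
  (comb v (.edge 0 false) * .of (.edge 1 false), .of (.edge 0 true) * comb w (.edge 1 true))

/-- The class `[v₁ ⋯ v_m | w₁ ⋯ w_n]` of the theta graph in `Ω_{m+n,2}(H)`. -/
noncomputable def theta (v w : List H) : Omega k H (v.length + w.length) 2 :=
  toOmega k (v.length + w.length) 2 (chain k 2 (v.length + w.length) (thetaTree v w))

end Omega

/-! ### The algebraic side -/

section Presentation

variable (k : Type u) [Field k] (H : Type v) [AddCommGroup H] [Module k H]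

/-- The positive degree part of the tensor algebra as a subspace: the kernel of the projection to
the degree zero part. -/
noncomputable def augmentation : Submodule k (TensorAlgebra k H) :=
  LinearMap.ker (TensorAlgebra.algebraMapInv : TensorAlgebra k H →ₐ[k] k).toLinearMap

/-- The positive degree part `T⁺(H)` of the tensor algebra. -/
def TPlus : Type (max u v) := augmentation k H

noncomputable instance : AddCommGroup (TPlus k H) :=
  inferInstanceAs (AddCommGroup (augmentation k H))

noncomputable instance : Module k (TPlus k H) :=
  inferInstanceAs (Module k (augmentation k H))

/-- The inclusion `T⁺(H) → T(H)`. -/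
noncomputable def inclPlus : TPlus k H →ₗ[k] TensorAlgebra k H :=
  (augmentation k H).subtype

/-- The projection `T(H) → T⁺(H)` that kills the unit. -/
noncomputable def projPlus : TensorAlgebra k H →ₗ[k] TPlus k H :=
  LinearMap.codRestrict (augmentation k H)
    (LinearMap.id - (Algebra.linearMap k (TensorAlgebra k H)) ∘ₗ
      (TensorAlgebra.algebraMapInv : TensorAlgebra k H →ₐ[k] k).toLinearMap)
    (fun x => by simp [augmentation])

/-- The projection `T(H) ⊗ T(H) → T⁺(H) ⊗ T⁺(H)` that kills `1 ⊗ T(H)` and `T(H) ⊗ 1`. -/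
noncomputable def projPlus₂ :
    TensorAlgebra k H ⊗[k] TensorAlgebra k H →ₗ[k] TPlus k H ⊗[k] TPlus k H :=
  TensorProduct.map (projPlus k H) (projPlus k H)

/-- The involution `ρ(v₁ ⋯ v_m) = (-1)^m v_m ⋯ v₁`: the algebra anti-homomorphism with
`ρ(v) = -v`. -/
noncomputable def rho : TensorAlgebra k H →ₗ[k] TensorAlgebra k H :=
  (MulOpposite.opLinearEquiv k).symm.toLinearMap ∘ₗ
    (TensorAlgebra.lift k
      (-((MulOpposite.opLinearEquiv k).toLinearMap ∘ₗ TensorAlgebra.ι k (M := H)))).toLinearMap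

/-- The coproduct `Δ(v_K) = ∑_{K = I ⊔ J} v_I ⊗ v_J`: the algebra homomorphism with
`Δ(v) = v ⊗ 1 + 1 ⊗ v`. -/
noncomputable def Delta :
    TensorAlgebra k H →ₐ[k] TensorAlgebra k H ⊗[k] TensorAlgebra k H :=
  TensorAlgebra.lift k
    ((TensorProduct.mk k _ _).flip 1 ∘ₗ TensorAlgebra.ι k (M := H) +
      TensorProduct.mk k _ _ 1 ∘ₗ TensorAlgebra.ι k (M := H))

/-- The involution `v ⊗ w ↦ ρ(v) ⊗ ρ(w)` of `T⁺(H) ⊗ T⁺(H)`. -/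
noncomputable def actRho : TPlus k H ⊗[k] TPlus k H →ₗ[k] TPlus k H ⊗[k] TPlus k H :=
  TensorProduct.map (projPlus k H ∘ₗ rho k H ∘ₗ inclPlus k H)
    (projPlus k H ∘ₗ rho k H ∘ₗ inclPlus k H)

/-- The involution `v ⊗ w ↦ ρ(w) ⊗ ρ(v)` of `T⁺(H) ⊗ T⁺(H)`. -/
noncomputable def actSwap : TPlus k H ⊗[k] TPlus k H →ₗ[k] TPlus k H ⊗[k] TPlus k H :=
  actRho k H ∘ₗ (TensorProduct.comm k (TPlus k H) (TPlus k H)).toLinearMap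

/-- The coinvariants of `T⁺(H) ⊗ T⁺(H)` under the group `ℤ/2 × ℤ/2` generated by the two commuting
involutions `actRho` and `actSwap`. -/
abbrev Coinv : Type (max u v) :=
  (TPlus k H ⊗[k] TPlus k H) ⧸ Submodule.span k
    ({x | ∃ y : TPlus k H ⊗[k] TPlus k H, x = y - actRho k H y} ∪
      {x | ∃ y : TPlus k H ⊗[k] TPlus k H, x = y - actSwap k H y})

/-- The first family of relators: the commutator of `v ⊗ w` with `v₀ ⊗ 1 + 1 ⊗ v₀`. -/
noncomputable def commRelator (v₀ : H) (v w : TensorAlgebra k H) :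
    TensorAlgebra k H ⊗[k] TensorAlgebra k H :=
  -((TensorAlgebra.ι k v₀ ⊗ₜ[k] 1 + 1 ⊗ₜ[k] TensorAlgebra.ι k v₀) * (v ⊗ₜ[k] w))
    + (v ⊗ₜ[k] w) * (TensorAlgebra.ι k v₀ ⊗ₜ[k] 1 + 1 ⊗ₜ[k] TensorAlgebra.ι k v₀)

/-- The second family of relators:
`(ρ ⊗ 1)(Δ(v)(1 ⊗ w)) + v ⊗ w + (1 ⊗ ρ)((v ⊗ 1)Δ(w))`. -/
noncomputable def triRelator (v w : TensorAlgebra k H) :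
    TensorAlgebra k H ⊗[k] TensorAlgebra k H :=
  (rho k H).rTensor (TensorAlgebra k H) (Delta k H v * (1 ⊗ₜ[k] w)) + v ⊗ₜ[k] w
    + (rho k H).lTensor (TensorAlgebra k H) ((v ⊗ₜ[k] 1) * Delta k H w)

/-- The subspace of relations in the coinvariants. The terms of a relator in `1 ⊗ T(H)` or
`T(H) ⊗ 1` are read as zero. -/
noncomputable def relations : Submodule k (Coinv k H) :=
  Submodule.span k
    ({x | ∃ (v₀ : H) (v w : TPlus k H),
        x = Submodule.Quotient.mk
          (projPlus₂ k H (commRelator k H v₀ (inclPlus k H v) (inclPlus k H w)))} ∪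
      {x | ∃ v w : TPlus k H,
        x = Submodule.Quotient.mk
          (projPlus₂ k H (triRelator k H (inclPlus k H v) (inclPlus k H w)))})

/-- `[T⁺(H) ⊗ T⁺(H)]_{ℤ/2 × ℤ/2} / Rel`. -/
abbrev Presentation : Type (max u v) := Coinv k H ⧸ relations k H

variable {H}

/-- The class of `v₁ ⋯ v_m ⊗ w₁ ⋯ w_n`; it is zero if one of the two words is empty. -/
noncomputable def wordClass (v w : List H) : Presentation k H :=
  Submodule.Quotient.mk (Submodule.Quotient.mk (projPlus₂ k H
    ((v.map (TensorAlgebra.ι k)).prod ⊗ₜ[k] (w.map (TensorAlgebra.ι k)).prod)))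

end Presentation

end HairyGraph

/-!
A functional on trees that does not depend on the marked edge and satisfies AS and IHX is the same
thing as an invariant symmetric bilinear form on the free Lie algebra on the labels of the univalent
vertices. Hairs act on such a form through the tensor algebra, with `ρ` as the adjoint, so in genus
two a form is determined by its values on theta graphs with hairs along all four half-edges. If it
vanishes on `∂S₂`, then the tripods with a hair let the hairs slide along the external edges, which
leaves a linear map on `T(H) ⊗ T(H)`; the tripods with three and with one leg joined to the other
tree, and the invariance of the form, say that this map factors through the presentation.

Conversely, such a linear map is realised by a form. On the words in the labels of the hairs and of
the four ends of the external edges, let a hair act through the tensor algebra and let an end record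
its position; pairing the resulting operators gives an invariant form, and averaging it over the
numberings and directions of the external edges gives a form that vanishes on `∂S₂` and has the
prescribed theta values. Applied to the universal linear map and to the universal form, the two
constructions are inverse to each other.
-/

namespace HairyGraph

universe u v w

/-- A function on trees with a marked edge that does not depend on the mark and satisfies AS and
IHX. -/
structure TreeForm (X : Type v) (W : Type w) [AddCommGroup W] where
  /-- The value on the tree obtained by joining two rooted trees. -/
  toFun : FreeMagma X → FreeMagma X → W
  symm : ∀ A B, toFun A B = toFun B A
  move : ∀ A B C, toFun (A * B) C = toFun A (B * C)
  antisymm : ∀ A B C, toFun (A * B) C + toFun (B * A) C = 0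
  ihx : ∀ A B C D, toFun ((A * B) * C) D + toFun ((B * C) * A) D + toFun ((C * A) * B) D = 0

namespace TreeForm

section LieQuotient

open scoped MonoidAlgebra

variable (R : Type u) [CommRing R] {X : Type v} {W : Type w} [AddCommGroup W] [Module R W]
  (φ : TreeForm X W)

/-- The bilinear extension of a tree form to linear combinations of rooted trees. -/
noncomputable def preForm :
    R[FreeMagma X] →ₗ[R] R[FreeMagma X] →ₗ[R] W :=
  (Finsupp.linearCombination R fun A => Finsupp.linearCombination R (φ.toFun A)).compl₁₂
    (MonoidAlgebra.coeffLinearEquiv R).toLinearMap (MonoidAlgebra.coeffLinearEquiv R).toLinearMap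

@[simp] theorem preForm_single (A B : FreeMagma X) :
    preForm R φ (.single A 1) (.single B 1) = φ.toFun A B := by
  simp [preForm]

theorem preForm_symm (a b : R[FreeMagma X]) :
    preForm R φ a b = preForm R φ b a := by
  have h : preForm R φ = (preForm R φ).flip := by
    ext A B
    simpa using φ.symm A B
  exact LinearMap.congr_fun₂ h a b

theorem preForm_mul (a b c : R[FreeMagma X]) :
    preForm R φ (a * b) c = preForm R φ a (b * c) := by
  have h : (LinearMap.mul R R[FreeMagma X]).compr₂ (preForm R φ) =
      LinearMap.lcomp R _ (LinearMap.mul R R[FreeMagma X]) ∘ₗ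
        LinearMap.llcomp R R[FreeMagma X] R[FreeMagma X] W ∘ₗ preForm R φ := by
    ext A B C
    simpa [MonoidAlgebra.single_mul_single] using φ.move A B C
  exact LinearMap.congr_fun (LinearMap.congr_fun₂ h a b) c

/-- The radical of a tree form. -/
noncomputable def radical : Submodule R (R[FreeMagma X]) :=
  LinearMap.ker (preForm R φ)

variable {R φ} in
theorem mem_radical {a : R[FreeMagma X]} :
    a ∈ radical R φ ↔ ∀ b, preForm R φ a b = 0 := by
  simp only [radical, LinearMap.mem_ker, LinearMap.ext_iff, LinearMap.zero_apply]

variable {R φ} in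
theorem mem_radical_of_forall_single {a : R[FreeMagma X]}
    (h : ∀ B, preForm R φ a (.single B 1) = 0) : a ∈ radical R φ := by
  refine LinearMap.mem_ker.2 ?_
  ext B
  simpa using h B

/-- The Lie algebra of rooted trees modulo the radical of a tree form. -/
def LieQuotient : Type (max u v) := R[FreeMagma X] ⧸ radical R φ

noncomputable instance : AddCommGroup (LieQuotient R φ) :=
  inferInstanceAs (AddCommGroup (R[FreeMagma X] ⧸ radical R φ))

noncomputable instance : Module R (LieQuotient R φ) :=
  inferInstanceAs (Module R (R[FreeMagma X] ⧸ radical R φ))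

/-- The class of a linear combination of rooted trees. -/
noncomputable def lieMk : R[FreeMagma X] →ₗ[R] LieQuotient R φ := (radical R φ).mkQ

theorem lieMk_surjective : Function.Surjective (lieMk R φ) := Submodule.mkQ_surjective _

variable {R φ} in
theorem lieMk_eq_zero {a : R[FreeMagma X]} : lieMk R φ a = 0 ↔ a ∈ radical R φ :=
  Submodule.Quotient.mk_eq_zero _

theorem lieMk_mul_add_swap (a b : R[FreeMagma X]) :
    lieMk R φ (a * b) + lieMk R φ (b * a) = 0 := by
  let μ := (LinearMap.mul R R[FreeMagma X]).compr₂ (lieMk R φ)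
  suffices h : μ + μ.flip = 0 from LinearMap.congr_fun₂ h a b
  ext A B
  suffices h : lieMk R φ (.single (A * B) 1 + .single (B * A) 1) = 0 by
    simpa [μ, MonoidAlgebra.single_mul_single] using h
  exact lieMk_eq_zero.2 (mem_radical_of_forall_single fun C => by simpa using φ.antisymm A B C)

theorem lieMk_mul_mul (a b c : R[FreeMagma X]) :
    lieMk R φ (a * (b * c)) = lieMk R φ (a * b * c) + lieMk R φ (b * (a * c)) := by
  let μ := LinearMap.mul R (R[FreeMagma X])
  let ν : R[FreeMagma X] →ₗ[R] R[FreeMagma X] →ₗ[R] R[FreeMagma X] →ₗ[R] R[FreeMagma X] :=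
    (LinearMap.mul R (Module.End R R[FreeMagma X])).compl₁₂ μ μ
  let γ : (R[FreeMagma X] →ₗ[R] R[FreeMagma X]) →ₗ[R] R[FreeMagma X] →ₗ[R] LieQuotient R φ :=
    (lieMk R φ).compRight R
  suffices h : ν.compr₂ γ = (μ.compr₂ μ + ν.flip).compr₂ γ by
    simpa [μ, ν, γ] using LinearMap.congr_fun (LinearMap.congr_fun₂ h a b) c
  ext A B C
  suffices h : lieMk R φ (.single (A * (B * C)) 1 - (.single (A * B * C) 1 +
      .single (B * (A * C)) 1)) = 0 by
    simpa [μ, ν, γ, MonoidAlgebra.single_mul_single, sub_eq_zero] using h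
  refine lieMk_eq_zero.2 (mem_radical_of_forall_single fun D => ?_)
  have h₁ := φ.antisymm A (B * C) D
  have h₂ := φ.antisymm B (A * C) D
  have h₃ := φ.antisymm A C (B * D)
  rw [← φ.move, ← φ.move] at h₃
  simp only [map_sub, map_add, LinearMap.sub_apply, LinearMap.add_apply, preForm_single]
  linear_combination (norm := abel) h₁ - h₂ + h₃ - φ.ihx A B C D

theorem mul_mem_radical_left {a : R[FreeMagma X]} (ha : a ∈ radical R φ)
    (b : R[FreeMagma X]) : a * b ∈ radical R φ :=
  mem_radical.2 fun c => by rw [preForm_mul, mem_radical.1 ha]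

theorem mul_mem_radical_right (a : R[FreeMagma X])
    {b : R[FreeMagma X]} (hb : b ∈ radical R φ) : a * b ∈ radical R φ := by
  rw [← lieMk_eq_zero]
  simpa [lieMk_eq_zero.2 (mul_mem_radical_left R φ hb a)] using lieMk_mul_add_swap R φ a b

/-- The bracket of the Lie algebra of a tree form. -/
noncomputable def bracketMap : LieQuotient R φ →ₗ[R] LieQuotient R φ →ₗ[R] LieQuotient R φ :=
  ((LinearMap.mul R _).compr₂ (lieMk R φ)).liftQ₂ (radical R φ) (radical R φ)
    (fun _ ha => LinearMap.ext fun b => lieMk_eq_zero.2 (mul_mem_radical_left R φ ha b))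
    (fun _ hb => LinearMap.ext fun a => lieMk_eq_zero.2 (mul_mem_radical_right R φ a hb))

theorem bracketMap_lieMk (a b : R[FreeMagma X]) :
    bracketMap R φ (lieMk R φ a) (lieMk R φ b) = lieMk R φ (a * b) := rfl

/-- The invariant form of the Lie algebra of a tree form. -/
noncomputable def form : LieQuotient R φ →ₗ[R] LieQuotient R φ →ₗ[R] W :=
  (preForm R φ).liftQ₂ (radical R φ) (radical R φ) (fun _ ha => ha)
    (fun _ hb => LinearMap.ext fun a => (preForm_symm R φ a _).trans (mem_radical.1 hb a))

theorem form_lieMk (a b : R[FreeMagma X]) :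
    form R φ (lieMk R φ a) (lieMk R φ b) = preForm R φ a b := rfl

theorem form_symm (a b : LieQuotient R φ) : form R φ a b = form R φ b a := by
  obtain ⟨a, rfl⟩ := lieMk_surjective R φ a
  obtain ⟨b, rfl⟩ := lieMk_surjective R φ b
  exact preForm_symm R φ a b

theorem eq_zero_of_form_eq_zero {a : LieQuotient R φ} (h : ∀ b, form R φ a b = 0) : a = 0 := by
  obtain ⟨a, rfl⟩ := lieMk_surjective R φ a
  exact lieMk_eq_zero.2 (mem_radical.2 fun b => h (lieMk R φ b))

/-- The element of the Lie algebra given by a leaf. -/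
noncomputable def leaf (x : X) : LieQuotient R φ := lieMk R φ (.single (.of x) 1)

variable [Invertible (2 : R)]

noncomputable instance : LieRing (LieQuotient R φ) where
  bracket a b := bracketMap R φ a b
  add_lie a b c := by simp
  lie_add a b c := by simp
  lie_self a := by
    obtain ⟨a, rfl⟩ := lieMk_surjective R φ a
    have h := lieMk_mul_add_swap R φ a a
    rw [← two_smul R] at h
    exact (isUnit_of_invertible (2 : R)).smul_eq_zero.1 h
  leibniz_lie a b c := by
    obtain ⟨a, rfl⟩ := lieMk_surjective R φ a
    obtain ⟨b, rfl⟩ := lieMk_surjective R φ b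
    obtain ⟨c, rfl⟩ := lieMk_surjective R φ c
    exact lieMk_mul_mul R φ a b c

noncomputable instance : LieAlgebra R (LieQuotient R φ) where
  lie_smul c a b := map_smul (bracketMap R φ a) c b

theorem form_lie (a b c : LieQuotient R φ) : form R φ ⁅a, b⁆ c = form R φ a ⁅b, c⁆ := by
  obtain ⟨a, rfl⟩ := lieMk_surjective R φ a
  obtain ⟨b, rfl⟩ := lieMk_surjective R φ b
  obtain ⟨c, rfl⟩ := lieMk_surjective R φ c
  exact preForm_mul R φ a b c

end LieQuotient

end TreeForm

section LieEval

variable {X : Type v} {L : Type w} [LieRing L]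

/-- The value of a rooted tree in a Lie ring, given the values of its leaves. -/
def lieEval (ψ : X → L) : FreeMagma X → L
  | .of x => ψ x
  | .mul A B => ⁅lieEval ψ A, lieEval ψ B⁆

@[simp] theorem lieEval_of (ψ : X → L) (x : X) : lieEval ψ (.of x) = ψ x := rfl

@[simp] theorem lieEval_mul (ψ : X → L) (A B : FreeMagma X) :
    lieEval ψ (A * B) = ⁅lieEval ψ A, lieEval ψ B⁆ := rfl

theorem lieEval_map {Y : Type*} (g : Y → X) (ψ : X → L) (A : FreeMagma Y) :
    lieEval ψ (FreeMagma.map g A) = lieEval (ψ ∘ g) A := by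
  induction A with
  | ih1 x => rfl
  | ih2 A B hA hB => rw [map_mul, lieEval_mul, lieEval_mul, hA, hB]

@[simp] theorem rootedLeaves_of (x : X) : rootedLeaves (.of x) = {x} := rfl

@[simp] theorem rootedLeaves_mul (A B : FreeMagma X) :
    rootedLeaves (A * B) = rootedLeaves A + rootedLeaves B := rfl

end LieEval

namespace TreeForm

variable (R : Type u) [CommRing R] [Invertible (2 : R)] {X : Type v} {W : Type w}
  [AddCommGroup W] [Module R W] (φ : TreeForm X W)

theorem lieEval_leaf (A : FreeMagma X) : lieEval (leaf R φ) A = lieMk R φ (.single A 1) := by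
  induction A with
  | ih1 x => rfl
  | ih2 A B hA hB =>
    rw [lieEval_mul, hA, hB]
    exact (bracketMap_lieMk R φ _ _).trans (by simp [MonoidAlgebra.single_mul_single])

theorem toFun_eq_form (A B : FreeMagma X) :
    φ.toFun A B = form R φ (lieEval (leaf R φ) A) (lieEval (leaf R φ) B) := by
  rw [lieEval_leaf, lieEval_leaf, form_lieMk, preForm_single]

variable {R φ} in
theorem lieQuotient_hom_ext {M : Type*} [AddCommGroup M] [Module R M]
    {f g : LieQuotient R φ →ₗ[R] M}
    (h : ∀ A, f (lieEval (leaf R φ) A) = g (lieEval (leaf R φ) A)) : f = g := by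
  refine LinearMap.ext fun a => ?_
  obtain ⟨a, rfl⟩ := lieMk_surjective R φ a
  have hfg : f ∘ₗ lieMk R φ = g ∘ₗ lieMk R φ := by
    ext A
    simpa [lieEval_leaf] using h A
  exact LinearMap.congr_fun hfg a

variable {R φ} in
theorem lieQuotient_ext {a b : LieQuotient R φ}
    (h : ∀ A, form R φ a (lieEval (leaf R φ) A) = form R φ b (lieEval (leaf R φ) A)) : a = b := by
  refine sub_eq_zero.1 (eq_zero_of_form_eq_zero R φ fun c => ?_)
  rw [map_sub, lieQuotient_hom_ext h, sub_self, LinearMap.zero_apply]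

end TreeForm

section Words

variable (R : Type u) [CommSemiring R] {M : Type v} [AddCommMonoid M] [Module R M]

/-- The product in the tensor algebra of the letters of a word. -/
noncomputable def word (v : List M) : TensorAlgebra R M := (v.map (TensorAlgebra.ι R)).prod

@[simp] theorem word_nil : word R ([] : List M) = 1 := rfl

@[simp] theorem word_cons (h : M) (v : List M) :
    word R (h :: v) = TensorAlgebra.ι R h * word R v := by simp [word]

theorem span_range_word : Submodule.span R (Set.range (word R (M := M))) = ⊤ := by
  have h : Set.range (word R (M := M)) =
      Submonoid.closure (Set.range (TensorAlgebra.ι R (M := M))) := by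
    rw [← FreeMonoid.mrange_lift, MonoidHom.coe_mrange]
    exact congrArg Set.range (funext fun v => (FreeMonoid.lift_apply _ _).symm)
  rw [h, ← Algebra.adjoin_eq_span, TensorAlgebra.adjoin_range_ι, Algebra.top_toSubmodule]

variable {R}

theorem word_induction {p : TensorAlgebra R M → Prop} (word : ∀ v, p (word R v))
    (add : ∀ x y, p x → p y → p (x + y)) (smul : ∀ (c : R) x, p x → p (c • x)) (x) : p x := by
  have hx : x ∈ Submodule.span R (Set.range (HairyGraph.word R (M := M))) := by
    rw [span_range_word]; trivial
  induction hx using Submodule.span_induction with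
  | mem y hy => obtain ⟨v, rfl⟩ := hy; exact word v
  | zero => simpa using smul 0 _ (word [])
  | add x y _ _ hx hy => exact add x y hx hy
  | smul c x _ hx => exact smul c x hx

theorem left_induction {p : TensorAlgebra R M → Prop} (one : p 1)
    (ι_mul : ∀ h x, p x → p (TensorAlgebra.ι R h * x))
    (add : ∀ x y, p x → p y → p (x + y)) (smul : ∀ (c : R) x, p x → p (c • x)) (x) : p x := by
  refine word_induction (fun v => ?_) add smul x
  induction v with
  | nil => exact one
  | cons h v ih => rw [word_cons]; exact ι_mul h _ ih

end Words

section Coproduct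

variable (k : Type u) [Field k] {H : Type v} [AddCommGroup H] [Module k H]

@[simp] theorem rho_one : rho k H 1 = 1 := by simp [rho]

@[simp] theorem rho_ι (h : H) : rho k H (TensorAlgebra.ι k h) = -TensorAlgebra.ι k h := by
  simp [rho]

@[simp] theorem rho_mul (x y : TensorAlgebra k H) : rho k H (x * y) = rho k H y * rho k H x := by
  simp [rho]

@[simp] theorem rho_rho (x : TensorAlgebra k H) : rho k H (rho k H x) = x := by
  induction x using left_induction with
  | one => simp
  | ι_mul h x hx => simp [hx]
  | add x y hx hy => simp [hx, hy]
  | smul c x hx => simp [hx]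

theorem rho_comp_rho : rho k H ∘ₗ rho k H = LinearMap.id := LinearMap.ext (rho_rho k)

@[simp] theorem Delta_ι (h : H) : Delta k H (TensorAlgebra.ι k h) =
    TensorAlgebra.ι k h ⊗ₜ[k] 1 + 1 ⊗ₜ[k] TensorAlgebra.ι k h := by
  simp [Delta]

theorem comm_Delta (x : TensorAlgebra k H) :
    TensorProduct.comm k _ _ (Delta k H x) = Delta k H x := by
  have h : (Algebra.TensorProduct.comm k (TensorAlgebra k H) (TensorAlgebra k H)).toAlgHom.comp
      (Delta k H) = Delta k H := by
    ext h
    simp [add_comm]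
  exact DFunLike.congr_fun h x

theorem map_rho_mul (x y : TensorAlgebra k H ⊗[k] TensorAlgebra k H) :
    TensorProduct.map (rho k H) (rho k H) (x * y) =
      TensorProduct.map (rho k H) (rho k H) y * TensorProduct.map (rho k H) (rho k H) x := by
  induction x using TensorProduct.induction_on with
  | zero => simp
  | add a b ha hb => simp [add_mul, mul_add, ha, hb]
  | tmul a b =>
    induction y using TensorProduct.induction_on with
    | zero => simp
    | add a b ha hb => simp [add_mul, mul_add, ha, hb]
    | tmul c d => simp

theorem Delta_rho (x : TensorAlgebra k H) :
    Delta k H (rho k H x) = TensorProduct.map (rho k H) (rho k H) (Delta k H x) := by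
  induction x using left_induction with
  | one => simp [Algebra.TensorProduct.one_def]
  | ι_mul h x hx =>
    simp only [rho_mul, rho_ι, map_mul, map_neg, Delta_ι, map_rho_mul, map_add, hx,
      TensorProduct.map_tmul, rho_one, TensorProduct.neg_tmul, TensorProduct.tmul_neg, neg_add]
  | add x y hx hy => simp [hx, hy]
  | smul c x hx => simp [hx]

end Coproduct

section PositiveDegree

variable {k : Type u} [Field k] {H : Type v} [AddCommGroup H] [Module k H]

theorem inclPlus_projPlus (x : TensorAlgebra k H) :
    inclPlus k H (projPlus k H x) =
      x - TensorAlgebra.algebraMapInv (R := k) x • (1 : TensorAlgebra k H) := by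
  rw [← Algebra.algebraMap_eq_smul_one]; rfl

theorem projPlus_inclPlus (x : TPlus k H) : projPlus k H (inclPlus k H x) = x := by
  have hx : (TensorAlgebra.algebraMapInv : TensorAlgebra k H →ₐ[k] k) (inclPlus k H x) = 0 := x.2
  exact Subtype.ext <|
    (inclPlus_projPlus (inclPlus k H x)).trans (by rw [hx, zero_smul, sub_zero]; rfl)

@[simp] theorem projPlus_one : projPlus k H 1 = 0 :=
  Subtype.ext <| (inclPlus_projPlus 1).trans (by rw [map_one, one_smul, sub_self]; rfl)

theorem inclPlus_projPlus_ι (h : H) :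
    inclPlus k H (projPlus k H (TensorAlgebra.ι k h)) = TensorAlgebra.ι k h := by
  simp [inclPlus_projPlus, TensorAlgebra.algebraMapInv]

theorem eq_inclPlus_add_smul_one (x : TensorAlgebra k H) :
    x = inclPlus k H (projPlus k H x) +
      TensorAlgebra.algebraMapInv (R := k) x • (1 : TensorAlgebra k H) := by
  rw [inclPlus_projPlus, sub_add_cancel]

variable {W : Type w} [AddCommGroup W] [Module k W]

theorem bilinear_ext_inclPlus {F G : TensorAlgebra k H →ₗ[k] TensorAlgebra k H →ₗ[k] W}
    (one_left : ∀ w, F 1 w = G 1 w) (one_right : ∀ v, F v 1 = G v 1)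
    (plus : ∀ v w, F (inclPlus k H v) (inclPlus k H w) = G (inclPlus k H v) (inclPlus k H w)) :
    F = G := by
  ext1 v
  ext1 w
  rw [eq_inclPlus_add_smul_one v, eq_inclPlus_add_smul_one w]
  simp only [map_add, map_smul, LinearMap.add_apply, LinearMap.smul_apply, one_left, one_right,
    plus]

variable (k H) in
/-- The inclusion `T⁺(H) ⊗ T⁺(H) → T(H) ⊗ T(H)`. -/
noncomputable def inclPlus₂ :
    TPlus k H ⊗[k] TPlus k H →ₗ[k] TensorAlgebra k H ⊗[k] TensorAlgebra k H :=
  TensorProduct.map (inclPlus k H) (inclPlus k H)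

theorem projPlus₂_inclPlus₂ (x : TPlus k H ⊗[k] TPlus k H) :
    projPlus₂ k H (inclPlus₂ k H x) = x := by
  have h : projPlus k H ∘ₗ inclPlus k H = LinearMap.id := LinearMap.ext projPlus_inclPlus
  rw [projPlus₂, inclPlus₂, ← LinearMap.comp_apply, ← TensorProduct.map_comp, h,
    TensorProduct.map_id, LinearMap.id_apply]

theorem actRho_eq (x : TPlus k H ⊗[k] TPlus k H) :
    actRho k H x = projPlus₂ k H (TensorProduct.map (rho k H) (rho k H) (inclPlus₂ k H x)) := by
  rw [actRho, TensorProduct.map_comp, TensorProduct.map_comp]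
  rfl

theorem inclPlus₂_comm (x : TPlus k H ⊗[k] TPlus k H) :
    inclPlus₂ k H (TensorProduct.comm k _ _ x) = TensorProduct.comm k _ _ (inclPlus₂ k H x) :=
  TensorProduct.map_comm _ _ _

theorem tensor_ext_inclPlus₂ {F G : TensorAlgebra k H ⊗[k] TensorAlgebra k H →ₗ[k] W}
    (one_left : ∀ w, F (1 ⊗ₜ w) = G (1 ⊗ₜ w)) (one_right : ∀ v, F (v ⊗ₜ 1) = G (v ⊗ₜ 1))
    (plus : ∀ x, F (inclPlus₂ k H x) = G (inclPlus₂ k H x)) : F = G := by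
  have h : (TensorProduct.mk k _ _).compr₂ F = (TensorProduct.mk k _ _).compr₂ G :=
    bilinear_ext_inclPlus one_left one_right fun v w => plus (v ⊗ₜ w)
  exact TensorProduct.ext h

theorem apply_inclPlus₂_projPlus₂ {F : TensorAlgebra k H ⊗[k] TensorAlgebra k H →ₗ[k] W}
    (one_left : ∀ w, F (1 ⊗ₜ w) = 0) (one_right : ∀ v, F (v ⊗ₜ 1) = 0)
    (x : TensorAlgebra k H ⊗[k] TensorAlgebra k H) :
    F (inclPlus₂ k H (projPlus₂ k H x)) = F x := by
  have h : F ∘ₗ inclPlus₂ k H ∘ₗ projPlus₂ k H = F :=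
    tensor_ext_inclPlus₂ (fun w => by simp [projPlus₂, one_left])
      (fun v => by simp [projPlus₂, one_right]) fun x => by simp [projPlus₂_inclPlus₂]
  exact LinearMap.congr_fun h x

end PositiveDegree

section ThetaMap

variable {k : Type u} [Field k] {H : Type v} [AddCommGroup H] [Module k H]
  {W : Type w} [AddCommGroup W] [Module k W]

/-- A linear map on `T(H) ⊗ T(H)` that satisfies the relations of the presentation: it is a linear
map on the presentation (`IsThetaMap.lift`). -/
structure IsThetaMap (F : TensorAlgebra k H ⊗[k] TensorAlgebra k H →ₗ[k] W) : Prop where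
  one_left : ∀ w, F (1 ⊗ₜ w) = 0
  one_right : ∀ v, F (v ⊗ₜ 1) = 0
  map_rho : ∀ x, F (TensorProduct.map (rho k H) (rho k H) x) = F x
  comm : ∀ x, F (TensorProduct.comm k _ _ x) = F x
  commRelator : ∀ h v w, F (commRelator k H h v w) = 0
  triRelator : ∀ v w, F (triRelator k H v w) = 0

namespace IsThetaMap

variable {F : TensorAlgebra k H ⊗[k] TensorAlgebra k H →ₗ[k] W} (hF : IsThetaMap F)

include hF

theorem apply_actRho (x : TPlus k H ⊗[k] TPlus k H) :
    F (inclPlus₂ k H (actRho k H x)) = F (inclPlus₂ k H x) := by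
  rw [actRho_eq, apply_inclPlus₂_projPlus₂ hF.one_left hF.one_right, hF.map_rho]

theorem apply_actSwap (x : TPlus k H ⊗[k] TPlus k H) :
    F (inclPlus₂ k H (actSwap k H x)) = F (inclPlus₂ k H x) :=
  (hF.apply_actRho _).trans <| (congrArg F (inclPlus₂_comm x)).trans (hF.comm _)

/-- The linear map on the coinvariants induced by a theta map. -/
noncomputable def liftCoinv : Coinv k H →ₗ[k] W :=
  Submodule.liftQ _ (F ∘ₗ inclPlus₂ k H) <| Submodule.span_le.2 <| by
    rintro _ (⟨y, rfl⟩ | ⟨y, rfl⟩)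
    · simp [hF.apply_actRho]
    · simp [hF.apply_actSwap]

theorem liftCoinv_mk_projPlus₂ (x : TensorAlgebra k H ⊗[k] TensorAlgebra k H) :
    hF.liftCoinv (Submodule.Quotient.mk (projPlus₂ k H x)) = F x :=
  apply_inclPlus₂_projPlus₂ hF.one_left hF.one_right x

/-- The linear map on the presentation induced by a theta map. -/
noncomputable def lift : Presentation k H →ₗ[k] W :=
  (relations k H).liftQ hF.liftCoinv <| Submodule.span_le.2 <| by
    rintro _ (⟨h, v, w, rfl⟩ | ⟨v, w, rfl⟩)
    · exact (hF.liftCoinv_mk_projPlus₂ _).trans (hF.commRelator _ _ _)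
    · exact (hF.liftCoinv_mk_projPlus₂ _).trans (hF.triRelator _ _)

end IsThetaMap

variable (k H) in
/-- The projection from `T(H) ⊗ T(H)` to the presentation. -/
noncomputable def presentationMk :
    TensorAlgebra k H ⊗[k] TensorAlgebra k H →ₗ[k] Presentation k H :=
  (relations k H).mkQ ∘ₗ Submodule.mkQ _ ∘ₗ projPlus₂ k H

theorem IsThetaMap.lift_presentationMk
    {F : TensorAlgebra k H ⊗[k] TensorAlgebra k H →ₗ[k] W} (hF : IsThetaMap F)
    (x : TensorAlgebra k H ⊗[k] TensorAlgebra k H) : hF.lift (presentationMk k H x) = F x :=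
  hF.liftCoinv_mk_projPlus₂ x

theorem presentationMk_word (v w : List H) :
    presentationMk k H (word k v ⊗ₜ[k] word k w) = wordClass k v w := rfl

@[simp] theorem presentationMk_one_left (w : TensorAlgebra k H) :
    presentationMk k H (1 ⊗ₜ[k] w) = 0 := by
  simp [presentationMk, projPlus₂]

@[simp] theorem presentationMk_one_right (v : TensorAlgebra k H) :
    presentationMk k H (v ⊗ₜ[k] 1) = 0 := by
  simp [presentationMk, projPlus₂]

theorem presentationMk_inclPlus₂ (x : TPlus k H ⊗[k] TPlus k H) :
    presentationMk k H (inclPlus₂ k H x) = (relations k H).mkQ (Submodule.Quotient.mk x) := by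
  rw [presentationMk, LinearMap.comp_apply, LinearMap.comp_apply, projPlus₂_inclPlus₂]
  rfl

theorem presentationMk_surjective : Function.Surjective (presentationMk k H) := by
  intro y
  obtain ⟨x, rfl⟩ := Submodule.mkQ_surjective _ y
  obtain ⟨x, rfl⟩ := Submodule.Quotient.mk_surjective _ x
  exact ⟨inclPlus₂ k H x, presentationMk_inclPlus₂ x⟩

theorem presentationMk_map_rho (x : TensorAlgebra k H ⊗[k] TensorAlgebra k H) :
    presentationMk k H (TensorProduct.map (rho k H) (rho k H) x) = presentationMk k H x := by
  suffices h : presentationMk k H ∘ₗ TensorProduct.map (rho k H) (rho k H) =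
      presentationMk k H from LinearMap.congr_fun h x
  refine tensor_ext_inclPlus₂ (fun w => by simp) (fun v => by simp) fun x => ?_
  have hx : (Submodule.Quotient.mk x : Coinv k H) = Submodule.Quotient.mk (actRho k H x) :=
    (Submodule.Quotient.eq _).2 (Submodule.subset_span (Or.inl ⟨x, rfl⟩))
  rw [presentationMk_inclPlus₂, hx, actRho_eq]
  rfl

theorem presentationMk_comm (x : TensorAlgebra k H ⊗[k] TensorAlgebra k H) :
    presentationMk k H (TensorProduct.comm k _ _ x) = presentationMk k H x := by
  suffices h : presentationMk k H ∘ₗ (TensorProduct.comm k _ _).toLinearMap =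
      presentationMk k H from LinearMap.congr_fun h x
  refine tensor_ext_inclPlus₂ (fun w => by simp) (fun v => by simp) fun x => ?_
  have hx : (Submodule.Quotient.mk x : Coinv k H) = Submodule.Quotient.mk (actSwap k H x) :=
    (Submodule.Quotient.eq _).2 (Submodule.subset_span (Or.inr ⟨x, rfl⟩))
  rw [LinearMap.comp_apply, LinearEquiv.coe_coe, ← inclPlus₂_comm, ← presentationMk_map_rho,
    presentationMk_inclPlus₂, hx]
  exact congrArg (fun y => (relations k H).mkQ (Submodule.Quotient.mk y)) (actRho_eq _).symm

theorem presentationMk_commRelator (h : H) (v w : TensorAlgebra k H) :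
    presentationMk k H (commRelator k H h v w) = 0 := by
  let D : TensorAlgebra k H ⊗[k] TensorAlgebra k H :=
    TensorAlgebra.ι k h ⊗ₜ[k] 1 + 1 ⊗ₜ[k] TensorAlgebra.ι k h
  let F := (TensorProduct.mk k _ _).compr₂
    (presentationMk k H ∘ₗ (-LinearMap.mulLeft k D + LinearMap.mulRight k D))
  suffices hF : F = 0 from LinearMap.congr_fun₂ hF v w
  refine bilinear_ext_inclPlus (fun w => ?_) (fun v => ?_) fun v w => ?_
  · simp [F, D, add_mul, mul_add]
  · simp [F, D, add_mul, mul_add]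
  · exact (Submodule.Quotient.mk_eq_zero _).2 (Submodule.subset_span (Or.inl ⟨_, _, _, rfl⟩))

theorem presentationMk_triRelator_inclPlus (v w : TPlus k H) :
    presentationMk k H (triRelator k H (inclPlus k H v) (inclPlus k H w)) = 0 :=
  (Submodule.Quotient.mk_eq_zero _).2 (Submodule.subset_span (Or.inr ⟨_, _, rfl⟩))

theorem presentationMk_lTensor_rho_ι_mul_Delta (h : H) (w : TensorAlgebra k H) :
    presentationMk k H
      ((rho k H).lTensor _ ((TensorAlgebra.ι k h ⊗ₜ[k] 1) * Delta k H w)) = 0 := by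
  have hplus : ∀ w : TPlus k H, presentationMk k H
      ((rho k H).lTensor _ ((TensorAlgebra.ι k h ⊗ₜ[k] 1) * Delta k H (inclPlus k H w))) = 0 := by
    intro w
    have hw := presentationMk_triRelator_inclPlus (projPlus k H (TensorAlgebra.ι k h)) w
    rw [inclPlus_projPlus_ι] at hw
    simpa [triRelator, add_mul, TensorProduct.neg_tmul] using hw
  rw [eq_inclPlus_add_smul_one w, map_add, mul_add, map_add, map_add, hplus]
  simp

theorem presentationMk_rTensor_rho (x : TensorAlgebra k H ⊗[k] TensorAlgebra k H) :
    presentationMk k H ((rho k H).rTensor _ x) = presentationMk k H ((rho k H).lTensor _ x) := by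
  rw [← presentationMk_map_rho ((rho k H).rTensor _ x), LinearMap.map_rTensor, rho_comp_rho]
  rfl

theorem presentationMk_lTensor_rho_comm (x : TensorAlgebra k H ⊗[k] TensorAlgebra k H) :
    presentationMk k H ((rho k H).lTensor _ (TensorProduct.comm k _ _ x)) =
      presentationMk k H ((rho k H).lTensor _ x) := by
  rw [LinearMap.lTensor_comm, presentationMk_comm, presentationMk_rTensor_rho]

theorem presentationMk_lTensor_rho_Delta (w : TensorAlgebra k H) :
    presentationMk k H ((rho k H).lTensor _ (Delta k H w)) = 0 := by
  induction w using left_induction with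
  | one => simp [Algebra.TensorProduct.one_def]
  | ι_mul h w _ =>
    have hcomm : TensorProduct.comm k _ _ ((1 ⊗ₜ[k] TensorAlgebra.ι k h) * Delta k H w) =
        (TensorAlgebra.ι k h ⊗ₜ[k] 1) * Delta k H w := by
      conv_rhs => rw [← comm_Delta]
      exact map_mul (Algebra.TensorProduct.comm k _ _) _ _
    rw [map_mul, Delta_ι, add_mul, map_add, map_add, presentationMk_lTensor_rho_ι_mul_Delta,
      ← presentationMk_lTensor_rho_comm, hcomm, presentationMk_lTensor_rho_ι_mul_Delta, add_zero]
  | add x y hx hy => simp [hx, hy]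
  | smul c x hx => simp [hx]

variable (k H) in
/-- The relator `triRelator` as a bilinear map. -/
noncomputable def triRelatorBilin : TensorAlgebra k H →ₗ[k] TensorAlgebra k H →ₗ[k]
    TensorAlgebra k H ⊗[k] TensorAlgebra k H :=
  let M := LinearMap.mul k (TensorAlgebra k H ⊗[k] TensorAlgebra k H)
  let I := TensorProduct.mk k (TensorAlgebra k H) (TensorAlgebra k H)
  (M.compl₁₂ (Delta k H).toLinearMap (I 1)).compr₂ ((rho k H).rTensor _) + I +
    (M.compl₁₂ (I.flip 1) (Delta k H).toLinearMap).compr₂ ((rho k H).lTensor _)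

theorem triRelatorBilin_apply (v w : TensorAlgebra k H) :
    triRelatorBilin k H v w = triRelator k H v w := rfl

theorem presentationMk_triRelator (v w : TensorAlgebra k H) :
    presentationMk k H (triRelator k H v w) = 0 := by
  suffices hF : (triRelatorBilin k H).compr₂ (presentationMk k H) = 0 from
    LinearMap.congr_fun₂ hF v w
  refine bilinear_ext_inclPlus (fun w => ?_) (fun v => ?_) presentationMk_triRelator_inclPlus
  · simp [triRelatorBilin_apply, triRelator, ← Algebra.TensorProduct.one_def,
      presentationMk_lTensor_rho_Delta]
  · simp [triRelatorBilin_apply, triRelator, ← Algebra.TensorProduct.one_def,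
      presentationMk_rTensor_rho, presentationMk_lTensor_rho_Delta]

theorem isThetaMap_presentationMk : IsThetaMap (presentationMk k H) where
  one_left := presentationMk_one_left
  one_right := presentationMk_one_right
  map_rho := presentationMk_map_rho
  comm := presentationMk_comm
  commRelator := presentationMk_commRelator
  triRelator := presentationMk_triRelator

end ThetaMap

section LieBilin

variable (R : Type u) [CommRing R] (L : Type w) [LieRing L] [LieAlgebra R L]

/-- The bracket of a Lie algebra as a bilinear map. -/
def lieBilin : L →ₗ[R] L →ₗ[R] L :=
  LinearMap.mk₂ R (fun a b => ⁅a, b⁆) add_lie smul_lie lie_add (fun c a b => lie_smul c a b)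

@[simp] theorem lieBilin_apply (a b : L) : lieBilin R L a b = ⁅a, b⁆ := rfl

end LieBilin

@[simp] theorem comb_nil {H : Type v} {n : ℕ} (x : Leaf H n) : comb [] x = .of x := rfl

@[simp] theorem comb_cons {H : Type v} {n : ℕ} (h : H) (v : List H) (x : Leaf H n) :
    comb (h :: v) x = .of (.hair h) * comb v x := rfl

section TensorAction

variable {R : Type u} [CommRing R] {H : Type v} [AddCommGroup H] [Module R H]
  {L : Type w} [LieRing L] [LieAlgebra R L] (η : H →ₗ[R] L)

/-- The action of the tensor algebra of `H` on a Lie algebra `L`, induced by a linear map `H → L`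
and the adjoint action. -/
noncomputable def tensorAct : TensorAlgebra R H →ₐ[R] Module.End R L :=
  TensorAlgebra.lift R (lieBilin R L ∘ₗ η)

@[simp] theorem tensorAct_ι (h : H) (a : L) : tensorAct η (TensorAlgebra.ι R h) a = ⁅η h, a⁆ := by
  simp [tensorAct]

/-- The linear map `x ⊗ y ↦ [x · a, y · b]`. -/
noncomputable def tensorActLie (a b : L) : TensorAlgebra R H ⊗[R] TensorAlgebra R H →ₗ[R] L :=
  TensorProduct.lift ((lieBilin R L).compl₁₂
    (LinearMap.applyₗ a ∘ₗ (tensorAct η).toLinearMap)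
    (LinearMap.applyₗ b ∘ₗ (tensorAct η).toLinearMap))

@[simp] theorem tensorActLie_tmul (a b : L) (x y : TensorAlgebra R H) :
    tensorActLie η a b (x ⊗ₜ y) = ⁅tensorAct η x a, tensorAct η y b⁆ := rfl

theorem tensorActLie_ι_mul (a b : L) (h : H) (p : TensorAlgebra R H ⊗[R] TensorAlgebra R H) :
    tensorActLie η a b ((TensorAlgebra.ι R h ⊗ₜ 1 + 1 ⊗ₜ TensorAlgebra.ι R h) * p) =
      ⁅η h, tensorActLie η a b p⁆ := by
  induction p using TensorProduct.induction_on with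
  | zero => simp
  | add p q hp hq => simp only [mul_add, map_add, hp, hq, lie_add]
  | tmul p q => simp [add_mul]

theorem lieEval_comb {n : ℕ} {ψ : Leaf H n → L} (hψ : ∀ h, ψ (.hair h) = η h) (v : List H)
    (x : Leaf H n) : lieEval ψ (comb v x) = tensorAct η (word R v) (ψ x) := by
  induction v with
  | nil => simp
  | cons h v ih => simp [ih, hψ]

end TensorAction

section TensorActionAdjoint

variable {k : Type u} [Field k] {H : Type v} [AddCommGroup H] [Module k H]
  {L : Type w} [LieRing L] [LieAlgebra k L] (η : H →ₗ[k] L)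

theorem tensorAct_lie (a b : L) (x : TensorAlgebra k H) :
    tensorAct η x ⁅a, b⁆ = tensorActLie η a b (Delta k H x) := by
  induction x using left_induction with
  | one => simp [Algebra.TensorProduct.one_def]
  | ι_mul h x hx =>
    rw [map_mul, Module.End.mul_apply, hx, map_mul, Delta_ι, tensorAct_ι, tensorActLie_ι_mul]
  | add x y hx hy => simp [hx, hy]
  | smul c x hx => simp [hx]

theorem apply_tensorAct_left {W : Type*} [AddCommGroup W] [Module k W] {F : L →ₗ[k] L →ₗ[k] W}
    (hF : ∀ a b c, F ⁅a, b⁆ c = F a ⁅b, c⁆) (x : TensorAlgebra k H) (a b : L) :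
    F (tensorAct η x a) b = F a (tensorAct η (rho k H x) b) := by
  induction x using left_induction generalizing a b with
  | one => simp
  | ι_mul h x hx =>
    rw [map_mul, Module.End.mul_apply, tensorAct_ι, ← lie_skew, map_neg, LinearMap.neg_apply, hF,
      hx, rho_mul, rho_ι, map_mul, Module.End.mul_apply, map_neg, LinearMap.neg_apply, tensorAct_ι,
      map_neg, map_neg]
  | add x y hx hy => simp [hx, hy]
  | smul c x hx => simp [hx]

end TensorActionAdjoint

section Root

variable (R : Type u) [CommRing R] {X : Type v} {L : Type w} [LieRing L] [LieAlgebra R L]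

open Classical in
/-- The value of the tree `(A, C)` rooted at the univalent vertex `x` of `A`, as a function of the
value of `C`. It is summed over the occurrences of `x` in `A`. -/
noncomputable def rootAux (ψ : X → L) (x : X) : FreeMagma X → L →ₗ[R] L
  | .of y => if y = x then LinearMap.id else 0
  | .mul A B => rootAux ψ x A ∘ₗ lieBilin R L (lieEval ψ B) -
      rootAux ψ x B ∘ₗ lieBilin R L (lieEval ψ A)

/-- The value of the tree `(A, B)` rooted at its univalent vertex `x`. -/
noncomputable def root (ψ : X → L) (x : X) (A B : FreeMagma X) : L :=
  rootAux R ψ x A (lieEval ψ B) + rootAux R ψ x B (lieEval ψ A)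

variable (ψ : X → L)

theorem rootAux_mul (x : X) (A B : FreeMagma X) (c : L) :
    rootAux R ψ x (A * B) c =
      rootAux R ψ x A ⁅lieEval ψ B, c⁆ + rootAux R ψ x B ⁅c, lieEval ψ A⁆ := by
  rw [← lie_skew c, map_neg, ← sub_eq_add_neg]
  rfl

theorem rootAux_of_self (x : X) (c : L) : rootAux R ψ x (.of x) c = c := by
  simp [rootAux]

theorem rootAux_of_ne {x y : X} (h : y ≠ x) (c : L) : rootAux R ψ x (.of y) c = 0 := by
  simp [rootAux, h]

theorem rootAux_eq_zero {x : X} {A : FreeMagma X} (h : x ∉ rootedLeaves A) (c : L) :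
    rootAux R ψ x A c = 0 := by
  induction A generalizing c with
  | ih1 y => exact rootAux_of_ne R ψ (fun hyx => h (by simp [hyx])) c
  | ih2 A B hA hB =>
    rw [rootedLeaves_mul, Multiset.mem_add, not_or] at h
    rw [rootAux_mul, hA h.1, hB h.2, add_zero]

theorem root_of_left {x : X} {A : FreeMagma X} (hA : x ∉ rootedLeaves A) :
    root R ψ x (.of x) A = lieEval ψ A := by
  rw [root, rootAux_of_self, rootAux_eq_zero R ψ hA, add_zero]

theorem root_of_mul {x : X} {A B : FreeMagma X} (hA : x ∉ rootedLeaves A)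
    (hB : x ∉ rootedLeaves B) :
    root R ψ x (.of x * A) B = ⁅lieEval ψ A, lieEval ψ B⁆ := by
  rw [root, rootAux_mul, rootAux_of_self, rootAux_eq_zero R ψ hA, rootAux_eq_zero R ψ hB,
    add_zero, add_zero]

/-- The tree form that roots a tree at the vertex `x` and applies a linear map to its value. -/
noncomputable def rootForm {W : Type*} [AddCommGroup W] [Module R W] (x : X) (y : L →ₗ[R] W) :
    TreeForm X W where
  toFun A B := y (root R ψ x A B)
  symm A B := by rw [root, root, add_comm]
  move A B C := by
    simp only [root, rootAux_mul, lieEval_mul]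
    rw [add_assoc, add_comm (rootAux R ψ x B _)]
  antisymm A B C := by
    simp only [root, rootAux_mul, lieEval_mul]
    rw [← map_add, ← lie_skew (lieEval ψ A) (lieEval ψ C), ← lie_skew (lieEval ψ B) (lieEval ψ C),
      ← lie_skew (lieEval ψ A) (lieEval ψ B)]
    simp only [map_neg]
    convert map_zero y using 2
    abel
  ihx A B C D := by
    have jacobi₁ : ∀ b c d : L, ⁅b, ⁅c, d⁆⁆ + ⁅d, ⁅b, c⁆⁆ + ⁅⁅b, d⁆, c⁆ = 0 := by
      intro b c d
      rw [← lie_skew d ⁅b, c⁆, leibniz_lie b c d, ← lie_skew c ⁅b, d⁆]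
      abel
    have jacobi₂ : ∀ a b c : L, ⁅⁅a, b⁆, c⁆ + ⁅⁅b, c⁆, a⁆ + ⁅⁅c, a⁆, b⁆ = 0 := by
      intro a b c
      rw [← lie_skew ⁅a, b⁆ c, ← lie_skew ⁅b, c⁆ a, ← lie_skew ⁅c, a⁆ b]
      linear_combination (norm := abel) -lie_jacobi a b c
    have hA := congrArg (rootAux R ψ x A) (jacobi₁ (lieEval ψ B) (lieEval ψ C) (lieEval ψ D))
    have hB := congrArg (rootAux R ψ x B) (jacobi₁ (lieEval ψ C) (lieEval ψ A) (lieEval ψ D))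
    have hC := congrArg (rootAux R ψ x C) (jacobi₁ (lieEval ψ A) (lieEval ψ B) (lieEval ψ D))
    have hD := congrArg (rootAux R ψ x D) (jacobi₂ (lieEval ψ A) (lieEval ψ B) (lieEval ψ C))
    simp only [root, rootAux_mul, lieEval_mul]
    rw [← map_add, ← map_add]
    convert map_zero y using 2
    simp only [map_add, map_zero] at hA hB hC hD
    linear_combination (norm := abel) hA + hB + hC + hD

end Root

section Cut

open Classical in
theorem count_add_eq_one {X : Type*} {x : X} {s t : Multiset X} (h : (s + t).count x = 1) :
    s.count x = 1 ∧ x ∉ t ∨ x ∉ s ∧ t.count x = 1 := by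
  rw [Multiset.count_add] at h
  rw [← Multiset.count_eq_zero, ← Multiset.count_eq_zero]
  lia

variable {X : Type v}

theorem cutAux_mul (x : X) (A B C : FreeMagma X) :
    cutAux x (A * B) C = (cutAux x A (B * C) <|> cutAux x B (C * A)) := rfl

theorem cutAux_eq_none {x : X} {A : FreeMagma X} (h : x ∉ rootedLeaves A) (C : FreeMagma X) :
    cutAux x A C = none := by
  induction A generalizing C with
  | ih1 y =>
    have hyx : y ≠ x := fun hyx => h (by simp [hyx])
    simp [cutAux, hyx]
  | ih2 A B hA hB =>
    rw [rootedLeaves_mul, Multiset.mem_add, not_or] at h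
    rw [cutAux_mul, hA h.1, hB h.2]
    rfl

theorem cut_eq_none {x : X} {t : Tree X} (h : x ∉ t.leaves) : t.cut x = none := by
  rw [Tree.leaves, Multiset.mem_add, not_or] at h
  rw [Tree.cut, cutAux_eq_none h.1, cutAux_eq_none h.2]
  rfl

open Classical in
theorem exists_cutAux {x : X} {A : FreeMagma X} (h : (rootedLeaves A).count x = 1)
    (C : FreeMagma X) :
    ∃ D, cutAux x A C = some D ∧ x ::ₘ rootedLeaves D = rootedLeaves A + rootedLeaves C := by
  induction A generalizing C with
  | ih1 y =>
    obtain rfl : x = y := by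
      by_contra hxy
      simp [hxy] at h
    exact ⟨C, by simp [cutAux], by simp⟩
  | ih2 A B hA hB =>
    rw [rootedLeaves_mul] at h ⊢
    rw [cutAux_mul]
    obtain ⟨h, -⟩ | ⟨hx, h⟩ := count_add_eq_one h
    · obtain ⟨D, hD, hleaves⟩ := hA h (B * C)
      exact ⟨D, by rw [hD]; rfl, by rw [hleaves, rootedLeaves_mul, add_assoc]⟩
    · obtain ⟨D, hD, hleaves⟩ := hB h (C * A)
      exact ⟨D, by rw [cutAux_eq_none hx, hD]; rfl, by rw [hleaves, rootedLeaves_mul]; abel⟩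

open Classical in
theorem exists_cut {x : X} {t : Tree X} (h : t.leaves.count x = 1) :
    ∃ D, t.cut x = some D ∧ x ::ₘ rootedLeaves D = t.leaves := by
  rw [Tree.leaves] at h ⊢
  rw [Tree.cut]
  obtain ⟨h, -⟩ | ⟨hx, h⟩ := count_add_eq_one h
  · obtain ⟨D, hD, hleaves⟩ := exists_cutAux h t.2
    exact ⟨D, by rw [hD]; rfl, hleaves⟩
  · obtain ⟨D, hD, hleaves⟩ := exists_cutAux h t.1
    exact ⟨D, by rw [cutAux_eq_none hx, hD]; rfl, by rw [hleaves, add_comm]⟩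

variable (R : Type u) [CommRing R] {L : Type w} [LieRing L] [LieAlgebra R L] (ψ : X → L)

open Classical in
theorem lieEval_of_cutAux_eq_some {x : X} {A C D : FreeMagma X}
    (h : (rootedLeaves A).count x = 1) (hD : cutAux x A C = some D) :
    lieEval ψ D = rootAux R ψ x A (lieEval ψ C) := by
  induction A generalizing C with
  | ih1 y =>
    obtain rfl : x = y := by
      by_contra hxy
      simp [hxy] at h
    obtain rfl : C = D := by simpa [cutAux] using hD
    rw [rootAux_of_self]
  | ih2 A B hA hB =>
    rw [cutAux_mul] at hD
    rw [rootAux_mul]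
    obtain ⟨h, hx⟩ | ⟨hx, h⟩ := count_add_eq_one h
    · obtain ⟨D', hD', -⟩ := exists_cutAux h (B * C)
      obtain rfl : D' = D := by simpa [hD'] using hD
      rw [hA h hD', rootAux_eq_zero R ψ hx, add_zero, lieEval_mul]
    · rw [cutAux_eq_none hx] at hD
      rw [hB h hD, rootAux_eq_zero R ψ hx, zero_add, lieEval_mul]

open Classical in
theorem lieEval_of_cut_eq_some {x : X} {t : Tree X} {D : FreeMagma X} (h : t.leaves.count x = 1)
    (hD : t.cut x = some D) : lieEval ψ D = root R ψ x t.1 t.2 := by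
  rw [Tree.cut] at hD
  rw [root]
  obtain ⟨h, hx⟩ | ⟨hx, h⟩ := count_add_eq_one h
  · obtain ⟨D', hD', -⟩ := exists_cutAux h t.2
    obtain rfl : D' = D := by simpa [hD'] using hD
    rw [lieEval_of_cutAux_eq_some R ψ h hD', rootAux_eq_zero R ψ hx, add_zero]
  · rw [cutAux_eq_none hx] at hD
    rw [lieEval_of_cutAux_eq_some R ψ h hD, rootAux_eq_zero R ψ hx, zero_add]

end Cut

section Ends

variable {H : Type v} {n : ℕ}

/-- The end of an external edge at a univalent vertex, if the vertex is not a hair. -/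
def Leaf.end? : Leaf H n → Option (Fin n × Bool)
  | .hair _ => none
  | .edge e b => some (e, b)

/-- The ends of external edges on a rooted tree. -/
def rootedEnds (A : FreeMagma (Leaf H n)) : Multiset (Fin n × Bool) :=
  (rootedLeaves A).filterMap Leaf.end?

@[simp] theorem rootedEnds_hair (h : H) : rootedEnds (.of (.hair h) : FreeMagma (Leaf H n)) = 0 :=
  rfl

@[simp] theorem rootedEnds_edge (e : Fin n) (b : Bool) :
    rootedEnds (.of (.edge e b) : FreeMagma (Leaf H n)) = {(e, b)} := rfl

@[simp] theorem rootedEnds_mul (A B : FreeMagma (Leaf H n)) :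
    rootedEnds (A * B) = rootedEnds A + rootedEnds B := by
  simp [rootedEnds]

theorem mem_rootedEnds {A : FreeMagma (Leaf H n)} {x : Fin n × Bool} :
    x ∈ rootedEnds A ↔ Leaf.edge x.1 x.2 ∈ rootedLeaves A := by
  rw [rootedEnds, Multiset.mem_filterMap]
  constructor
  · rintro ⟨_ | ⟨e, b⟩, hl, h⟩
    · simp [Leaf.end?] at h
    · obtain rfl : (e, b) = x := Option.some.inj h
      exact hl
  · exact fun h => ⟨_, h, rfl⟩

@[simp] theorem rootedEnds_comb (v : List H) (e : Fin n) (b : Bool) :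
    rootedEnds (comb v (.edge e b)) = {(e, b)} := by
  induction v with
  | nil => rfl
  | cons h v ih => simp [ih]

end Ends

section LieSpan

variable {R : Type u} [CommRing R] {L : Type w} [LieRing L] [LieAlgebra R L]
  {U V W : Submodule R L}

theorem map₂_lieBilin_comm :
    Submodule.map₂ (lieBilin R L) U V = Submodule.map₂ (lieBilin R L) V U := by
  have h : ∀ {U V : Submodule R L},
      Submodule.map₂ (lieBilin R L) U V ≤ Submodule.map₂ (lieBilin R L) V U := fun {U V} =>
    Submodule.map₂_le.2 fun x hx y hy => by
      rw [lieBilin_apply, ← lie_skew]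
      exact neg_mem (Submodule.apply_mem_map₂ (lieBilin R L) hy hx)
  exact le_antisymm h h

theorem map₂_lieBilin_jacobi :
    Submodule.map₂ (lieBilin R L) U (Submodule.map₂ (lieBilin R L) V W) ≤
      Submodule.map₂ (lieBilin R L) V (Submodule.map₂ (lieBilin R L) U W) ⊔
        Submodule.map₂ (lieBilin R L) W (Submodule.map₂ (lieBilin R L) U V) := by
  refine Submodule.map₂_le.2 fun x hx w hw => Submodule.mem_comap.1 ?_
  revert w
  refine SetLike.le_def.1 (Submodule.map₂_le.2 fun y hy z hz => Submodule.mem_comap.2 ?_)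
  rw [lieBilin_apply, lieBilin_apply, leibniz_lie, ← lie_skew _ z]
  exact add_mem
    (Submodule.mem_sup_right (neg_mem (Submodule.apply_mem_map₂ (lieBilin R L) hz
      (Submodule.apply_mem_map₂ (lieBilin R L) hx hy))))
    (Submodule.mem_sup_left (Submodule.apply_mem_map₂ (lieBilin R L) hy
      (Submodule.apply_mem_map₂ (lieBilin R L) hx hz)))

theorem map₂_lieBilin_le_comap {d : L} (hU : U ≤ U.comap (lieBilin R L d))
    (hV : V ≤ V.comap (lieBilin R L d)) : Submodule.map₂ (lieBilin R L) U V ≤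
      (Submodule.map₂ (lieBilin R L) U V).comap (lieBilin R L d) := by
  refine Submodule.map₂_le.2 fun x hx y hy => Submodule.mem_comap.2 ?_
  rw [lieBilin_apply, lieBilin_apply, leibniz_lie]
  exact add_mem (Submodule.apply_mem_map₂ (lieBilin R L) (hU hx) hy)
    (Submodule.apply_mem_map₂ (lieBilin R L) hx (hV hy))

theorem sup_le_comap_sup {f : L →ₗ[R] L} (hU : U ≤ U.comap f) (hV : V ≤ V.comap f) :
    U ⊔ V ≤ (U ⊔ V).comap f :=
  sup_le (hU.trans (Submodule.comap_mono le_sup_left))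
    (hV.trans (Submodule.comap_mono le_sup_right))

variable {H : Type v} {n : ℕ} (ψ : Leaf H n → L)

theorem lieEval_lie_mem {A : FreeMagma (Leaf H n)} (hA : rootedEnds A = 0)
    (hU : ∀ h, U ≤ U.comap (lieBilin R L (ψ (.hair h)))) {y : L} (hy : y ∈ U) :
    ⁅lieEval ψ A, y⁆ ∈ U := by
  induction A generalizing y with
  | ih1 x =>
    cases x with
    | hair h => exact hU h hy
    | edge e b => simp at hA
  | ih2 A B ihA ihB =>
    rw [rootedEnds_mul, add_eq_zero] at hA
    rw [lieEval_mul, lie_lie]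
    exact U.sub_mem (ihA hA.1 (ihB hA.2 hy)) (ihB hA.2 (ihA hA.1 hy))

theorem lieEval_mem_of_splittings (hU : ∀ h, U ≤ U.comap (lieBilin R L (ψ (.hair h))))
    {A : FreeMagma (Leaf H n)} (hA : rootedEnds A ≠ 0)
    (leaf : ∀ e b, rootedEnds A = {(e, b)} → ψ (.edge e b) ∈ U)
    (split : ∀ B C, rootedEnds B ≠ 0 → (rootedEnds B).card ≤ (rootedEnds C).card →
      rootedEnds B + rootedEnds C = rootedEnds A → ⁅lieEval ψ B, lieEval ψ C⁆ ∈ U) :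
    lieEval ψ A ∈ U := by
  induction A with
  | ih1 x =>
    cases x with
    | hair h => simp at hA
    | edge e b => exact leaf e b rfl
  | ih2 B C ihB ihC =>
    rw [rootedEnds_mul] at hA leaf split
    rw [lieEval_mul]
    by_cases hB : rootedEnds B = 0
    · rw [hB, zero_add] at hA leaf split
      exact lieEval_lie_mem ψ hB hU (ihC hA leaf split)
    by_cases hC : rootedEnds C = 0
    · rw [hC, add_zero] at hA leaf split
      rw [← lie_skew]
      exact neg_mem (lieEval_lie_mem ψ hC hU (ihB hA leaf split))
    obtain hcard | hcard := le_total (rootedEnds B).card (rootedEnds C).card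
    · exact split B C hB hcard rfl
    · rw [← lie_skew]
      exact neg_mem (split C B hC hcard (add_comm _ _))

variable (R) in
/-- The span of the values of the rooted trees with hairs along an edge that ends at `a`. -/
def combSpan (a : Fin n × Bool) : Submodule R L :=
  Submodule.span R (Set.range fun v => lieEval ψ (comb v (.edge a.1 a.2)))

theorem combSpan_le_comap (a : Fin n × Bool) (h : H) :
    combSpan R ψ a ≤ (combSpan R ψ a).comap (lieBilin R L (ψ (.hair h))) := by
  refine Submodule.span_le.2 ?_
  rintro _ ⟨v, rfl⟩
  exact Submodule.subset_span ⟨h :: v, rfl⟩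

variable (R) in
/-- The span of the brackets of the values of two rooted trees with hairs along an edge. -/
def combSpan₂ (a b : Fin n × Bool) : Submodule R L :=
  Submodule.map₂ (lieBilin R L) (combSpan R ψ a) (combSpan R ψ b)

theorem combSpan₂_le_comap (a b : Fin n × Bool) (h : H) :
    combSpan₂ R ψ a b ≤ (combSpan₂ R ψ a b).comap (lieBilin R L (ψ (.hair h))) :=
  map₂_lieBilin_le_comap (combSpan_le_comap ψ a h) (combSpan_le_comap ψ b h)

variable (R) in
/-- The span of the values of the rooted trees with three branches `a`, `b`, `c` that have hairs
along an edge. By the Jacobi identity those in which `b` is grouped with `c` can be left out. -/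
def combSpan₃ (a b c : Fin n × Bool) : Submodule R L :=
  Submodule.map₂ (lieBilin R L) (combSpan R ψ b) (combSpan₂ R ψ a c) ⊔
    Submodule.map₂ (lieBilin R L) (combSpan R ψ c) (combSpan₂ R ψ a b)

theorem combSpan₃_le_comap (a b c : Fin n × Bool) (h : H) :
    combSpan₃ R ψ a b c ≤ (combSpan₃ R ψ a b c).comap (lieBilin R L (ψ (.hair h))) :=
  sup_le_comap_sup
    (map₂_lieBilin_le_comap (combSpan_le_comap ψ b h) (combSpan₂_le_comap ψ a c h))
    (map₂_lieBilin_le_comap (combSpan_le_comap ψ c h) (combSpan₂_le_comap ψ a b h))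

variable (R)

theorem lieEval_mem_combSpan {a : Fin n × Bool} {A : FreeMagma (Leaf H n)}
    (hA : rootedEnds A = {a}) : lieEval ψ A ∈ combSpan R ψ a := by
  refine lieEval_mem_of_splittings ψ (combSpan_le_comap ψ a) (by simp [hA])
    (fun e b h => ?_) fun B C hB hcard h => ?_
  · obtain rfl : a = (e, b) := by simpa [hA] using h
    exact Submodule.subset_span ⟨[], rfl⟩
  · have hcard' := congrArg Multiset.card (h.trans hA)
    rw [Multiset.card_add, Multiset.card_singleton] at hcard'
    have := Multiset.card_pos.2 hB
    lia

variable {R}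

theorem lieEval_mem_of_card_le_three (hU : ∀ h, U ≤ U.comap (lieBilin R L (ψ (.hair h))))
    {A : FreeMagma (Leaf H n)} (hA₁ : 1 < (rootedEnds A).card) (hA₃ : (rootedEnds A).card ≤ 3)
    (split : ∀ x y C, y ∈ combSpan R ψ x → x ::ₘ rootedEnds C = rootedEnds A →
      ⁅y, lieEval ψ C⁆ ∈ U) : lieEval ψ A ∈ U := by
  refine lieEval_mem_of_splittings ψ hU (Multiset.card_pos.1 (by lia)) (fun e b h => ?_)
    fun B C hB hBC h => ?_
  · simp [h] at hA₁
  · have hcard := congrArg Multiset.card h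
    rw [Multiset.card_add] at hcard
    have hB₁ : (rootedEnds B).card = 1 := by
      have := Multiset.card_pos.2 hB
      lia
    obtain ⟨x, hx⟩ := Multiset.card_eq_one.1 hB₁
    exact split x _ C (lieEval_mem_combSpan R ψ hx) (by rw [← h, hx, Multiset.singleton_add])

theorem cons_eq_pair {α : Type*} {a b x : α} {s : Multiset α} (h : x ::ₘ s = {a, b}) :
    x = a ∧ s = {b} ∨ x = b ∧ s = {a} := by
  obtain ⟨rfl, hs⟩ | ⟨-, t, rfl, ht⟩ := Multiset.cons_eq_cons.1 h
  · exact Or.inl ⟨rfl, hs⟩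
  · obtain ⟨rfl, rfl⟩ := Multiset.singleton_eq_cons_iff _ |>.1 ht
    exact Or.inr ⟨rfl, rfl⟩

theorem cons_eq_triple {α : Type*} {a b c x : α} {s : Multiset α} (h : x ::ₘ s = {a, b, c}) :
    x = a ∧ s = {b, c} ∨ x = b ∧ s = {a, c} ∨ x = c ∧ s = {a, b} := by
  obtain ⟨rfl, hs⟩ | ⟨-, t, rfl, ht⟩ := Multiset.cons_eq_cons.1 h
  · exact Or.inl ⟨rfl, hs⟩
  · obtain ⟨rfl, rfl⟩ | ⟨rfl, rfl⟩ := cons_eq_pair ht.symm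
    · exact Or.inr (Or.inl ⟨rfl, rfl⟩)
    · exact Or.inr (Or.inr ⟨rfl, rfl⟩)

variable (R)

theorem lieEval_mem_combSpan₂ {a b : Fin n × Bool} {A : FreeMagma (Leaf H n)}
    (hA : rootedEnds A = {a, b}) : lieEval ψ A ∈ combSpan₂ R ψ a b := by
  refine lieEval_mem_of_card_le_three ψ (combSpan₂_le_comap ψ a b) (by simp [hA]) (by simp [hA])
    fun x y C hy h => ?_
  obtain ⟨rfl, hC⟩ | ⟨rfl, hC⟩ := cons_eq_pair (h.trans hA)
  · exact Submodule.apply_mem_map₂ (lieBilin R L) hy (lieEval_mem_combSpan R ψ hC)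
  · rw [combSpan₂, map₂_lieBilin_comm]
    exact Submodule.apply_mem_map₂ (lieBilin R L) hy (lieEval_mem_combSpan R ψ hC)

theorem lieEval_mem_combSpan₃ {a b c : Fin n × Bool} {A : FreeMagma (Leaf H n)}
    (hA : rootedEnds A = {a, b, c}) : lieEval ψ A ∈ combSpan₃ R ψ a b c := by
  refine lieEval_mem_of_card_le_three ψ (combSpan₃_le_comap ψ a b c) (by simp [hA]) (by simp [hA])
    fun x y C hy h => ?_
  obtain ⟨rfl, hC⟩ | ⟨rfl, hC⟩ | ⟨rfl, hC⟩ := cons_eq_triple (h.trans hA)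
  · exact map₂_lieBilin_jacobi
      (Submodule.apply_mem_map₂ (lieBilin R L) hy (lieEval_mem_combSpan₂ R ψ hC))
  · exact Submodule.mem_sup_left
      (Submodule.apply_mem_map₂ (lieBilin R L) hy (lieEval_mem_combSpan₂ R ψ hC))
  · exact Submodule.mem_sup_right
      (Submodule.apply_mem_map₂ (lieBilin R L) hy (lieEval_mem_combSpan₂ R ψ hC))

end LieSpan

namespace TreeForm

variable {H : Type v} {n : ℕ} {W : Type w} [AddCommGroup W]

theorem exists_reroot_left {a : Fin n × Bool} {A : FreeMagma (Leaf H n)} (ha : a ∈ rootedEnds A)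
    (C : FreeMagma (Leaf H n)) : ∃ D, a ::ₘ rootedEnds D = rootedEnds A + rootedEnds C ∧
      ∀ φ : TreeForm (Leaf H n) W, φ.toFun A C = φ.toFun (.of (.edge a.1 a.2)) D := by
  induction A generalizing C with
  | ih1 x =>
    cases x with
    | hair h => simp at ha
    | edge e b =>
      obtain rfl : a = (e, b) := by simpa using ha
      exact ⟨C, by simp, fun φ => rfl⟩
  | ih2 A B ihA ihB =>
    rw [rootedEnds_mul, Multiset.mem_add] at ha
    obtain ha | ha := ha
    · obtain ⟨D, hD, hφ⟩ := ihA ha (B * C)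
      exact ⟨D, by rw [hD, rootedEnds_mul, rootedEnds_mul, add_assoc],
        fun φ => by rw [φ.move, hφ]⟩
    · obtain ⟨D, hD, hφ⟩ := ihB ha (C * A)
      refine ⟨D, ?_, fun φ => by rw [φ.symm, ← φ.move, φ.symm, hφ]⟩
      rw [hD, rootedEnds_mul, rootedEnds_mul]
      abel

theorem exists_reroot {a : Fin n × Bool} {A C : FreeMagma (Leaf H n)}
    (ha : a ∈ rootedEnds A + rootedEnds C) :
    ∃ D, a ::ₘ rootedEnds D = rootedEnds A + rootedEnds C ∧
      ∀ φ : TreeForm (Leaf H n) W, φ.toFun A C = φ.toFun (.of (.edge a.1 a.2)) D := by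
  obtain ha | ha := Multiset.mem_add.1 ha
  · exact exists_reroot_left ha C
  · obtain ⟨D, hD, hφ⟩ := exists_reroot_left (W := W) ha A
    exact ⟨D, by rw [hD, add_comm], fun φ => by rw [φ.symm, hφ]⟩

section Span

variable {R : Type u} [CommRing R] [Invertible (2 : R)] [Module R W]
  (φ : TreeForm (Leaf H n) W) (S : Submodule R W)

theorem mem_of_rootedEnds_eq_three {a b c : Fin n × Bool}
    (h : ∀ v w, φ.toFun (.of (.edge a.1 a.2))
      (comb v (.edge b.1 b.2) * comb w (.edge c.1 c.2)) ∈ S)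
    {A C : FreeMagma (Leaf H n)} (hA : rootedEnds A + rootedEnds C = {a, b, c}) :
    φ.toFun A C ∈ S := by
  obtain ⟨D, hD, hφ⟩ := exists_reroot (W := W) (a := a) (A := A) (C := C) (by simp [hA])
  rw [hA, Multiset.insert_eq_cons, Multiset.cons_inj_right] at hD
  rw [hφ, toFun_eq_form R]
  suffices hS : combSpan₂ R (leaf R φ) b c ≤
      S.comap (form R φ (lieEval (leaf R φ) (.of (.edge a.1 a.2)))) from
    hS (lieEval_mem_combSpan₂ R _ hD)
  rw [combSpan₂, combSpan, combSpan, Submodule.map₂_span_span, Submodule.span_le]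
  rintro _ ⟨_, ⟨v, rfl⟩, _, ⟨w, rfl⟩, rfl⟩
  have hvw := h v w
  rw [toFun_eq_form R] at hvw
  exact hvw

theorem mem_of_rootedEnds_eq_four {a b c d : Fin n × Bool}
    (h : ∀ u v w, φ.toFun (.of (.edge a.1 a.2) * comb v (.edge c.1 c.2))
      (comb u (.edge b.1 b.2) * comb w (.edge d.1 d.2)) ∈ S)
    (h' : ∀ u v w, φ.toFun (.of (.edge a.1 a.2) * comb w (.edge d.1 d.2))
      (comb u (.edge b.1 b.2) * comb v (.edge c.1 c.2)) ∈ S)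
    {A C : FreeMagma (Leaf H n)} (hA : rootedEnds A + rootedEnds C = {a, b, c, d}) :
    φ.toFun A C ∈ S := by
  obtain ⟨D, hD, hφ⟩ := exists_reroot (W := W) (a := a) (A := A) (C := C) (by simp [hA])
  rw [hA, Multiset.insert_eq_cons, Multiset.cons_inj_right] at hD
  rw [hφ, toFun_eq_form R]
  suffices hS : combSpan₃ R (leaf R φ) b c d ≤
      S.comap (form R φ (lieEval (leaf R φ) (.of (.edge a.1 a.2)))) from
    hS (lieEval_mem_combSpan₃ R _ hD)
  rw [combSpan₃, combSpan₂, combSpan₂, combSpan, combSpan, combSpan, sup_le_iff]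
  simp only [Submodule.map₂_span_span, Submodule.span_le]
  constructor
  · rintro _ ⟨_, ⟨v, rfl⟩, _, ⟨_, ⟨u, rfl⟩, _, ⟨w, rfl⟩, rfl⟩, rfl⟩
    have huvw := h u v w
    rw [φ.move, toFun_eq_form R] at huvw
    exact huvw
  · rintro _ ⟨_, ⟨w, rfl⟩, _, ⟨_, ⟨u, rfl⟩, _, ⟨v, rfl⟩, rfl⟩, rfl⟩
    have huvw := h' u v w
    rw [φ.move, toFun_eq_form R] at huvw
    exact huvw

end Span

end TreeForm

/-- A tree form on trees with hairs and ends of external edges, linear in the labels of the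
hairs. -/
structure HairForm (R : Type u) [CommRing R] (H : Type v) [AddCommGroup H] [Module R H] (n : ℕ)
    (W : Type w) [AddCommGroup W] [Module R W] extends TreeForm (Leaf H n) W where
  hair_add : ∀ h h' B, toFun (.of (.hair (h + h'))) B =
    toFun (.of (.hair h)) B + toFun (.of (.hair h')) B
  hair_smul : ∀ (c : R) h B, toFun (.of (.hair (c • h))) B = c • toFun (.of (.hair h)) B

/-- A hair form with two external edges that does not depend on their numbering and changes its sign
when an edge is reversed. -/
structure SymForm (R : Type u) [CommRing R] (H : Type v) [AddCommGroup H] [Module R H]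
    (W : Type w) [AddCommGroup W] [Module R W] extends HairForm R H 2 W where
  renumber : ∀ π A B, toFun (FreeMagma.map (Leaf.renumber π) A)
    (FreeMagma.map (Leaf.renumber π) B) = toFun A B
  reverse : ∀ e A B, toFun (FreeMagma.map (Leaf.reverse e) A)
    (FreeMagma.map (Leaf.reverse e) B) = -toFun A B

namespace HairForm

variable {R : Type u} [CommRing R] {H : Type v} [AddCommGroup H] [Module R H] {n : ℕ}
  {W : Type w} [AddCommGroup W] [Module R W] (φ : HairForm R H n W)

/-- The Lie algebra of a hair form. -/
abbrev L : Type (max u v) := φ.toTreeForm.LieQuotient R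

/-- The element of the Lie algebra given by an end of an external edge. -/
noncomputable def edgeEnd (e : Fin n) (b : Bool) : φ.L := φ.leaf R (.edge e b)

theorem leaf_edge (e : Fin n) (b : Bool) : φ.leaf R (.edge e b) = φ.edgeEnd e b := rfl

variable [Invertible (2 : R)]

/-- The element of the Lie algebra given by a hair. -/
noncomputable def hair : H →ₗ[R] φ.L where
  toFun h := φ.leaf R (.hair h)
  map_add' h h' := TreeForm.lieQuotient_ext fun C => by
    have hadd := φ.hair_add h h' C
    simpa only [φ.toFun_eq_form R, lieEval_of, map_add, LinearMap.add_apply] using hadd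
  map_smul' c h := TreeForm.lieQuotient_ext fun C => by
    have hsmul := φ.hair_smul c h C
    simpa only [φ.toFun_eq_form R, lieEval_of, map_smul, LinearMap.smul_apply, RingHom.id_apply]
      using hsmul

theorem leaf_hair (h : H) : φ.leaf R (.hair h) = φ.hair h := rfl

end HairForm

section Placement

variable {H : Type v} {n : ℕ}

theorem freeMagma_map_map {X Y Z : Type*} (f : X → Y) (g : Y → Z) (A : FreeMagma X) :
    FreeMagma.map g (FreeMagma.map f A) = FreeMagma.map (g ∘ f) A := by
  induction A with
  | ih1 x => rfl
  | ih2 A B hA hB => rw [map_mul, map_mul, map_mul, hA, hB]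

/-- The sign of an end of an external edge: `1` for the tail and `-1` for the head. -/
def sgn (b : Bool) : ℤ := if b then -1 else 1

/-- Number the external edge `f` by `0` and all others by `1`, and reverse `f` if `b` is true and
the others if `c` is true. -/
def place (f : Fin n) (b c : Bool) : Leaf H n → Leaf H 2
  | .hair h => .hair h
  | .edge i β => if i = f then .edge 0 (xor β b) else .edge 1 (xor β c)

@[simp] theorem place_hair (f : Fin n) (b c : Bool) (h : H) :
    place f b c (.hair h) = .hair h := rfl

theorem place_edge_self (f : Fin n) (b c β : Bool) :
    place (H := H) f b c (.edge f β) = .edge 0 (xor β b) := by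
  simp [place]

theorem place_edge_of_ne {f i : Fin n} (h : i ≠ f) (b c β : Bool) :
    place (H := H) f b c (.edge i β) = .edge 1 (xor β c) := by
  simp [place, h]

theorem place_true_left (f : Fin n) (c : Bool) :
    place (H := H) f true c = Leaf.reverse 0 ∘ place f false c := by
  funext x
  rcases x with h | ⟨i, β⟩
  · rfl
  · by_cases h : i = f <;> simp [place, Leaf.reverse, h]

theorem place_true_right (f : Fin n) (b : Bool) :
    place (H := H) f b true = Leaf.reverse 1 ∘ place f b false := by
  funext x
  rcases x with h | ⟨i, β⟩
  · rfl
  · by_cases h : i = f <;> simp [place, Leaf.reverse, h]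

theorem place_false_false (f : Fin 2) :
    place (H := H) f false false = Leaf.renumber (Equiv.swap 0 f) := by
  funext x
  rcases x with h | ⟨i, β⟩
  · rfl
  · fin_cases f <;> fin_cases i <;> simp [place, Leaf.renumber]

/-- Number the external edges so that the number `e` is left free. -/
def Leaf.succAbove (e : Fin (n + 1)) : Leaf H n → Leaf H (n + 1)
  | .hair h => .hair h
  | .edge f b => .edge (e.succAbove f) b

theorem place_comp_succAbove (e : Fin (n + 1)) (f : Fin n) (b c : Bool) :
    place (H := H) (e.succAbove f) b c ∘ Leaf.succAbove e = place f b c := by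
  funext x
  rcases x with h | ⟨i, β⟩
  · rfl
  · simp [place, Leaf.succAbove]

theorem dropEdge_map_succAbove (e : Fin (n + 1)) (A : FreeMagma (Leaf H n)) :
    dropEdge e (FreeMagma.map (Leaf.succAbove e) A) = some A := by
  induction A with
  | ih1 x =>
    rcases x with h | ⟨i, β⟩
    · rfl
    · simp [dropEdge, Leaf.succAbove]
  | ih2 A B hA hB =>
    rw [map_mul]
    change Option.map₂ (· * ·) (dropEdge e _) (dropEdge e _) = _
    rw [hA, hB]
    rfl

theorem exists_map_succAbove {e : Fin (n + 1)} {A : FreeMagma (Leaf H (n + 1))}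
    (hA : ∀ b, (e, b) ∉ rootedEnds A) : ∃ A', FreeMagma.map (Leaf.succAbove e) A' = A := by
  induction A with
  | ih1 x =>
    rcases x with h | ⟨i, β⟩
    · exact ⟨.of (.hair h), rfl⟩
    · have hi : i ≠ e := by
        rintro rfl
        exact hA β (by simp)
      obtain ⟨j, rfl⟩ := Fin.exists_succAbove_eq hi
      exact ⟨.of (.edge j β), rfl⟩
  | ih2 A B ihA ihB =>
    obtain ⟨A', rfl⟩ := ihA fun b hb => hA b (by simp [hb])
    obtain ⟨B', rfl⟩ := ihB fun b hb => hA b (by simp [hb])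
    exact ⟨A' * B', map_mul _ _ _⟩

end Placement

section TreeEnds

variable {H : Type v} {n : ℕ}

/-- The ends of external edges on a tree. -/
def Tree.ends (t : Tree (Leaf H n)) : Multiset (Fin n × Bool) := t.leaves.filterMap Leaf.end?

theorem Tree.ends_eq (t : Tree (Leaf H n)) : t.ends = rootedEnds t.1 + rootedEnds t.2 :=
  Multiset.filterMap_add _ _ _

theorem edge_mem_leaves {t : Tree (Leaf H n)} {e : Fin n} {b : Bool} :
    Leaf.edge e b ∈ t.leaves ↔ (e, b) ∈ t.ends := by
  rw [Tree.ends_eq, Tree.leaves, Multiset.mem_add, Multiset.mem_add, mem_rootedEnds, mem_rootedEnds]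

open Classical in
theorem count_edge_leaves {t : Tree (Leaf H n)} {e : Fin n} {b : Bool} :
    t.leaves.count (.edge e b) = t.ends.count (e, b) := by
  rw [Tree.ends]
  induction t.leaves using Multiset.induction_on with
  | empty => rfl
  | cons x m ih =>
    rcases x with h | ⟨f, c⟩
    · rw [Multiset.filterMap_cons_none _ _ (by rfl), ← ih, Multiset.count_cons_of_ne (by simp)]
    · rw [Multiset.filterMap_cons_some _ _ _ (by rfl), Multiset.count_cons, Multiset.count_cons, ih]
      simp

theorem rootedLeaves_map {X Y : Type v} (f : X → Y) (A : FreeMagma X) :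
    rootedLeaves (FreeMagma.map f A) = (rootedLeaves A).map f := by
  induction A with
  | ih1 x => rfl
  | ih2 A B hA hB => rw [map_mul, rootedLeaves_mul, rootedLeaves_mul, hA, hB, Multiset.map_add]

theorem leaves_relabel {X Y : Type v} (f : X → Y) (t : Tree X) :
    (t.relabel f).leaves = t.leaves.map f := by
  simp only [Tree.leaves, Tree.relabel, rootedLeaves_map, Multiset.map_add]

theorem join_eq_none_left {e : Fin (n + 1)} {b : Bool} {t₁ t₂ : Tree (Leaf H (n + 1))}
    (h : (e, b) ∉ t₁.ends) : join e b t₁ t₂ = none := by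
  rw [join, cut_eq_none (mt edge_mem_leaves.1 h)]
  rfl

theorem join_eq_none_right {e : Fin (n + 1)} {b : Bool} {t₁ t₂ : Tree (Leaf H (n + 1))}
    (h : (e, !b) ∉ t₂.ends) : join e b t₁ t₂ = none := by
  rw [join, cut_eq_none (mt edge_mem_leaves.1 h)]
  simp

theorem exists_cut_of_count_ends {e : Fin (n + 1)} {b : Bool} {t : Tree (Leaf H (n + 1))}
    (h : t.ends.count (e, b) = 1) (h' : (e, !b) ∉ t.ends) :
    ∃ D : FreeMagma (Leaf H n), t.cut (.edge e b) = some (FreeMagma.map (Leaf.succAbove e) D) ∧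
      t.leaves = .edge e b ::ₘ (rootedLeaves D).map (Leaf.succAbove e) := by
  classical
  rw [← count_edge_leaves] at h
  obtain ⟨D, hD, hleaves⟩ := exists_cut h
  obtain ⟨D, rfl⟩ : ∃ D', FreeMagma.map (Leaf.succAbove e) D' = D := by
    refine exists_map_succAbove fun c hc => ?_
    rw [mem_rootedEnds] at hc
    obtain rfl | rfl := Bool.eq_or_eq_not c b
    · rw [← hleaves, Multiset.count_cons_self] at h
      exact absurd (Multiset.count_pos.2 hc) (by lia)
    · exact h' (edge_mem_leaves.1 (hleaves ▸ Multiset.mem_cons_of_mem hc))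
  exact ⟨D, hD, by rw [← hleaves, rootedLeaves_map]⟩

variable {X : Type v} {x y z : X}

theorem cut_tripod_fst : (tripod x y z).cut x = some (.of y * .of z) := by
  simp [Tree.cut, tripod, cutAux]

theorem cut_tripod_snd (hxy : x ≠ y) : (tripod x y z).cut y = some (.of z * .of x) := by
  simp only [Tree.cut, tripod]
  rw [cutAux, if_neg hxy]
  change (none <|> (cutAux y (.of y) (.of z * .of x) <|> cutAux y (.of z) (.of x * .of y))) = _
  simp [cutAux]

theorem cut_tripod_thd (hxz : x ≠ z) (hyz : y ≠ z) :
    (tripod x y z).cut z = some (.of x * .of y) := by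
  simp only [Tree.cut, tripod]
  rw [cutAux, if_neg hxz]
  change (none <|> (cutAux z (.of y) (.of z * .of x) <|> cutAux z (.of z) (.of x * .of y))) = _
  simp [cutAux, hyz]

end TreeEnds

/-- The boundary of a hairy graph with two trees, with values in the target of a tree form. -/
noncomputable def TreeForm.boundary {H : Type v} {W : Type w} [AddCommGroup W] {n : ℕ}
    (φ : TreeForm (Leaf H n) W) (t₁ t₂ : Tree (Leaf H (n + 1))) : W :=
  ∑ e : Fin (n + 1), ((join e false t₁ t₂).elim 0 (fun t => φ.toFun t.1 t.2) -
    (join e true t₁ t₂).elim 0 (fun t => φ.toFun t.1 t.2))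

namespace SymForm

variable {R : Type u} [CommRing R] {H : Type v} [AddCommGroup H] [Module R H]
  {W : Type w} [AddCommGroup W] [Module R W] (φ : SymForm R H W)

theorem toFun_map_place (f : Fin 2) (b c : Bool) (A B : FreeMagma (Leaf H 2)) :
    φ.toFun (FreeMagma.map (place f b c) A) (FreeMagma.map (place f b c) B) =
      (sgn b * sgn c) • φ.toFun A B := by
  cases b <;> cases c <;>
    simp [place_true_left, place_true_right, place_false_false, ← freeMagma_map_map, φ.reverse,
      φ.renumber, sgn]

variable [Invertible (2 : R)]

theorem toFun_eq_form_place {e f : Fin 3} (hef : e ≠ f) (b c : Bool)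
    (A B : FreeMagma (Leaf H 2)) :
    φ.toFun A B = (sgn b * sgn c) •
      φ.form R (lieEval (φ.leaf R ∘ place f b c) (FreeMagma.map (Leaf.succAbove e) A))
        (lieEval (φ.leaf R ∘ place f b c) (FreeMagma.map (Leaf.succAbove e) B)) := by
  obtain ⟨f, rfl⟩ := Fin.exists_succAbove_eq hef.symm
  have hsq : sgn b * sgn c * (sgn b * sgn c) = 1 := by cases b <;> cases c <;> rfl
  rw [lieEval_map, lieEval_map, Function.comp_assoc, place_comp_succAbove, ← lieEval_map,
    ← lieEval_map, ← φ.toFun_eq_form R, φ.toFun_map_place, smul_smul, hsq, one_smul]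

theorem boundary_term {e f : Fin 3} (hef : e ≠ f) (a b c : Bool) {t₁ t₂ : Tree (Leaf H 3)}
    {A : FreeMagma (Leaf H 3)} (hA : t₁.cut (.edge e a) = some A)
    (hAe : ∀ b, (e, b) ∉ rootedEnds A) (h₁ : (e, !a) ∉ t₁.ends) (h₂ : (e, a) ∉ t₂.ends)
    (h₂' : t₂.ends.count (e, !a) = 1) :
    (join e false t₁ t₂).elim 0 (fun t => φ.toFun t.1 t.2) -
        (join e true t₁ t₂).elim 0 (fun t => φ.toFun t.1 t.2) =
      (sgn a * (sgn b * sgn c)) • φ.form R (lieEval (φ.leaf R ∘ place f b c) A)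
        (root R (φ.leaf R ∘ place f b c) (.edge e !a) t₂.1 t₂.2) := by
  classical
  obtain ⟨A, rfl⟩ := exists_map_succAbove hAe
  obtain ⟨B, hB, -⟩ := exists_cut_of_count_ends h₂' (by rwa [Bool.not_not])
  have hjoin : join e a t₁ t₂ = some (A, B) := by
    rw [join, hA, hB, Option.bind_some, Option.bind_some, dropEdge_map_succAbove,
      dropEdge_map_succAbove]
    rfl
  have hjoin' : join e (!a) t₁ t₂ = none := join_eq_none_left h₁
  rw [← lieEval_of_cut_eq_some R _ (count_edge_leaves.trans h₂') hB, mul_smul,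
    ← φ.toFun_eq_form_place hef]
  cases a
  · rw [Bool.not_false] at hjoin'
    simp [hjoin, hjoin', sgn]
  · rw [Bool.not_true] at hjoin'
    simp [hjoin, hjoin', sgn]

theorem sum_fin_three {M : Type*} [AddCommMonoid M] (F : Fin 3 → M) {e f g : Fin 3} (hef : e ≠ f)
    (heg : e ≠ g) (hfg : f ≠ g) : ∑ i, F i = F e + F f + F g := by
  have huniv : (Finset.univ : Finset (Fin 3)) = {e, f, g} := by
    clear F
    revert e f g
    decide
  rw [huniv, Finset.sum_insert (by simp [hef, heg]), Finset.sum_insert (by simp [hfg]),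
    Finset.sum_singleton, add_assoc]

theorem boundary_three {e f g : Fin 3} (hef : e ≠ f) (heg : e ≠ g)
    (hfg : f ≠ g) (a b c : Bool) {t : Tree (Leaf H 3)}
    (ht : t.ends = {(e, !a), (f, !b), (g, !c)}) :
    φ.boundary (tripod (.edge e a) (.edge f b) (.edge g c)) t =
      (sgn a * (sgn b * sgn c)) • (φ.form R ⁅φ.edgeEnd 0 false, φ.edgeEnd 1 false⁆
          (root R (φ.leaf R ∘ place f b c) (.edge e !a) t.1 t.2) +
        φ.form R ⁅φ.edgeEnd 0 false, φ.edgeEnd 1 false⁆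
          (root R (φ.leaf R ∘ place g c a) (.edge f !b) t.1 t.2) +
        φ.form R ⁅φ.edgeEnd 0 false, φ.edgeEnd 1 false⁆
          (root R (φ.leaf R ∘ place e a b) (.edge g !c) t.1 t.2)) := by
  rw [TreeForm.boundary, sum_fin_three _ hef heg hfg,
    φ.boundary_term hef a b c cut_tripod_fst (by simp [hef, heg])
      (by simp [tripod, Tree.ends_eq, hef, heg]) (by simp [ht, hef, heg])
      (by simp [ht, hef, heg]),
    φ.boundary_term hfg b c a (cut_tripod_snd (by simp [hef]))
      (by simp [hef.symm, hfg]) (by simp [tripod, Tree.ends_eq, hef.symm, hfg])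
      (by simp [ht, hef.symm, hfg]) (by simp [ht, hef.symm, hfg]),
    φ.boundary_term heg.symm c a b (cut_tripod_thd (by simp [heg]) (by simp [hfg]))
      (by simp [heg.symm, hfg.symm]) (by simp [tripod, Tree.ends_eq, heg.symm, hfg.symm])
      (by simp [ht, heg.symm, hfg.symm]) (by simp [ht, heg.symm, hfg.symm]),
    show sgn b * (sgn c * sgn a) = sgn a * (sgn b * sgn c) by ring,
    show sgn c * (sgn a * sgn b) = sgn a * (sgn b * sgn c) by ring, ← smul_add, ← smul_add]
  simp [place_edge_self, place_edge_of_ne, hef.symm, heg, hfg.symm, φ.leaf_edge]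

theorem boundary_two {e f g : Fin 3} (hef : e ≠ f) (heg : e ≠ g)
    (hfg : f ≠ g) (a b : Bool) (h : H) {t : Tree (Leaf H 3)}
    (ht : t.ends = {(e, !a), (f, !b), (g, false), (g, true)}) :
    φ.boundary (tripod (.edge e a) (.edge f b) (.hair h)) t =
      (sgn a * sgn b) • (φ.form R ⁅φ.edgeEnd 0 false, φ.hair h⁆
          (root R (φ.leaf R ∘ place f b false) (.edge e !a) t.1 t.2) +
        φ.form R ⁅φ.hair h, φ.edgeEnd 0 false⁆
          (root R (φ.leaf R ∘ place e a false) (.edge f !b) t.1 t.2)) := by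
  have hsgn : sgn false = 1 := rfl
  rw [TreeForm.boundary, sum_fin_three _ hef heg hfg,
    φ.boundary_term hef a b false cut_tripod_fst (by simp [hef])
      (by simp [tripod, Tree.ends_eq, hef]) (by simp [ht, hef, heg])
      (by simp [ht, hef, heg]),
    φ.boundary_term hef.symm b a false (cut_tripod_snd (by simp [hef]))
      (by simp [hef.symm]) (by simp [tripod, Tree.ends_eq, hef.symm])
      (by simp [ht, hef.symm, hfg]) (by simp [ht, hef.symm, hfg]),
    join_eq_none_left (by simp [tripod, Tree.ends_eq, heg.symm, hfg.symm]),
    join_eq_none_left (by simp [tripod, Tree.ends_eq, heg.symm, hfg.symm]),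
    hsgn, mul_one, mul_one, mul_comm (sgn b)]
  simp [place_edge_self, φ.leaf_edge, φ.leaf_hair]

theorem boundary_loop {e f g : Fin 3} (hef : e ≠ f) (heg : e ≠ g)
    (hfg : f ≠ g) (a b : Bool) {t : Tree (Leaf H 3)}
    (ht : t.ends = {(e, !a), (g, false), (g, true)}) :
    φ.boundary (tripod (.edge e a) (.edge f b) (.edge f !b)) t =
      (sgn a * sgn b) • φ.form R ⁅φ.edgeEnd 0 false, φ.edgeEnd 0 true⁆
          (root R (φ.leaf R ∘ place f b false) (.edge e !a) t.1 t.2) := by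
  have hsgn : sgn false = 1 := rfl
  rw [TreeForm.boundary, sum_fin_three _ hef heg hfg,
    φ.boundary_term hef a b false cut_tripod_fst (by simp [hef])
      (by simp [tripod, Tree.ends_eq, hef]) (by simp [ht, heg]) (by simp [ht, heg]),
    join_eq_none_right (e := f) (by simp [ht, hef.symm, hfg]),
    join_eq_none_right (e := f) (by simp [ht, hef.symm, hfg]),
    join_eq_none_left (e := g) (by simp [tripod, Tree.ends_eq, heg.symm, hfg.symm]),
    join_eq_none_left (e := g) (by simp [tripod, Tree.ends_eq, heg.symm, hfg.symm]),
    hsgn, mul_one]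
  simp [place_edge_self, φ.leaf_edge]

end SymForm

section WordExt

variable {R : Type u} [CommSemiring R] {M : Type v} [AddCommMonoid M] [Module R M]
  {W : Type w} [AddCommMonoid W] [Module R W]

theorem linearMap_ext_word {F G : TensorAlgebra R M →ₗ[R] W}
    (h : ∀ v, F (word R v) = G (word R v)) : F = G :=
  LinearMap.ext_on_range (span_range_word R) h

theorem tensorProduct_ext_word {F G : TensorAlgebra R M ⊗[R] TensorAlgebra R M →ₗ[R] W}
    (h : ∀ v w, F (word R v ⊗ₜ word R w) = G (word R v ⊗ₜ word R w)) : F = G :=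
  TensorProduct.ext <| linearMap_ext_word fun v => linearMap_ext_word (h v)

end WordExt

section Comb

variable {H : Type v} {n : ℕ}

theorem map_comb {m : ℕ} {σ : Leaf H n → Leaf H m} (hσ : ∀ h, σ (.hair h) = .hair h)
    (v : List H) (x : Leaf H n) : FreeMagma.map σ (comb v x) = comb v (σ x) := by
  induction v with
  | nil => rfl
  | cons h v ih => rw [comb_cons, map_mul, ih, FreeMagma.map_of, hσ, comb_cons]

theorem edge_mem_comb {v : List H} {e f : Fin n} {b c : Bool} :
    Leaf.edge e b ∈ rootedLeaves (comb v (.edge f c)) ↔ e = f ∧ b = c := by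
  rw [← mem_rootedEnds (x := (e, b)), rootedEnds_comb, Multiset.mem_singleton, Prod.mk.injEq]

end Comb

section RootComb

variable {k : Type u} [Field k] {H : Type v} [AddCommGroup H] [Module k H] {n : ℕ}
  {L : Type w} [LieRing L] [LieAlgebra k L] (η : H →ₗ[k] L) {ψ : Leaf H n → L}
  {e : Fin n} {b : Bool} {A B : FreeMagma (Leaf H n)}

theorem rootAux_comb (hψ : ∀ h, ψ (.hair h) = η h) (v : List H) (c : L) :
    rootAux k ψ (.edge e b) (comb v (.edge e b)) c = tensorAct η (rho k H (word k v)) c := by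
  induction v generalizing c with
  | nil => simp [rootAux_of_self]
  | cons h v ih =>
    rw [comb_cons, rootAux_mul, rootAux_of_ne k ψ (by simp), ih, lieEval_of, hψ, word_cons,
      rho_mul, map_mul, rho_ι, zero_add, Module.End.mul_apply, map_neg, LinearMap.neg_apply,
      tensorAct_ι, lie_skew]

theorem root_comb_mul (hψ : ∀ h, ψ (.hair h) = η h) (hA : Leaf.edge e b ∉ rootedLeaves A)
    (hB : Leaf.edge e b ∉ rootedLeaves B) (v : List H) :
    root k ψ (.edge e b) A (comb v (.edge e b) * B) =
      tensorAct η (rho k H (word k v)) ⁅lieEval ψ B, lieEval ψ A⁆ := by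
  rw [root, rootAux_eq_zero k ψ hA, rootAux_mul, rootAux_comb η hψ, rootAux_eq_zero k ψ hB,
    zero_add, add_zero]

theorem root_mul_comb (hψ : ∀ h, ψ (.hair h) = η h) (hA : Leaf.edge e b ∉ rootedLeaves A)
    (hB : Leaf.edge e b ∉ rootedLeaves B) (v : List H) :
    root k ψ (.edge e b) A (B * comb v (.edge e b)) =
      tensorAct η (rho k H (word k v)) ⁅lieEval ψ A, lieEval ψ B⁆ := by
  rw [root, rootAux_eq_zero k ψ hA, rootAux_mul, rootAux_comb η hψ, rootAux_eq_zero k ψ hB,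
    zero_add, zero_add]

end RootComb

section Pairing

variable {R : Type u} [CommRing R] [Invertible (2 : R)] {H : Type v} [AddCommGroup H] [Module R H]
  {W : Type w} [AddCommGroup W] [Module R W]

namespace HairForm

variable (φ : HairForm R H 2 W)

/-- The values `⟨[x · u, y · v], [z · s, t · w]⟩` of a hair form on the trees whose core is an
H-shaped tree with the ends `x`, `y`, `z`, `t` of the two external edges, with hairs along the
edges. -/
noncomputable def pairing (x y z t : Fin 2 × Bool) :
    TensorAlgebra R H ⊗[R] TensorAlgebra R H →ₗ[R]
      TensorAlgebra R H ⊗[R] TensorAlgebra R H →ₗ[R] W :=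
  (φ.form R).compl₁₂ (tensorActLie φ.hair (φ.edgeEnd x.1 x.2) (φ.edgeEnd y.1 y.2))
    (tensorActLie φ.hair (φ.edgeEnd z.1 z.2) (φ.edgeEnd t.1 t.2))

theorem pairing_tmul (x y z t : Fin 2 × Bool) (p q r s : TensorAlgebra R H) :
    φ.pairing x y z t (p ⊗ₜ q) (r ⊗ₜ s) =
      φ.form R ⁅tensorAct φ.hair p (φ.edgeEnd x.1 x.2), tensorAct φ.hair q (φ.edgeEnd y.1 y.2)⁆
        ⁅tensorAct φ.hair r (φ.edgeEnd z.1 z.2), tensorAct φ.hair s (φ.edgeEnd t.1 t.2)⁆ := rfl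

theorem toFun_comb (x y z t : Fin 2 × Bool) (p q r s : List H) :
    φ.toFun (comb p (.edge x.1 x.2) * comb q (.edge y.1 y.2))
      (comb r (.edge z.1 z.2) * comb s (.edge t.1 t.2)) =
      φ.pairing x y z t (word R p ⊗ₜ word R q) (word R r ⊗ₜ word R s) := by
  rw [φ.toFun_eq_form R, pairing_tmul]
  simp only [lieEval_mul, lieEval_comb φ.hair φ.leaf_hair, φ.leaf_edge]

theorem pairing_ι_mul (x y z t : Fin 2 × Bool) (h : H)
    (p q : TensorAlgebra R H ⊗[R] TensorAlgebra R H) :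
    φ.pairing x y z t ((TensorAlgebra.ι R h ⊗ₜ 1 + 1 ⊗ₜ TensorAlgebra.ι R h) * p) q =
      -φ.pairing x y z t p ((TensorAlgebra.ι R h ⊗ₜ 1 + 1 ⊗ₜ TensorAlgebra.ι R h) * q) := by
  simp only [pairing, LinearMap.compl₁₂_apply, tensorActLie_ι_mul]
  rw [← lie_skew, map_neg, LinearMap.neg_apply, φ.form_lie R]

theorem pairing_symm (x y z t : Fin 2 × Bool) (p q : TensorAlgebra R H ⊗[R] TensorAlgebra R H) :
    φ.pairing x y z t p q = φ.pairing z t x y q p := by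
  simp only [pairing, LinearMap.compl₁₂_apply]
  rw [φ.form_symm R]

theorem pairing_comm (x y z t : Fin 2 × Bool) (p q r s : TensorAlgebra R H) :
    φ.pairing y x t z (q ⊗ₜ p) (s ⊗ₜ r) = φ.pairing x y z t (p ⊗ₜ q) (r ⊗ₜ s) := by
  rw [pairing_tmul, pairing_tmul, ← lie_skew (tensorAct φ.hair q _),
    ← lie_skew (tensorAct φ.hair s _), map_neg, map_neg, LinearMap.neg_apply, neg_neg]

theorem form_tensorAct {k : Type u} [Field k] [Invertible (2 : k)] [Module k H] [Module k W]
    (φ : HairForm k H 2 W) (x : TensorAlgebra k H) (a b : φ.L) :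
    φ.form k (tensorAct φ.hair x a) b = φ.form k a (tensorAct φ.hair (rho k H x) b) :=
  apply_tensorAct_left φ.hair (φ.form_lie k) x a b

/-- The values of a hair form on the theta graphs, with hairs along all four half-edges. -/
noncomputable abbrev thetaPairing :
    TensorAlgebra R H ⊗[R] TensorAlgebra R H →ₗ[R]
      TensorAlgebra R H ⊗[R] TensorAlgebra R H →ₗ[R] W :=
  φ.pairing (0, false) (1, false) (0, true) (1, true)

end HairForm

namespace SymForm

variable (φ : SymForm R H W)

theorem pairing_eq_smul_thetaPairing (b c : Bool) :
    φ.pairing (0, b) (1, c) (0, !b) (1, !c) = (sgn b * sgn c) • φ.thetaPairing := by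
  refine tensorProduct_ext_word fun p q => tensorProduct_ext_word fun r s => ?_
  rw [LinearMap.smul_apply, LinearMap.smul_apply, ← HairForm.toFun_comb, ← HairForm.toFun_comb,
    ← φ.toFun_map_place 0 b c]
  simp [map_comb (place_hair 0 b c), place]

theorem thetaPairing_symm (p q : TensorAlgebra R H ⊗[R] TensorAlgebra R H) :
    φ.thetaPairing p q = φ.thetaPairing q p := by
  have h := φ.pairing_eq_smul_thetaPairing true true
  rw [show sgn true * sgn true = 1 from rfl, one_smul] at h
  rw [φ.pairing_symm]
  exact LinearMap.congr_fun₂ h q p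

theorem thetaPairing_comm (p q r s : TensorAlgebra R H) :
    φ.thetaPairing (q ⊗ₜ p) (s ⊗ₜ r) = φ.thetaPairing (p ⊗ₜ q) (r ⊗ₜ s) := by
  have h : φ.pairing (1, false) (0, false) (1, true) (0, true) = φ.thetaPairing := by
    refine tensorProduct_ext_word fun p q => tensorProduct_ext_word fun r s => ?_
    rw [← HairForm.toFun_comb, ← HairForm.toFun_comb, ← φ.renumber (Equiv.swap 0 1)]
    simp [map_comb (σ := Leaf.renumber (Equiv.swap 0 1)) (fun _ => rfl), Leaf.renumber]
  rw [← LinearMap.congr_fun₂ h (q ⊗ₜ p) (s ⊗ₜ r), HairForm.pairing_comm]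

end SymForm

end Pairing

namespace SymForm

variable {k : Type u} [Field k] [Invertible (2 : k)] {H : Type v} [AddCommGroup H] [Module k H]
  {W : Type w} [AddCommGroup W] [Module k W] (φ : SymForm k H W)

theorem leaf_place_hair (f : Fin 3) (b c : Bool) (h : H) :
    (φ.leaf k ∘ place f b c) (.hair h) = φ.hair h := rfl

theorem lieEval_place_comb_self (f : Fin 3) (b c β : Bool) (v : List H) :
    lieEval (φ.leaf k ∘ place f b c) (comb v (.edge f β)) =
      tensorAct φ.hair (word k v) (φ.edgeEnd 0 (xor β b)) := by
  rw [lieEval_comb φ.hair (φ.leaf_place_hair f b c), Function.comp_apply, place_edge_self,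
    φ.leaf_edge]

theorem lieEval_place_comb_of_ne {f i : Fin 3} (hi : i ≠ f) (b c β : Bool) (v : List H) :
    lieEval (φ.leaf k ∘ place f b c) (comb v (.edge i β)) =
      tensorAct φ.hair (word k v) (φ.edgeEnd 1 (xor β c)) := by
  rw [lieEval_comb φ.hair (φ.leaf_place_hair f b c), Function.comp_apply, place_edge_of_ne hi,
    φ.leaf_edge]

variable {e f g : Fin 3} (hef : e ≠ f) (heg : e ≠ g) (hfg : f ≠ g)

include hef heg hfg

theorem boundary_three_comb (a b c : Bool) (v w : List H) :
    φ.boundary (tripod (.edge e a) (.edge f b) (.edge g c))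
        (.of (.edge e !a), comb v (.edge f !b) * comb w (.edge g !c)) =
      (sgn a * (sgn b * sgn c)) • (φ.thetaPairing (1 ⊗ₜ 1) (word k v ⊗ₜ word k w) +
        φ.form k ⁅φ.edgeEnd 0 false, φ.edgeEnd 1 false⁆ (tensorAct φ.hair (rho k H (word k v))
          ⁅tensorAct φ.hair (word k w) (φ.edgeEnd 0 true), φ.edgeEnd 1 true⁆) +
        φ.form k ⁅φ.edgeEnd 0 false, φ.edgeEnd 1 false⁆ (tensorAct φ.hair (rho k H (word k w))
          ⁅φ.edgeEnd 0 true, tensorAct φ.hair (word k v) (φ.edgeEnd 1 true)⁆)) := by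
  rw [φ.boundary_three hef heg hfg a b c (by
    simp only [Tree.ends_eq, rootedEnds_mul, rootedEnds_comb, rootedEnds_edge,
      Multiset.insert_eq_cons, ← Multiset.singleton_add]),
    root_of_left k _ (by simp [edge_mem_comb, hef, heg]),
    root_comb_mul φ.hair (φ.leaf_place_hair g c a) (by simp [hef.symm])
      (by simp [edge_mem_comb, hfg]),
    root_mul_comb φ.hair (φ.leaf_place_hair e a b) (by simp [heg.symm])
      (by simp [edge_mem_comb, hfg.symm]),
    HairForm.pairing_tmul, lieEval_mul, φ.lieEval_place_comb_self, φ.lieEval_place_comb_self,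
    φ.lieEval_place_comb_of_ne hfg.symm, φ.lieEval_place_comb_of_ne hef.symm]
  simp [place_edge_self, place_edge_of_ne heg, φ.leaf_edge]

theorem boundary_two_comb (a b β : Bool) (h : H) (u v w : List H) :
    φ.boundary (tripod (.edge e a) (.edge f b) (.hair h))
        (.of (.edge e !a) * comb v (.edge g β), comb u (.edge f !b) * comb w (.edge g !β)) =
      (-(sgn a * sgn b * sgn β)) •
        (φ.thetaPairing (TensorAlgebra.ι k h ⊗ₜ word k v) (word k u ⊗ₜ word k w) +
          φ.thetaPairing ((word k u * TensorAlgebra.ι k h) ⊗ₜ word k w) (1 ⊗ₜ word k v)) := by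
  have hform : ∀ x y z t : φ.L, φ.form k x ⁅y, ⁅z, t⁆⁆ = φ.form k ⁅x, y⁆ ⁅z, t⁆ :=
    fun x y z t => (φ.form_lie k _ _ _).symm
  have h₁ := LinearMap.congr_fun₂ (φ.pairing_eq_smul_thetaPairing false β)
    (TensorAlgebra.ι k h ⊗ₜ word k v) (word k u ⊗ₜ word k w)
  have h₂ := LinearMap.congr_fun₂ (φ.pairing_eq_smul_thetaPairing false !β)
    ((word k u * TensorAlgebra.ι k h) ⊗ₜ word k w) (1 ⊗ₜ word k v)
  have hβ : sgn (!β) = -sgn β := by cases β <;> rfl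
  rw [show sgn false = 1 from rfl, one_mul, HairForm.pairing_tmul] at h₁ h₂
  simp only [Bool.not_not, hβ, map_one, Module.End.one_apply, tensorAct_ι, Bool.not_false,
    map_mul, Module.End.mul_apply, LinearMap.smul_apply, neg_smul, LinearMap.neg_apply] at h₁ h₂
  rw [φ.boundary_two hef heg hfg a b h (by
    simp only [Tree.ends_eq, rootedEnds_mul, rootedEnds_comb, rootedEnds_edge,
      Multiset.insert_eq_cons, ← Multiset.singleton_add]
    cases β <;> abel),
    root_of_mul k _ (by simp [edge_mem_comb, heg]) (by simp [edge_mem_comb, hef, heg]),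
    root_comb_mul φ.hair (φ.leaf_place_hair e a false) (by simp [edge_mem_comb, hef.symm, hfg])
      (by simp [edge_mem_comb, hfg]), ← φ.form_tensorAct, lieEval_mul, lieEval_mul,
    φ.lieEval_place_comb_self, φ.lieEval_place_comb_of_ne hfg.symm,
    φ.lieEval_place_comb_of_ne hfg.symm, φ.lieEval_place_comb_of_ne heg.symm,
    φ.lieEval_place_comb_of_ne heg.symm, lieEval_of, Function.comp_apply, place_edge_self,
    φ.leaf_edge, hform, hform]
  simp only [Bool.bne_false, Bool.not_bne, bne_self_eq_false, Bool.not_false]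
  rw [← lie_skew (φ.edgeEnd 0 false) (φ.hair h), neg_lie, map_neg, LinearMap.neg_apply, h₁, h₂,
    neg_smul, mul_smul (sgn a * sgn b), smul_add (sgn β), smul_add, smul_add, smul_neg, smul_neg,
    neg_add]

theorem boundary_loop_comb (a b : Bool) (v w : List H) :
    φ.boundary (tripod (.edge e a) (.edge f b) (.edge f !b))
        (.of (.edge e !a), comb v (.edge g false) * comb w (.edge g true)) =
      (sgn a * sgn b) • (φ.thetaPairing (1 ⊗ₜ word k v) (1 ⊗ₜ word k w) +
        φ.thetaPairing (1 ⊗ₜ word k w) (1 ⊗ₜ word k v)) := by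
  have hform : ∀ x y z t : φ.L, φ.form k x ⁅y, ⁅z, t⁆⁆ = φ.form k ⁅x, y⁆ ⁅z, t⁆ :=
    fun x y z t => (φ.form_lie k _ _ _).symm
  have h := LinearMap.congr_fun₂ (φ.pairing_eq_smul_thetaPairing false true)
    (1 ⊗ₜ word k w) (1 ⊗ₜ word k v)
  rw [show sgn false * sgn true = -1 from rfl, HairForm.pairing_tmul] at h
  simp only [map_one, Module.End.one_apply, Bool.not_false, Bool.not_true] at h
  rw [φ.boundary_loop hef heg hfg a b (by
    simp only [Tree.ends_eq, rootedEnds_mul, rootedEnds_comb, rootedEnds_edge,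
      Multiset.insert_eq_cons, ← Multiset.singleton_add]),
    root_of_left k _ (by simp [edge_mem_comb, heg]), lieEval_mul,
    φ.lieEval_place_comb_of_ne hfg.symm, φ.lieEval_place_comb_of_ne hfg.symm, φ.form_lie k,
    leibniz_lie, ← lie_skew ⁅φ.edgeEnd 0 true, _⁆, map_add, map_neg]
  simp only [Bool.bne_false, hform, h]
  rw [LinearMap.smul_apply, LinearMap.smul_apply, neg_one_smul, neg_neg, add_comm,
    HairForm.pairing_tmul, HairForm.pairing_tmul]
  simp

omit hef heg hfg

variable {G : TensorAlgebra k H ⊗[k] TensorAlgebra k H →ₗ[k] W}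

theorem form_tensorActLie_right
    (hG : ∀ v w, φ.thetaPairing (1 ⊗ₜ 1) (v ⊗ₜ w) = G (rho k H v ⊗ₜ w)) (v w : TensorAlgebra k H)
    (x : TensorAlgebra k H ⊗[k] TensorAlgebra k H) :
    φ.form k ⁅φ.edgeEnd 0 false, φ.edgeEnd 1 false⁆
        (tensorActLie φ.hair (tensorAct φ.hair v (φ.edgeEnd 0 true))
          (tensorAct φ.hair w (φ.edgeEnd 1 true)) x) =
      G ((rho k H).rTensor _ (x * (v ⊗ₜ w))) := by
  induction x using TensorProduct.induction_on with
  | zero => simp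
  | add p q hp hq => simp only [map_add, add_mul, hp, hq]
  | tmul p q =>
    have h := hG (p * v) (q * w)
    rw [HairForm.pairing_tmul] at h
    simpa only [map_one, Module.End.one_apply, map_mul, Module.End.mul_apply, tensorActLie_tmul,
      Algebra.TensorProduct.tmul_mul_tmul, LinearMap.rTensor_tmul] using h

theorem boundary_three_value
    (hG : ∀ v w, φ.thetaPairing (1 ⊗ₜ 1) (v ⊗ₜ w) = G (rho k H v ⊗ₜ w))
    (hswap : ∀ x, G (TensorProduct.map (rho k H) (rho k H) (TensorProduct.comm k _ _ x)) = G x)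
    (v w : TensorAlgebra k H) :
    φ.thetaPairing (1 ⊗ₜ 1) (v ⊗ₜ w) +
        φ.form k ⁅φ.edgeEnd 0 false, φ.edgeEnd 1 false⁆ (tensorAct φ.hair (rho k H v)
          ⁅tensorAct φ.hair w (φ.edgeEnd 0 true), φ.edgeEnd 1 true⁆) +
        φ.form k ⁅φ.edgeEnd 0 false, φ.edgeEnd 1 false⁆ (tensorAct φ.hair (rho k H w)
          ⁅φ.edgeEnd 0 true, tensorAct φ.hair v (φ.edgeEnd 1 true)⁆) =
      G (triRelator k H (rho k H v) w) := by
  have hcomm (x : TensorAlgebra k H ⊗[k] TensorAlgebra k H) :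
      G ((rho k H).rTensor _ (TensorProduct.comm k _ _ x)) = G ((rho k H).rTensor _ x) := by
    rw [← hswap ((rho k H).rTensor _ x), ← LinearMap.lTensor_comm, LinearMap.map_lTensor,
      rho_comp_rho]
    rfl
  have hcomm_mul (x : TensorAlgebra k H) (a b : TensorAlgebra k H) :
      TensorProduct.comm k _ _ (Delta k H x * (a ⊗ₜ b)) = Delta k H x * (b ⊗ₜ a) := by
    conv_rhs => rw [← comm_Delta]
    exact map_mul (Algebra.TensorProduct.comm k _ _) _ _
  have hv := φ.form_tensorActLie_right hG w 1 (Delta k H (rho k H v))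
  have hw := φ.form_tensorActLie_right hG 1 v (Delta k H (rho k H w))
  rw [map_one, Module.End.one_apply, ← tensorAct_lie, ← hcomm, hcomm_mul] at hv hw
  have hw_rho : (rho k H).rTensor _ (Delta k H (rho k H w) * (v ⊗ₜ 1)) =
      (rho k H).lTensor _ ((rho k H v ⊗ₜ 1) * Delta k H w) := by
    rw [Delta_rho, ← rho_one k (H := H), ← rho_rho k v, ← TensorProduct.map_tmul, ← map_rho_mul,
      LinearMap.rTensor_map, rho_comp_rho, rho_rho]
    simp only [rho_one]
    rfl
  rw [hv, hw, hw_rho, hG, triRelator, map_add, map_add]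
  abel

end SymForm

section RootHairForm

variable {R : Type u} [CommRing R] {H : Type v} [AddCommGroup H] [Module R H] {n : ℕ}
  {L : Type*} [LieRing L] [LieAlgebra R L] {W : Type w} [AddCommGroup W] [Module R W]

/-- The tree form `rootForm` at an end of an external edge, as a hair form. -/
noncomputable def rootHairForm (η : H →ₗ[R] L) (ψ : Leaf H n → L) (hψ : ∀ h, ψ (.hair h) = η h)
    (e : Fin n) (b : Bool) (f : L →ₗ[R] W) : HairForm R H n W where
  toTreeForm := rootForm R ψ (.edge e b) f
  hair_add h h' B := by
    change f _ = f _ + f _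
    simp [root, rootAux_of_ne, hψ]
  hair_smul c h B := by
    change f _ = c • f _
    simp [root, rootAux_of_ne, hψ]

end RootHairForm

section RootHairFormPairing

variable {R : Type u} [CommRing R] [Invertible (2 : R)] {H : Type v} [AddCommGroup H] [Module R H]
  {L : Type*} [LieRing L] [LieAlgebra R L] {W : Type w} [AddCommGroup W] [Module R W]

theorem pairing_rootHairForm {η : H →ₗ[R] L} {ψ : Leaf H 2 → L} (hψ : ∀ h, ψ (.hair h) = η h)
    (f : L →ₗ[R] W) {x y z t : Fin 2 × Bool} (hy : x ≠ y) (hz : x ≠ z) (ht : x ≠ t)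
    (u v w : List H) :
    (rootHairForm η ψ hψ x.1 x.2 f).pairing x y z t (1 ⊗ₜ word R u) (word R v ⊗ₜ word R w) =
      f ⁅tensorAct η (word R u) (ψ (.edge y.1 y.2)), ⁅tensorAct η (word R v) (ψ (.edge z.1 z.2)),
        tensorAct η (word R w) (ψ (.edge t.1 t.2))⁆⁆ := by
  have hmem {y : Fin 2 × Bool} (hy : x ≠ y) (v : List H) :
      Leaf.edge x.1 x.2 ∉ rootedLeaves (comb v (.edge y.1 y.2)) := by
    rwa [edge_mem_comb, ← Prod.ext_iff]
  rw [← word_nil, ← HairForm.toFun_comb, comb_nil]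
  refine congrArg f ((root_of_mul R ψ (hmem hy u) ?_).trans ?_)
  · rw [rootedLeaves_mul, Multiset.mem_add, not_or]
    exact ⟨hmem hz v, hmem ht w⟩
  · simp only [lieEval_mul, lieEval_comb η hψ]

end RootHairFormPairing

section Words

attribute [local instance] LieRing.ofAssociativeRing

theorem tensorAct_apply_one {R : Type u} [CommRing R] {H : Type v} [AddCommGroup H] [Module R H]
    {L : Type*} [LieRing L] [LieAlgebra R L] {η : H →ₗ[R] L} {F : TensorAlgebra R H →ₗ[R] L}
    (hF : ∀ h x, F (TensorAlgebra.ι R h * x) = ⁅η h, F x⁆) (x : TensorAlgebra R H) :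
    tensorAct η x (F 1) = F x := by
  induction x using left_induction with
  | one => simp
  | ι_mul h x hx => rw [map_mul, Module.End.mul_apply, tensorAct_ι, hx, hF]
  | add x y hx hy => simp [hx, hy]
  | smul c x hx => simp [hx]

variable (R : Type u) [CommRing R] (H : Type v) [AddCommGroup H] [Module R H]

/-- The span of the words with at most three letters other than elements of `H`, in which these
letters occur in a fixed order and the first letter stands at the right end. The tensor factors
are the strings of elements of `H` to the left of each letter. -/
abbrev Words : Type (max u v) :=
  R × TensorAlgebra R H × (TensorAlgebra R H ⊗[R] TensorAlgebra R H) ×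
    (TensorAlgebra R H ⊗[R] (TensorAlgebra R H ⊗[R] TensorAlgebra R H))

/-- The operators on words that add the first letter. -/
noncomputable def firstLetter : TensorAlgebra R H →ₗ[R] Module.End R (Words R H) where
  toFun x := LinearMap.inr R _ _ ∘ₗ LinearMap.inl R _ _ ∘ₗ LinearMap.toSpanSingleton R _ x ∘ₗ
    LinearMap.fst R _ _
  map_add' x y := LinearMap.ext fun p => by simp
  map_smul' c x := LinearMap.ext fun p => by simp [smul_comm p.1 c]

/-- The operators on words that add the second letter. -/
noncomputable def secondLetter : TensorAlgebra R H →ₗ[R] Module.End R (Words R H) where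
  toFun x := LinearMap.inr R _ _ ∘ₗ LinearMap.inr R _ _ ∘ₗ LinearMap.inl R _ _ ∘ₗ
    TensorProduct.mk R _ _ x ∘ₗ LinearMap.fst R _ _ ∘ₗ LinearMap.snd R _ _
  map_add' x y := LinearMap.ext fun p => by simp
  map_smul' c x := LinearMap.ext fun p => by simp [TensorProduct.smul_tmul']

/-- The operators on words that add the third letter. -/
noncomputable def thirdLetter : TensorAlgebra R H →ₗ[R] Module.End R (Words R H) where
  toFun x := LinearMap.inr R _ _ ∘ₗ LinearMap.inr R _ _ ∘ₗ LinearMap.inr R _ _ ∘ₗ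
    TensorProduct.mk R _ _ x ∘ₗ LinearMap.fst R _ _ ∘ₗ LinearMap.snd R _ _ ∘ₗ LinearMap.snd R _ _
  map_add' x y := LinearMap.ext fun p => by simp
  map_smul' c x := LinearMap.ext fun p => by simp [TensorProduct.smul_tmul']

/-- The diagonal action of the elements of `H` on words. -/
noncomputable def diagLetter : H →ₗ[R] Module.End R (Words R H) where
  toFun h := LinearMap.prodMap 0 (LinearMap.prodMap (LinearMap.mulLeft R (TensorAlgebra.ι R h))
    (LinearMap.prodMap
      (LinearMap.mulLeft R (TensorAlgebra.ι R h ⊗ₜ 1 + 1 ⊗ₜ TensorAlgebra.ι R h))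
      (LinearMap.mulLeft R (TensorAlgebra.ι R h ⊗ₜ 1 +
        1 ⊗ₜ (TensorAlgebra.ι R h ⊗ₜ 1 + 1 ⊗ₜ TensorAlgebra.ι R h)))))
  map_add' h h' := LinearMap.ext fun p => by
    simp only [map_add, TensorProduct.add_tmul, TensorProduct.tmul_add, LinearMap.prodMap_apply,
      LinearMap.zero_apply, LinearMap.mulLeft_apply, add_mul, LinearMap.add_apply, Prod.mk_add_mk,
      add_zero, Prod.mk.injEq, true_and]
    constructor <;> abel
  map_smul' c h := LinearMap.ext fun p => by
    simp [← TensorProduct.smul_tmul', TensorProduct.tmul_add, add_mul, smul_add, smul_mul_assoc]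

variable {R H}

theorem tensorAct_firstLetter (x : TensorAlgebra R H) :
    tensorAct (diagLetter R H) x (firstLetter R H 1) = firstLetter R H x :=
  tensorAct_apply_one (fun h x => LinearMap.ext fun p => by
    simp [firstLetter, diagLetter, Ring.lie_def, Prod.ext_iff]) x

theorem tensorAct_secondLetter (x : TensorAlgebra R H) :
    tensorAct (diagLetter R H) x (secondLetter R H 1) = secondLetter R H x :=
  tensorAct_apply_one (fun h x => LinearMap.ext fun p => by
    simp [secondLetter, diagLetter, Ring.lie_def, add_mul]) x

theorem tensorAct_thirdLetter (x : TensorAlgebra R H) :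
    tensorAct (diagLetter R H) x (thirdLetter R H 1) = thirdLetter R H x :=
  tensorAct_apply_one (fun h x => LinearMap.ext fun p => by
    simp [thirdLetter, diagLetter, Ring.lie_def, add_mul _ _ (x ⊗ₜ[R] p.2.2.1)]) x

variable (R H)

/-- The operators on words given by the hairs and by the ends of the external edges. The end
`(0, false)` is sent to `0`, since it will be the root. -/
noncomputable def letterOp : Leaf H 2 → Module.End R (Words R H)
  | .hair h => diagLetter R H h
  | .edge e b => if b then (if e = 0 then firstLetter R H 1 else secondLetter R H 1)
      else (if e = 0 then 0 else thirdLetter R H 1)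

theorem letterOp_hair (h : H) : letterOp R H (.hair h) = diagLetter R H h := rfl

end Words

section WordForm

attribute [local instance] LieRing.ofAssociativeRing

variable {k : Type u} [Field k] {H : Type v} [AddCommGroup H] [Module k H]
  {W : Type w} [AddCommGroup W] [Module k W]

/-- The map `x ⊗ (y ⊗ z) ↦ -F (ρ(z) ⊗ y ρ(x))`. -/
noncomputable def readOff (F : TensorAlgebra k H ⊗[k] TensorAlgebra k H →ₗ[k] W) :
    TensorAlgebra k H ⊗[k] (TensorAlgebra k H ⊗[k] TensorAlgebra k H) →ₗ[k] W :=
  -(F ∘ₗ TensorProduct.map (rho k H)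
      (TensorProduct.lift ((LinearMap.mul k (TensorAlgebra k H)).flip ∘ₗ rho k H)) ∘ₗ
    (TensorProduct.comm k _ _).toLinearMap ∘ₗ (TensorProduct.assoc k _ _ _).symm.toLinearMap)

theorem readOff_tmul (F : TensorAlgebra k H ⊗[k] TensorAlgebra k H →ₗ[k] W)
    (x y z : TensorAlgebra k H) :
    readOff F (x ⊗ₜ (y ⊗ₜ z)) = -F (rho k H z ⊗ₜ (y * rho k H x)) := by
  simp [readOff]

/-- The hair form that roots a tree at the tail of the first external edge and reads off the words
in which the letters of the three remaining ends occur in the given order. -/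
noncomputable def wordForm (F : TensorAlgebra k H ⊗[k] TensorAlgebra k H →ₗ[k] W) :
    HairForm k H 2 W :=
  rootHairForm (diagLetter k H) (letterOp k H) (letterOp_hair k H) 0 false
    (readOff F ∘ₗ LinearMap.snd k _ _ ∘ₗ LinearMap.snd k _ _ ∘ₗ LinearMap.snd k _ _ ∘ₗ
      LinearMap.applyₗ ((1, 0, 0, 0) : Words k H))

end WordForm

section Gluing

variable {k : Type u} [Field k] {H : Type v} [AddCommGroup H] [Module k H]
  {W : Type w} [AddCommGroup W] [Module k W]

/-- The bilinear map `(α ⊗ β, γ ⊗ δ) ↦ F (α ρ(γ) ⊗ δ ρ(β))`: the hairs along the two halves of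
each external edge of a theta graph are glued to one word. -/
noncomputable def gluing (F : TensorAlgebra k H ⊗[k] TensorAlgebra k H →ₗ[k] W) :
    TensorAlgebra k H ⊗[k] TensorAlgebra k H →ₗ[k]
      TensorAlgebra k H ⊗[k] TensorAlgebra k H →ₗ[k] W :=
  ((LinearMap.mul k (TensorAlgebra k H ⊗[k] TensorAlgebra k H)).compl₁₂ LinearMap.id
    (TensorProduct.map (rho k H) (rho k H))).compr₂ (F ∘ₗ (rho k H).lTensor _)

theorem gluing_tmul (F : TensorAlgebra k H ⊗[k] TensorAlgebra k H →ₗ[k] W)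
    (α β γ δ : TensorAlgebra k H) :
    gluing F (α ⊗ₜ β) (γ ⊗ₜ δ) = F ((α * rho k H γ) ⊗ₜ (δ * rho k H β)) := by
  simp [gluing]

/-- Invariance of a bilinear map on `T(H) ⊗ T(H)` under the diagonal action of `H`. -/
def IsDiagInvariant (A : TensorAlgebra k H ⊗[k] TensorAlgebra k H →ₗ[k]
    TensorAlgebra k H ⊗[k] TensorAlgebra k H →ₗ[k] W) : Prop :=
  ∀ h p q, A ((TensorAlgebra.ι k h ⊗ₜ 1 + 1 ⊗ₜ TensorAlgebra.ι k h) * p) q =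
    -A p ((TensorAlgebra.ι k h ⊗ₜ 1 + 1 ⊗ₜ TensorAlgebra.ι k h) * q)

theorem IsDiagInvariant.ext {A B : TensorAlgebra k H ⊗[k] TensorAlgebra k H →ₗ[k]
    TensorAlgebra k H ⊗[k] TensorAlgebra k H →ₗ[k] W} (hA : IsDiagInvariant A)
    (hB : IsDiagInvariant B) (h : ∀ v s t : List H,
      A (1 ⊗ₜ word k v) (word k s ⊗ₜ word k t) = B (1 ⊗ₜ word k v) (word k s ⊗ₜ word k t)) :
    A = B := by
  refine tensorProduct_ext_word fun u v => ?_
  induction u generalizing v with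
  | nil => exact tensorProduct_ext_word fun s t => h v s t
  | cons g u ih =>
    have hsplit : word k (g :: u) ⊗ₜ[k] word k v =
        (TensorAlgebra.ι k g ⊗ₜ[k] 1 + 1 ⊗ₜ[k] TensorAlgebra.ι k g) * (word k u ⊗ₜ[k] word k v) -
          word k u ⊗ₜ[k] word k (g :: v) := by
      simp [add_mul]
    refine LinearMap.ext fun q => ?_
    rw [hsplit, map_sub, map_sub, LinearMap.sub_apply, LinearMap.sub_apply, hA, hB, ih, ih]

theorem IsThetaMap.isDiagInvariant_gluing {F : TensorAlgebra k H ⊗[k] TensorAlgebra k H →ₗ[k] W}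
    (hF : IsThetaMap F) : IsDiagInvariant (gluing F) := by
  intro h p q
  let D : TensorAlgebra k H ⊗[k] TensorAlgebra k H :=
    TensorAlgebra.ι k h ⊗ₜ 1 + 1 ⊗ₜ TensorAlgebra.ι k h
  have hmul_comm : ∀ x : TensorAlgebra k H ⊗[k] TensorAlgebra k H,
      F ((rho k H).lTensor _ (D * x)) = F ((rho k H).lTensor _ (x * D)) := by
    suffices hcomp : F ∘ₗ (rho k H).lTensor _ ∘ₗ LinearMap.mulLeft k D =
        F ∘ₗ (rho k H).lTensor _ ∘ₗ LinearMap.mulRight k D from LinearMap.congr_fun hcomp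
    refine tensorProduct_ext_word fun v w => ?_
    have hrel := hF.commRelator h (word k v) (rho k H (word k w))
    simp only [HairyGraph.commRelator, add_mul, mul_add, Algebra.TensorProduct.tmul_mul_tmul,
      one_mul, mul_one, map_add, map_neg, neg_add_eq_zero] at hrel
    simp only [D, LinearMap.comp_apply, LinearMap.mulLeft_apply, LinearMap.mulRight_apply,
      add_mul, mul_add, Algebra.TensorProduct.tmul_mul_tmul, one_mul, mul_one, map_add,
      LinearMap.lTensor_tmul, rho_mul, rho_ι, mul_neg, neg_mul, TensorProduct.tmul_neg, map_neg]
    rw [← sub_eq_add_neg, ← sub_eq_add_neg, sub_eq_sub_iff_add_eq_add, hrel]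
  have hrho : TensorProduct.map (rho k H) (rho k H) D = (-1 : k) • D := by
    simp only [D, map_add, TensorProduct.map_tmul, rho_ι, rho_one, smul_add,
      ← neg_one_smul k (TensorAlgebra.ι k h), TensorProduct.tmul_smul, TensorProduct.smul_tmul']
  change F ((rho k H).lTensor _ (D * p * TensorProduct.map _ _ q)) =
    -F ((rho k H).lTensor _ (p * TensorProduct.map _ _ (D * q)))
  rw [mul_assoc, hmul_comm, mul_assoc, map_rho_mul, hrho, mul_smul_comm, mul_smul_comm,
    map_smul, map_smul, neg_one_smul, neg_neg]

variable {F : TensorAlgebra k H ⊗[k] TensorAlgebra k H →ₗ[k] W} (hF : IsThetaMap F)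

include hF

theorem IsThetaMap.smul (c : k) : IsThetaMap (c • F) where
  one_left w := by rw [LinearMap.smul_apply, hF.one_left, smul_zero]
  one_right v := by rw [LinearMap.smul_apply, hF.one_right, smul_zero]
  map_rho x := congrArg (c • ·) (hF.map_rho x)
  comm x := congrArg (c • ·) (hF.comm x)
  commRelator h v w := by rw [LinearMap.smul_apply, hF.commRelator, smul_zero]
  triRelator v w := by rw [LinearMap.smul_apply, hF.triRelator, smul_zero]

theorem IsThetaMap.gluing_symm (α β γ δ : TensorAlgebra k H) :
    gluing F (γ ⊗ₜ δ) (α ⊗ₜ β) = gluing F (α ⊗ₜ β) (γ ⊗ₜ δ) := by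
  rw [gluing_tmul, gluing_tmul, ← hF.map_rho, TensorProduct.map_tmul, rho_mul, rho_mul, rho_rho,
    rho_rho]

theorem IsThetaMap.gluing_comm (α β γ δ : TensorAlgebra k H) :
    gluing F (β ⊗ₜ α) (δ ⊗ₜ γ) = gluing F (α ⊗ₜ β) (γ ⊗ₜ δ) := by
  rw [gluing_tmul, ← hF.comm, TensorProduct.comm_tmul, ← gluing_tmul, hF.gluing_symm]

end Gluing

section Symmetrize

variable {H : Type v}

theorem place_comp_renumber {n : ℕ} (π : Equiv.Perm (Fin n)) (f : Fin n) (b c : Bool) :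
    (place f b c ∘ Leaf.renumber π : Leaf H n → Leaf H 2) = place (π.symm f) b c := by
  funext x
  cases x with
  | hair h => rfl
  | edge i β => simp [place, Leaf.renumber, Equiv.eq_symm_apply]

theorem place_comp_reverse_self {n : ℕ} (f : Fin n) (b c : Bool) :
    (place f b c ∘ Leaf.reverse f : Leaf H n → Leaf H 2) = place f (!b) c := by
  funext x
  cases x with
  | hair h => rfl
  | edge i β => by_cases hi : i = f <;> simp [place, Leaf.reverse, hi]

theorem place_comp_reverse_of_ne {e f : Fin 2} (hef : e ≠ f) (b c : Bool) :
    (place f b c ∘ Leaf.reverse e : Leaf H 2 → Leaf H 2) = place f b (!c) := by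
  funext x
  cases x with
  | hair h => rfl
  | edge i β =>
    by_cases hi : i = f
    · simp [place, Leaf.reverse, hi, hef.symm]
    · obtain rfl : i = e := by omega
      simp [place, Leaf.reverse, hi]

variable {R : Type u} [CommRing R] [AddCommGroup H] [Module R H]
  {W : Type w} [AddCommGroup W] [Module R W] (φ : HairForm R H 2 W)

/-- The sum, with signs, of the pullbacks of a hair form along the eight renumberings and reversals
of the two external edges. -/
def HairForm.symmetrize : SymForm R H W where
  toFun A B := ∑ f, ∑ b, ∑ c, (sgn b * sgn c) •
    φ.toFun (FreeMagma.map (place f b c) A) (FreeMagma.map (place f b c) B)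
  symm A B := by simp only [φ.symm]
  move A B C := by simp only [map_mul, φ.move]
  antisymm A B C := by
    simp only [← Finset.sum_add_distrib, map_mul, ← smul_add, φ.antisymm, smul_zero,
      Finset.sum_const_zero]
  ihx A B C D := by
    simp only [← Finset.sum_add_distrib, map_mul, ← smul_add, φ.ihx, smul_zero,
      Finset.sum_const_zero]
  hair_add h h' B := by
    simp only [← Finset.sum_add_distrib, FreeMagma.map_of, ← smul_add, place_hair, φ.hair_add]
  hair_smul c h B := by
    simp only [Finset.smul_sum, FreeMagma.map_of, place_hair, φ.hair_smul, smul_comm c]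
  renumber π A B := by
    simp only [freeMagma_map_map, place_comp_renumber]
    exact π.symm.sum_comp fun f => ∑ b, ∑ c, (sgn b * sgn c) •
      φ.toFun (FreeMagma.map (place f b c) A) (FreeMagma.map (place f b c) B)
  reverse e A B := by
    rw [← Finset.sum_neg_distrib]
    refine Finset.sum_congr rfl fun f _ => ?_
    by_cases hef : e = f
    · simp only [hef, freeMagma_map_map, place_comp_reverse_self, Fintype.sum_bool]
      simp only [sgn, Bool.not_true, Bool.not_false, Bool.false_eq_true, ↓reduceIte, Int.reduceNeg,
        mul_neg, mul_one, neg_neg, one_smul, neg_smul, neg_add_rev]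
      abel
    · simp only [freeMagma_map_map, place_comp_reverse_of_ne hef, Fintype.sum_bool]
      simp only [sgn, Bool.not_true, Bool.not_false, Bool.false_eq_true, ↓reduceIte, Int.reduceNeg,
        mul_neg, mul_one, neg_neg, one_smul, neg_smul, neg_add_rev]
      abel

end Symmetrize

section ThetaForm

attribute [local instance] LieRing.ofAssociativeRing

variable {k : Type u} [Field k] [Invertible (2 : k)] {H : Type v} [AddCommGroup H] [Module k H]
  {W : Type w} [AddCommGroup W] [Module k W]

theorem HairForm.thetaPairing_symmetrize (φ : HairForm k H 2 W) :
    φ.symmetrize.thetaPairing = ∑ b, ∑ c, (sgn b * sgn c) •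
      (φ.pairing (0, b) (1, c) (0, !b) (1, !c) + φ.pairing (1, c) (0, b) (1, !c) (0, !b)) := by
  refine tensorProduct_ext_word fun α β => tensorProduct_ext_word fun γ δ => ?_
  rw [← HairForm.toFun_comb]
  change ∑ f : Fin 2, ∑ b : Bool, ∑ c : Bool, (sgn b * sgn c) • φ.toFun (FreeMagma.map _ _)
    (FreeMagma.map _ _) = _
  simp only [map_mul, map_comb (place_hair _ _ _), Fin.sum_univ_two, ← Finset.sum_add_distrib,
    LinearMap.sum_apply, LinearMap.smul_apply, LinearMap.add_apply, ← HairForm.toFun_comb, smul_add]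
  simp [place]

variable {F : TensorAlgebra k H ⊗[k] TensorAlgebra k H →ₗ[k] W} (hF : IsThetaMap F)

include hF

theorem IsThetaMap.thetaPairing_wordForm : (wordForm F).thetaPairing = gluing F := by
  refine IsDiagInvariant.ext (fun h p q => (wordForm F).pairing_ι_mul _ _ _ _ h p q)
    hF.isDiagInvariant_gluing fun v s t => ?_
  refine (pairing_rootHairForm (letterOp_hair k H) _ (x := (0, false)) (by simp) (by simp)
    (by simp) v s t).trans ?_
  simp only [letterOp, Bool.false_eq_true, ↓reduceIte, one_ne_zero, tensorAct_thirdLetter,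
    tensorAct_firstLetter, tensorAct_secondLetter, LinearMap.coe_comp, LinearMap.coe_snd,
    Function.comp_apply, LinearMap.applyₗ_apply_apply, LieHom.lie_apply, Module.End.lie_apply,
    lie_sub, Prod.snd_sub, map_sub, gluing_tmul, one_mul]
  simp [firstLetter, secondLetter, thirdLetter, readOff_tmul]

omit hF

theorem pairing_crossed_wordForm :
    (wordForm F).pairing (0, false) (1, true) (0, true) (1, false) = 0 := by
  refine IsDiagInvariant.ext (fun h p q => (wordForm F).pairing_ι_mul _ _ _ _ h p q)
    (fun h p q => by simp) fun v s t => ?_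
  refine (pairing_rootHairForm (letterOp_hair k H) _ (x := (0, false)) (by simp) (by simp)
    (by simp) v s t).trans ?_
  simp only [letterOp, ↓reduceIte, one_ne_zero, tensorAct_secondLetter, tensorAct_firstLetter,
    Bool.false_eq_true, tensorAct_thirdLetter, LinearMap.coe_comp, LinearMap.coe_snd,
    Function.comp_apply, LinearMap.applyₗ_apply_apply, LieHom.lie_apply, Module.End.lie_apply,
    lie_sub, Prod.snd_sub, map_sub, LinearMap.zero_apply]
  simp [firstLetter, secondLetter, thirdLetter]

/-- The symmetric form whose theta values are given by `F`. Four of its eight summands contribute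
to a theta graph, and they contribute equally. -/
noncomputable def thetaForm (F : TensorAlgebra k H ⊗[k] TensorAlgebra k H →ₗ[k] W) :
    SymForm k H W :=
  (wordForm ((⅟2 * ⅟2 : k) • F)).symmetrize

theorem IsThetaMap.thetaPairing_thetaForm (hF : IsThetaMap F) :
    (thetaForm F).thetaPairing = gluing F := by
  set G := (⅟2 * ⅟2 : k) • F with hG
  have hGF : IsThetaMap G := hF.smul _
  have hcrossed : ∀ p q, (wordForm G).pairing (0, false) (1, true) (0, true) (1, false) p q = 0 :=
    LinearMap.congr_fun₂ pairing_crossed_wordForm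
  have hcrossed' : ∀ p q, (wordForm G).pairing (0, true) (1, false) (0, false) (1, true) p q = 0 :=
    fun p q => by rw [HairForm.pairing_symm, hcrossed]
  have hstraight : ∀ p q, (wordForm G).pairing (0, false) (1, false) (0, true) (1, true) p q =
      gluing G p q := LinearMap.congr_fun₂ hGF.thetaPairing_wordForm
  have hstraight' : ∀ p q, (wordForm G).pairing (0, true) (1, true) (0, false) (1, false) p q =
      gluing G q p := fun p q => by rw [HairForm.pairing_symm, hstraight]
  refine TensorProduct.ext' fun α β => TensorProduct.ext' fun γ δ => ?_
  rw [thetaForm, ← hG, HairForm.thetaPairing_symmetrize]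
  simp only [Fintype.sum_bool, LinearMap.add_apply, LinearMap.smul_apply, Bool.not_true,
    Bool.not_false, HairForm.pairing_comm (wordForm G) (0, _) (1, _), hcrossed, hcrossed',
    hstraight, hstraight', hGF.gluing_comm]
  simp only [sgn, Bool.false_eq_true, ↓reduceIte, mul_one, neg_mul, one_mul, neg_neg, one_smul,
    add_zero, smul_zero, zero_add]
  rw [hGF.gluing_symm α β γ δ]
  simp only [hG, gluing_tmul, LinearMap.smul_apply, ← add_smul]
  convert one_smul k _ using 2
  linear_combination (2 * ⅟(2 : k) + 1) * mul_invOf_self (2 : k)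

end ThetaForm

section Hairy

variable {H : Type v} {n : ℕ}

theorem exists_hairs (m : Multiset (Leaf H n)) : ∃ hs : Multiset H,
    m = hs.map Leaf.hair + (m.filterMap Leaf.end?).map fun p => Leaf.edge p.1 p.2 := by
  induction m using Multiset.induction_on with
  | empty => exact ⟨0, rfl⟩
  | cons x m ih =>
    obtain ⟨hs, hm⟩ := ih
    cases x with
    | hair h =>
      refine ⟨h ::ₘ hs, ?_⟩
      rw [Multiset.filterMap_cons_none _ _ (by rfl), Multiset.map_cons, Multiset.cons_add, ← hm]
    | edge f c =>
      refine ⟨hs, ?_⟩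
      rw [Multiset.filterMap_cons_some _ _ _ (by rfl), Multiset.map_cons, Multiset.add_cons, ← hm]

theorem isHairy_iff {s : ℕ} {m : Multiset (Leaf H n)} : IsHairy s m ↔
    m.filterMap Leaf.end? = (Finset.univ : Finset (Fin n × Bool)).val ∧ m.card = s + n * 2 := by
  have hcard : (Finset.univ : Finset (Fin n × Bool)).val.card = n * 2 := by simp
  constructor
  · rintro ⟨hs, rfl, rfl⟩
    have hhair : Leaf.end? ∘ (Leaf.hair : H → Leaf H n) = fun _ => none := rfl
    have hedge : (Leaf.end? ∘ fun p : Fin n × Bool => (Leaf.edge p.1 p.2 : Leaf H n)) = some := rfl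
    simp only [Multiset.filterMap_add, Multiset.filterMap_map, hhair, hedge,
      Multiset.filterMap_some, Multiset.card_add, Multiset.card_map, hcard, and_true,
      add_eq_right]
    exact Multiset.eq_zero_of_forall_notMem fun x => by simp [Multiset.mem_filterMap]
  · rintro ⟨hends, hm⟩
    obtain ⟨hs, heq⟩ := exists_hairs m
    rw [hends] at heq
    refine ⟨hs, ?_, heq⟩
    rw [heq, Multiset.card_add, Multiset.card_map, Multiset.card_map, hcard] at hm
    lia

theorem isHairy_relabel {s : ℕ} (σ : Equiv.Perm (Fin n × Bool)) {f : Leaf H n → Leaf H n}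
    (hf : ∀ x, (f x).end? = x.end?.map σ) (t : Tree (Leaf H n)) :
    IsHairy s (t.relabel f).leaves ↔ IsHairy s t.leaves := by
  have hends : (t.relabel f).leaves.filterMap Leaf.end? =
      (t.leaves.filterMap Leaf.end?).map σ := by
    rw [leaves_relabel, Multiset.filterMap_map, Multiset.map_filterMap]
    exact congrArg (Multiset.filterMap · _) (funext hf)
  have huniv : (Finset.univ : Finset (Fin n × Bool)).val.map σ = Finset.univ.val :=
    congrArg Finset.val (Finset.map_univ_equiv σ)
  rw [isHairy_iff, isHairy_iff, hends, leaves_relabel, Multiset.card_map, ← huniv,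
    (Multiset.map_injective σ.injective).eq_iff, huniv]

theorem isHairy_renumber {s : ℕ} (π : Equiv.Perm (Fin n)) (t : Tree (Leaf H n)) :
    IsHairy s (t.relabel (Leaf.renumber π)).leaves ↔ IsHairy s t.leaves :=
  isHairy_relabel (π.prodCongr (Equiv.refl Bool)) (fun x => by cases x <;> rfl) t

theorem isHairy_reverse {s : ℕ} (e : Fin n) (t : Tree (Leaf H n)) :
    IsHairy s (t.relabel (Leaf.reverse e)).leaves ↔ IsHairy s t.leaves := by
  have hinv : Function.Involutive
      fun p : Fin n × Bool => (p.1, if p.1 = e then !p.2 else p.2) := by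
    rintro ⟨f, b⟩
    by_cases h : f = e <;> simp [h]
  exact isHairy_relabel (hinv.toPerm _) (fun x => by cases x <;> rfl) t

theorem isHairy_hair_iff {s : ℕ} (h h' : H) (B : FreeMagma (Leaf H n)) :
    IsHairy s (Tree.leaves (.of (.hair h), B)) ↔ IsHairy s (Tree.leaves (.of (.hair h'), B)) := by
  have hends : ∀ y : H, (Tree.leaves (.of (.hair y), B)).filterMap Leaf.end? = rootedEnds B :=
    fun y => (Tree.ends_eq _).trans (by simp)
  rw [isHairy_iff, isHairy_iff, hends, hends]
  simp only [Tree.leaves, Multiset.card_add, rootedLeaves, Multiset.card_singleton]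

theorem leaves_add_of_join_eq_some {e : Fin (n + 1)} {b : Bool} {t₁ t₂ : Tree (Leaf H (n + 1))}
    {t : Tree (Leaf H n)} (hnodup : (t₁.ends + t₂.ends).Nodup) (ht : join e b t₁ t₂ = some t) :
    t₁.leaves + t₂.leaves = .edge e b ::ₘ .edge e (!b) ::ₘ t.leaves.map (Leaf.succAbove e) := by
  classical
  obtain ⟨hnodup₁, hnodup₂, hdisj⟩ := Multiset.nodup_add.1 hnodup
  have hb₁ : (e, b) ∈ t₁.ends := by
    by_contra hb
    simp [join_eq_none_left hb] at ht
  have hb₂ : (e, !b) ∈ t₂.ends := by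
    by_contra hb
    simp [join_eq_none_right hb] at ht
  obtain ⟨A, hA, hA'⟩ := exists_cut_of_count_ends (Multiset.count_eq_one_of_mem hnodup₁ hb₁)
    (fun h => Multiset.disjoint_left.1 hdisj h hb₂)
  obtain ⟨B, hB, hB'⟩ := exists_cut_of_count_ends (Multiset.count_eq_one_of_mem hnodup₂ hb₂)
    (fun h => Multiset.disjoint_left.1 hdisj hb₁ (by rwa [Bool.not_not] at h))
  rw [join, hA, hB, Option.bind_some, Option.bind_some, dropEdge_map_succAbove,
    dropEdge_map_succAbove] at ht
  obtain rfl : (A, B) = t := Option.some_injective _ ht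
  rw [hA', hB', Tree.leaves, Multiset.map_add, Multiset.cons_add, Multiset.add_cons]

theorem univ_val_eq_cons (e : Fin (n + 1)) (b : Bool) :
    (Finset.univ : Finset (Fin (n + 1) × Bool)).val = (e, b) ::ₘ (e, !b) ::ₘ
      (Finset.univ : Finset (Fin n × Bool)).val.map (Prod.map e.succAbove id) := by
  have hinj : Function.Injective (Prod.map e.succAbove (id : Bool → Bool)) :=
    Fin.succAbove_right_injective.prodMap Function.injective_id
  refine (Multiset.Nodup.ext Finset.univ.nodup ?_).2 ?_
  · simp [Multiset.Nodup.map hinj Finset.univ.nodup, Fin.succAbove_ne]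
  · rintro ⟨f, c⟩
    rcases eq_or_ne f e with rfl | hf
    · cases b <;> cases c <;> simp
    · obtain ⟨g, rfl⟩ := Fin.exists_succAbove_eq hf
      simp

theorem ends_add_of_isHairy {s : ℕ} {t₁ t₂ : Tree (Leaf H n)}
    (h : IsHairy s (t₁.leaves + t₂.leaves)) :
    t₁.ends + t₂.ends = (Finset.univ : Finset (Fin n × Bool)).val := by
  rw [← (isHairy_iff.1 h).1, Multiset.filterMap_add]
  rfl

theorem isHairy_of_join_eq_some {s : ℕ} {e : Fin (n + 1)} {b : Bool}
    {t₁ t₂ : Tree (Leaf H (n + 1))} {t : Tree (Leaf H n)}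
    (h : IsHairy s (t₁.leaves + t₂.leaves)) (ht : join e b t₁ t₂ = some t) :
    IsHairy s t.leaves := by
  have hleaves := leaves_add_of_join_eq_some (by
    rw [ends_add_of_isHairy h]
    exact Finset.univ.nodup) ht
  have hend : Leaf.end? ∘ Leaf.succAbove (H := H) e =
      fun x => x.end?.map (Prod.map e.succAbove id) := by
    funext x
    cases x <;> rfl
  rw [isHairy_iff, hleaves, Multiset.filterMap_cons_some _ _ _ (by rfl),
    Multiset.filterMap_cons_some _ _ _ (by rfl), Multiset.filterMap_map, hend,
    ← Multiset.map_filterMap, univ_val_eq_cons e b, Multiset.cons_inj_right,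
    Multiset.cons_inj_right, Multiset.card_cons, Multiset.card_cons, Multiset.card_map] at h
  exact isHairy_iff.2 ⟨Multiset.map_injective
    (Fin.succAbove_right_injective.prodMap Function.injective_id) h.1, by lia⟩

end Hairy

namespace TreeForm

instance {X : Type v} {W : Type w} [AddCommGroup W] : Add (TreeForm X W) where
  add φ ψ :=
    { toFun := fun A B => φ.toFun A B + ψ.toFun A B
      symm := fun A B => congrArg₂ (· + ·) (φ.symm A B) (ψ.symm A B)
      move := fun A B C => congrArg₂ (· + ·) (φ.move A B C) (ψ.move A B C)
      antisymm := fun A B C => by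
        rw [add_add_add_comm, φ.antisymm, ψ.antisymm, add_zero]
      ihx := fun A B C D => by
        rw [add_add_add_comm (φ.toFun (A * B * C) D), add_add_add_comm, φ.ihx, ψ.ihx, add_zero] }

end TreeForm

namespace SymForm

variable {R : Type u} [CommRing R] [Invertible (2 : R)] {H : Type v} [AddCommGroup H] [Module R H]
  {W : Type w} [AddCommGroup W] [Module R W] (φ : SymForm R H W)
  {e f g : Fin 3} (hef : e ≠ f) (heg : e ≠ g) (hfg : f ≠ g)

include hef heg hfg

theorem boundary_three_eq_zero (a b c : Bool)
    (h : ∀ v w : List H, φ.boundary (tripod (.edge e a) (.edge f b) (.edge g c))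
      (.of (.edge e !a), comb v (.edge f !b) * comb w (.edge g !c)) = 0)
    {t : Tree (Leaf H 3)} (ht : t.ends = {(e, !a), (f, !b), (g, !c)}) :
    φ.boundary (tripod (.edge e a) (.edge f b) (.edge g c)) t = 0 := by
  let x := (sgn a * (sgn b * sgn c)) • φ.form R ⁅φ.edgeEnd 0 false, φ.edgeEnd 1 false⁆
  let B : TreeForm (Leaf H 3) W := rootForm R (φ.leaf R ∘ place f b c) (.edge e !a) x +
    rootForm R (φ.leaf R ∘ place g c a) (.edge f !b) x +
    rootForm R (φ.leaf R ∘ place e a b) (.edge g !c) x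
  have hB {t : Tree (Leaf H 3)} (ht : t.ends = {(e, !a), (f, !b), (g, !c)}) :
      φ.boundary (tripod (.edge e a) (.edge f b) (.edge g c)) t = B.toFun t.1 t.2 := by
    rw [φ.boundary_three hef heg hfg a b c ht, smul_add, smul_add]
    rfl
  rw [hB ht, ← Submodule.mem_bot R]
  refine B.mem_of_rootedEnds_eq_three ⊥ (a := (e, !a)) (fun v w => ?_) (t.ends_eq.symm.trans ht)
  rw [Submodule.mem_bot, ← h v w, hB]
  simp only [Tree.ends_eq, rootedEnds_mul, rootedEnds_comb, rootedEnds_edge,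
    Multiset.insert_eq_cons, ← Multiset.singleton_add]

theorem boundary_two_eq_zero (a b : Bool) (x : H)
    (h : ∀ (β : Bool) (u v w : List H), φ.boundary (tripod (.edge e a) (.edge f b) (.hair x))
      (.of (.edge e !a) * comb v (.edge g β), comb u (.edge f !b) * comb w (.edge g !β)) = 0)
    {t : Tree (Leaf H 3)} (ht : t.ends = {(e, !a), (f, !b), (g, false), (g, true)}) :
    φ.boundary (tripod (.edge e a) (.edge f b) (.hair x)) t = 0 := by
  let B : TreeForm (Leaf H 3) W :=
    rootForm R (φ.leaf R ∘ place f b false) (.edge e !a)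
      ((sgn a * sgn b) • φ.form R ⁅φ.edgeEnd 0 false, φ.hair x⁆) +
    rootForm R (φ.leaf R ∘ place e a false) (.edge f !b)
      ((sgn a * sgn b) • φ.form R ⁅φ.hair x, φ.edgeEnd 0 false⁆)
  have hB {t : Tree (Leaf H 3)} (ht : t.ends = {(e, !a), (f, !b), (g, false), (g, true)}) :
      φ.boundary (tripod (.edge e a) (.edge f b) (.hair x)) t = B.toFun t.1 t.2 := by
    rw [φ.boundary_two hef heg hfg a b x ht, smul_add]
    rfl
  have hcomb (β : Bool) (u v w : List H) : B.toFun (.of (.edge e !a) * comb v (.edge g β))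
      (comb u (.edge f !b) * comb w (.edge g !β)) ∈ (⊥ : Submodule R W) := by
    rw [Submodule.mem_bot, ← h β u v w, hB]
    cases β <;>
      simp only [Tree.ends_eq, rootedEnds_mul, rootedEnds_comb, rootedEnds_edge, Bool.not_true,
        Bool.not_false, Multiset.insert_eq_cons, ← Multiset.singleton_add] <;> abel
  rw [hB ht, ← Submodule.mem_bot R]
  exact B.mem_of_rootedEnds_eq_four ⊥ (a := (e, !a)) (b := (f, !b)) (c := (g, false))
    (d := (g, true)) (hcomb false) (fun u v w => hcomb true u w v) (t.ends_eq.symm.trans ht)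

theorem boundary_loop_eq_zero (a b : Bool)
    (h : ∀ v w : List H, φ.boundary (tripod (.edge e a) (.edge f b) (.edge f !b))
      (.of (.edge e !a), comb v (.edge g false) * comb w (.edge g true)) = 0)
    {t : Tree (Leaf H 3)} (ht : t.ends = {(e, !a), (g, false), (g, true)}) :
    φ.boundary (tripod (.edge e a) (.edge f b) (.edge f !b)) t = 0 := by
  let B : TreeForm (Leaf H 3) W := rootForm R (φ.leaf R ∘ place f b false) (.edge e !a)
    ((sgn a * sgn b) • φ.form R ⁅φ.edgeEnd 0 false, φ.edgeEnd 0 true⁆)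
  have hB {t : Tree (Leaf H 3)} (ht : t.ends = {(e, !a), (g, false), (g, true)}) :
      φ.boundary (tripod (.edge e a) (.edge f b) (.edge f !b)) t = B.toFun t.1 t.2 := by
    rw [φ.boundary_loop hef heg hfg a b ht]
    rfl
  rw [hB ht, ← Submodule.mem_bot R]
  refine B.mem_of_rootedEnds_eq_three ⊥ (a := (e, !a)) (fun v w => ?_) (t.ends_eq.symm.trans ht)
  rw [Submodule.mem_bot, ← h v w, hB]
  simp only [Tree.ends_eq, rootedEnds_mul, rootedEnds_comb, rootedEnds_edge,
    Multiset.insert_eq_cons, ← Multiset.singleton_add]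

end SymForm

theorem exists_third {e f : Fin 3} (hef : e ≠ f) : ∃ g, e ≠ g ∧ f ≠ g := by
  revert e f
  decide

section Vanishing

variable {k : Type u} [Field k] [Invertible (2 : k)] {H : Type v} [AddCommGroup H] [Module k H]
  {W : Type w} [AddCommGroup W] [Module k W]
  {F : TensorAlgebra k H ⊗[k] TensorAlgebra k H →ₗ[k] W} (hF : IsThetaMap F)
  {φ : SymForm k H W} (hφ : φ.thetaPairing = gluing F)

/-- A form is closed if it vanishes on the boundaries of the generators of `S₂`. -/
def SymForm.Closed (φ : SymForm k H W) : Prop :=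
  ∀ (s : ℕ) (t₁ t₂ : Tree (Leaf H 3)), IsHairy s (t₁.leaves + t₂.leaves) → IsS₂Tripod t₁ →
    φ.boundary t₁ t₂ = 0

include hF hφ

theorem IsThetaMap.boundary_three_comb_eq_zero {e f g : Fin 3} (hef : e ≠ f) (heg : e ≠ g)
    (hfg : f ≠ g) (a b c : Bool) (v w : List H) :
    φ.boundary (tripod (.edge e a) (.edge f b) (.edge g c))
      (.of (.edge e !a), comb v (.edge f !b) * comb w (.edge g !c)) = 0 := by
  rw [φ.boundary_three_comb hef heg hfg, φ.boundary_three_value (G := F) _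
    (fun x => (hF.map_rho _).trans (hF.comm x)), hF.triRelator, smul_zero]
  intro v w
  rw [hφ, gluing_tmul, one_mul, rho_one, mul_one]

theorem IsThetaMap.boundary_two_comb_eq_zero {e f g : Fin 3} (hef : e ≠ f) (heg : e ≠ g)
    (hfg : f ≠ g) (a b : Bool) (h : H) (β : Bool) (u v w : List H) :
    φ.boundary (tripod (.edge e a) (.edge f b) (.hair h))
      (.of (.edge e !a) * comb v (.edge g β), comb u (.edge f !b) * comb w (.edge g !β)) = 0 := by
  rw [φ.boundary_two_comb hef heg hfg, hφ, gluing_tmul, gluing_tmul,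
    ← hF.map_rho ((word k u * _ * _) ⊗ₜ _), TensorProduct.map_tmul]
  simp only [rho_mul, rho_rho, rho_ι, rho_one, one_mul, neg_mul, TensorProduct.neg_tmul, map_neg,
    add_neg_cancel, smul_zero]

theorem IsThetaMap.boundary_loop_comb_eq_zero {e f g : Fin 3} (hef : e ≠ f) (heg : e ≠ g)
    (hfg : f ≠ g) (a b : Bool) (v w : List H) :
    φ.boundary (tripod (.edge e a) (.edge f b) (.edge f !b))
      (.of (.edge e !a), comb v (.edge g false) * comb w (.edge g true)) = 0 := by
  rw [φ.boundary_loop_comb hef heg hfg, hφ, gluing_tmul, gluing_tmul, rho_one, one_mul,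
    hF.one_left, hF.one_left, add_zero, smul_zero]

theorem IsThetaMap.closed_of_thetaPairing_eq : φ.Closed := by
  intro s t₁ t₂ ht h₁
  have hends : t₂.ends = Finset.univ.val - t₁.ends := by
    rw [← ends_add_of_isHairy ht, add_tsub_cancel_left]
  cases h₁ with
  | three e f g a b c hef heg hfg =>
    refine φ.boundary_three_eq_zero hef heg hfg a b c
      (hF.boundary_three_comb_eq_zero hφ hef heg hfg a b c) (hends.trans ?_)
    change Finset.univ.val - {(e, a), (f, b), (g, c)} = _
    clear * - hef heg hfg
    revert e f g a b c
    decide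
  | two e f a b h hef =>
    obtain ⟨g, heg, hfg⟩ := exists_third hef
    refine φ.boundary_two_eq_zero hef heg hfg a b h
      (hF.boundary_two_comb_eq_zero hφ hef heg hfg a b h) (hends.trans ?_)
    change Finset.univ.val - {(e, a), (f, b)} = _
    clear * - hef heg hfg
    revert e f g a b
    decide
  | loop e f a b hef =>
    obtain ⟨g, heg, hfg⟩ := exists_third hef
    refine φ.boundary_loop_eq_zero hef heg hfg a b
      (hF.boundary_loop_comb_eq_zero hφ hef heg hfg a b) (hends.trans ?_)
    change Finset.univ.val - {(e, a), (f, b), (f, !b)} = _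
    clear * - hef heg hfg
    revert e f g a b
    decide

end Vanishing

section Evaluation

variable {k : Type u} [Field k] {H : Type v} [AddCommGroup H] [Module k H]
  {W : Type w} [AddCommGroup W] [Module k W]

namespace SymForm

variable (s : ℕ) (φ : SymForm k H W)

open Classical in
/-- The form that agrees with `φ` on hairy graphs with `s` hairs and vanishes on all other trees. -/
noncomputable def hairyPart : SymForm k H W where
  toFun A B := if IsHairy s (Tree.leaves (A, B)) then φ.toFun A B else 0
  symm A B := by
    rw [φ.symm A B, Tree.leaves, Tree.leaves, add_comm (rootedLeaves A)]
  move A B C := by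
    rw [φ.move A B C, show Tree.leaves (A * B, C) = Tree.leaves (A, B * C) from add_assoc _ _ _]
  antisymm A B C := by
    rw [show Tree.leaves (B * A, C) = Tree.leaves (A * B, C) from
      congrArg (· + rootedLeaves C) (add_comm _ _)]
    split_ifs
    exacts [φ.antisymm A B C, add_zero 0]
  ihx A B C D := by
    rw [show Tree.leaves (B * C * A, D) = Tree.leaves (A * B * C, D) by
        simp only [Tree.leaves, rootedLeaves]; abel,
      show Tree.leaves (C * A * B, D) = Tree.leaves (A * B * C, D) by
        simp only [Tree.leaves, rootedLeaves]; abel]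
    split_ifs
    exacts [φ.ihx A B C D, by rw [add_zero, add_zero]]
  hair_add h h' B := by
    rw [isHairy_hair_iff (h + h') h, isHairy_hair_iff h' h]
    split_ifs
    exacts [φ.hair_add h h' B, (add_zero 0).symm]
  hair_smul c h B := by
    rw [isHairy_hair_iff (c • h) h]
    split_ifs
    exacts [φ.hair_smul c h B, (smul_zero c).symm]
  renumber π A B := if_congr (isHairy_renumber π (A, B)) (φ.renumber π A B) rfl
  reverse e A B :=
    (if_congr (isHairy_reverse e (A, B)) (φ.reverse e A B) rfl).trans (by
      split_ifs
      exacts [rfl, neg_zero.symm])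

theorem hairyPart_toFun_of_isHairy {t : Tree (Leaf H 2)} (ht : IsHairy s t.leaves) :
    (φ.hairyPart s).toFun t.1 t.2 = φ.toFun t.1 t.2 :=
  if_pos ht

/-- The evaluation of a form on combinations of hairy graphs. -/
noncomputable def evalGraph : (Graph H 2 s →₀ k) →ₗ[k] W :=
  Finsupp.linearCombination k fun t : Graph H 2 s => φ.toFun t.1.1 t.1.2

theorem evalGraph_gen (t : Tree (Leaf H 2)) :
    φ.evalGraph s (gen k 2 s t) = (φ.hairyPart s).toFun t.1 t.2 := by
  by_cases ht : IsHairy s t.leaves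
  · rw [hairyPart_toFun_of_isHairy s φ ht, evalGraph, gen, dif_pos ht]
    exact (Finsupp.linearCombination_single k (1 : k) _).trans (one_smul k _)
  · rw [gen, dif_neg ht, map_zero]
    exact (if_neg ht).symm

theorem evalGraph_eq_zero {x : Graph H 2 s →₀ k} (hx : ChainRel k 2 s x) :
    φ.evalGraph s x = 0 := by
  let ψ := φ.hairyPart s
  cases hx with
  | mark_symm A B => simpa only [map_sub, evalGraph_gen, sub_eq_zero] using ψ.symm A B
  | mark_move A B C => simpa only [map_sub, evalGraph_gen, sub_eq_zero] using ψ.move A B C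
  | renumber π t =>
    rw [map_sub, evalGraph_gen, evalGraph_gen, sub_eq_zero]
    exact ψ.renumber π t.1 t.2
  | reverse e t =>
    rw [map_add, evalGraph_gen, evalGraph_gen, add_eq_zero_iff_eq_neg]
    exact ψ.reverse e t.1 t.2
  | antisymm A B C => simpa only [map_add, evalGraph_gen] using ψ.antisymm A B C
  | ihx A B C D => simpa only [map_add, evalGraph_gen] using ψ.ihx A B C D
  | hair_add h h' B =>
    rw [map_sub, map_sub, evalGraph_gen, evalGraph_gen, evalGraph_gen, sub_sub, sub_eq_zero]
    exact ψ.hair_add h h' B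
  | hair_smul c h B =>
    simpa only [map_sub, map_smul, evalGraph_gen, sub_eq_zero] using ψ.hair_smul c h B

/-- The evaluation of a form on chains. -/
noncomputable def evalChain : Chains k H 2 s →ₗ[k] W :=
  Submodule.liftQ _ (φ.evalGraph s) (Submodule.span_le.2 fun _ hx => φ.evalGraph_eq_zero s hx)

variable {s}

theorem evalChain_chain {t : Tree (Leaf H 2)} (ht : IsHairy s t.leaves) :
    φ.evalChain s (chain k 2 s t) = φ.toFun t.1 t.2 :=
  (φ.evalGraph_gen s t).trans (hairyPart_toFun_of_isHairy s φ ht)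

end SymForm

theorem TreeForm.map_boundary {r s : ℕ} {ψ : TreeForm (Leaf H r) W} {f : Chains k H r s →ₗ[k] W}
    (hf : ∀ t : Tree (Leaf H r), IsHairy s t.leaves → f (chain k r s t) = ψ.toFun t.1 t.2)
    {t₁ t₂ : Tree (Leaf H (r + 1))} (ht : IsHairy s (t₁.leaves + t₂.leaves)) :
    f (HairyGraph.boundary k r s t₁ t₂) = ψ.boundary t₁ t₂ := by
  have hterm (e b) : f ((join e b t₁ t₂).elim 0 (chain k r s)) =
      (join e b t₁ t₂).elim 0 (fun t => ψ.toFun t.1 t.2) := by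
    cases hj : join e b t₁ t₂ with
    | none => exact map_zero f
    | some t => exact hf t (isHairy_of_join_eq_some ht hj)
  simp only [HairyGraph.boundary, TreeForm.boundary, map_sum, map_sub, hterm]

namespace SymForm

/-- The evaluation of a closed form on `Ω_{s,2}(H)`. -/
noncomputable def Closed.evalOmega {φ : SymForm k H W} (hφ : φ.Closed) (s : ℕ) :
    Omega k H s 2 →ₗ[k] W :=
  Submodule.liftQ (boundaryS₂ k H 2 s) (φ.evalChain s) (Submodule.span_le.2 (by
    rintro _ ⟨t₁, t₂, ht, h₁, rfl⟩
    exact (TreeForm.map_boundary (fun t ht => φ.evalChain_chain ht) ht).trans (hφ s t₁ t₂ ht h₁)))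

theorem Closed.evalOmega_toOmega {φ : SymForm k H W} (hφ : φ.Closed) {s : ℕ}
    {t : Tree (Leaf H 2)} (ht : IsHairy s t.leaves) :
    hφ.evalOmega s (toOmega k s 2 (chain k 2 s t)) = φ.toFun t.1 t.2 :=
  φ.evalChain_chain ht

end SymForm

end Evaluation

theorem exists_isHairy {H : Type v} {n : ℕ} {m : Multiset (Leaf H n)}
    (h : m.filterMap Leaf.end? = Finset.univ.val) : ∃ s, IsHairy s m := by
  obtain ⟨hs, hm⟩ := exists_hairs m
  rw [h] at hm
  exact ⟨hs.card, hs, rfl, hm⟩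

section ThetaValue

variable {k : Type u} [Field k] {H : Type v} [AddCommGroup H] [Module k H]
  {W : Type w} [AddCommGroup W] [Module k W]

namespace SymForm

variable {φ : SymForm k H W}

theorem Closed.boundary_eq_zero (hφ : φ.Closed) {t₁ t₂ : Tree (Leaf H 3)}
    (h : t₁.ends + t₂.ends = Finset.univ.val) (h₁ : IsS₂Tripod t₁) : φ.boundary t₁ t₂ = 0 := by
  obtain ⟨s, hs⟩ := exists_isHairy (m := t₁.leaves + t₂.leaves)
    (by rw [Multiset.filterMap_add]; exact h)
  exact hφ s t₁ t₂ hs h₁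

variable [Invertible (2 : k)]

variable (φ) in
/-- The values of a form on the theta graphs with hairs near the tail of the first edge and the
head of the second one. -/
noncomputable def thetaValue : TensorAlgebra k H ⊗[k] TensorAlgebra k H →ₗ[k] W :=
  TensorProduct.lift
    (φ.thetaPairing.compl₁₂ ((TensorProduct.mk k _ _).flip 1) (TensorProduct.mk k _ _ 1))

theorem thetaValue_tmul (v w : TensorAlgebra k H) :
    φ.thetaValue (v ⊗ₜ w) = φ.thetaPairing (v ⊗ₜ 1) (1 ⊗ₜ w) := rfl

theorem toFun_thetaTree (v w : List H) : φ.toFun (thetaTree v w).1 (thetaTree v w).2 =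
    φ.thetaValue (word k v ⊗ₜ word k w) :=
  φ.toFun_comb (0, false) (1, false) (0, true) (1, true) v [] [] w

namespace Closed

variable (hφ : φ.Closed)

include hφ

theorem thetaPairing_ι_tmul_word (h : H) (u v w : List H) :
    φ.thetaPairing (TensorAlgebra.ι k h ⊗ₜ word k v) (word k u ⊗ₜ word k w) =
      -φ.thetaPairing (1 ⊗ₜ word k v) ((word k u ⊗ₜ word k w) * (TensorAlgebra.ι k h ⊗ₜ 1)) := by
  have hzero := hφ.boundary_eq_zero (t₁ := tripod (.edge 0 false) (.edge 1 false) (.hair h))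
    (t₂ := (.of (.edge 0 true) * comb v (.edge 2 false),
      comb u (.edge 1 true) * comb w (.edge 2 true))) (by
    simp only [tripod, Tree.ends_eq, rootedEnds_mul, rootedEnds_comb, rootedEnds_edge,
      rootedEnds_hair]
    decide) (.two 0 1 false false h (by decide))
  have hcomb := φ.boundary_two_comb (e := 0) (f := 1) (g := 2) (by decide) (by decide) (by decide)
    false false false h u v w
  rw [show -(sgn false * sgn false * sgn false) = -1 from rfl, neg_one_smul] at hcomb
  rw [Algebra.TensorProduct.tmul_mul_tmul, mul_one, φ.thetaPairing_symm (1 ⊗ₜ word k v)]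
  exact eq_neg_of_add_eq_zero_left (neg_eq_zero.1 (hcomb.symm.trans hzero))

theorem thetaPairing_ι_tmul (h : H) (v : TensorAlgebra k H)
    (y : TensorAlgebra k H ⊗[k] TensorAlgebra k H) :
    φ.thetaPairing (TensorAlgebra.ι k h ⊗ₜ v) y =
      -φ.thetaPairing (1 ⊗ₜ v) (y * (TensorAlgebra.ι k h ⊗ₜ 1)) := by
  induction v using word_induction with
  | add v v' hv hv' =>
    simp only [TensorProduct.tmul_add, map_add, LinearMap.add_apply, hv, hv', neg_add]
  | smul c v hv =>
    simp only [TensorProduct.tmul_smul, map_smul, LinearMap.smul_apply, hv, smul_neg]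
  | word v =>
  let R := LinearMap.mulRight k (TensorAlgebra.ι k h ⊗ₜ[k] (1 : TensorAlgebra k H))
  have hext : φ.thetaPairing (TensorAlgebra.ι k h ⊗ₜ word k v) =
      -(φ.thetaPairing (1 ⊗ₜ word k v) ∘ₗ R) :=
    tensorProduct_ext_word fun u w => hφ.thetaPairing_ι_tmul_word h u v w
  exact LinearMap.congr_fun hext y

theorem thetaPairing_mul_ι (h : H) (x y : TensorAlgebra k H ⊗[k] TensorAlgebra k H) :
    φ.thetaPairing (x * (TensorAlgebra.ι k h ⊗ₜ 1)) y =
      -φ.thetaPairing x (y * (TensorAlgebra.ι k h ⊗ₜ 1)) := by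
  induction x using TensorProduct.induction_on with
  | zero => simp
  | add x x' hx hx' => simp only [add_mul, map_add, LinearMap.add_apply, hx, hx', neg_add]
  | tmul α v =>
  rw [Algebra.TensorProduct.tmul_mul_tmul, mul_one]
  induction α using left_induction generalizing v y with
  | add α α' hα hα' =>
    simp only [add_mul, TensorProduct.add_tmul, map_add, LinearMap.add_apply, hα, hα', neg_add]
  | smul c α hα =>
    simp only [smul_mul_assoc, ← TensorProduct.smul_tmul', map_smul, LinearMap.smul_apply, hα,
      smul_neg]
  | one => rw [one_mul, hφ.thetaPairing_ι_tmul]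
  | ι_mul g α ih =>
    have h₁ := φ.pairing_ι_mul (0, false) (1, false) (0, true) (1, true) g
      ((α * TensorAlgebra.ι k h) ⊗ₜ v) y
    have h₂ := φ.pairing_ι_mul (0, false) (1, false) (0, true) (1, true) g
      (α ⊗ₜ v) (y * (TensorAlgebra.ι k h ⊗ₜ 1))
    simp only [add_mul, Algebra.TensorProduct.tmul_mul_tmul, one_mul, map_add,
      LinearMap.add_apply, ih, ← mul_assoc] at h₁ h₂ ⊢
    linear_combination (norm := abel) h₁ + h₂

theorem thetaPairing_mul_rho (u : TensorAlgebra k H)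
    (x y : TensorAlgebra k H ⊗[k] TensorAlgebra k H) :
    φ.thetaPairing x (y * (rho k H u ⊗ₜ 1)) = φ.thetaPairing (x * (u ⊗ₜ 1)) y := by
  induction u using left_induction generalizing x with
  | one => rw [rho_one, ← Algebra.TensorProduct.one_def, mul_one, mul_one]
  | add u u' hu hu' =>
    simp only [mul_add, TensorProduct.add_tmul, map_add, LinearMap.add_apply, hu, hu']
  | smul c u hu =>
    simp only [mul_smul_comm, ← TensorProduct.smul_tmul', map_smul, LinearMap.smul_apply, hu]
  | ι_mul h u ih =>
    have hι (z : TensorAlgebra k H) :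
        (TensorAlgebra.ι k h * z) ⊗ₜ[k] (1 : TensorAlgebra k H) =
          (TensorAlgebra.ι k h ⊗ₜ 1) * (z ⊗ₜ 1) := by simp
    have hρ : rho k H (TensorAlgebra.ι k h * u) ⊗ₜ[k] (1 : TensorAlgebra k H) =
        (-1 : k) • ((rho k H u ⊗ₜ 1) * (TensorAlgebra.ι k h ⊗ₜ 1)) := by
      rw [rho_mul, rho_ι, Algebra.TensorProduct.tmul_mul_tmul, mul_one, TensorProduct.smul_tmul',
        neg_one_smul, mul_neg]
    rw [hι, hρ, mul_smul_comm, map_smul, neg_one_smul, ← mul_assoc, ← hφ.thetaPairing_mul_ι, ih,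
      mul_assoc]

theorem thetaPairing_eq_thetaValue (α β γ δ : TensorAlgebra k H) :
    φ.thetaPairing (α ⊗ₜ β) (γ ⊗ₜ δ) = φ.thetaValue ((α * rho k H γ) ⊗ₜ (δ * rho k H β)) := by
  have h₁ := hφ.thetaPairing_mul_rho (rho k H γ) (α ⊗ₜ β) (1 ⊗ₜ δ)
  have h₂ := hφ.thetaPairing_mul_rho β (1 ⊗ₜ (α * rho k H γ)) (δ ⊗ₜ 1)
  simp only [Algebra.TensorProduct.tmul_mul_tmul, one_mul, mul_one, rho_rho] at h₁ h₂
  rw [h₁, ← φ.thetaPairing_comm, ← h₂, φ.thetaPairing_comm, thetaValue_tmul]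

theorem thetaValue_rho_tmul_rho (v w : TensorAlgebra k H) :
    φ.thetaValue (rho k H v ⊗ₜ rho k H w) = φ.thetaValue (w ⊗ₜ v) := by
  rw [thetaValue_tmul w, ← φ.thetaPairing_comm, hφ.thetaPairing_eq_thetaValue, one_mul, one_mul]

theorem thetaValue_comm (x : TensorAlgebra k H ⊗[k] TensorAlgebra k H) :
    φ.thetaValue (TensorProduct.comm k _ _ x) = φ.thetaValue x := by
  suffices hext : φ.thetaValue ∘ₗ (TensorProduct.comm k _ _).toLinearMap = φ.thetaValue from
    LinearMap.congr_fun hext x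
  refine TensorProduct.ext' fun v w => ?_
  change φ.thetaValue (w ⊗ₜ v) = φ.thetaValue (v ⊗ₜ w)
  rw [← hφ.thetaValue_rho_tmul_rho v w, thetaValue_tmul v w, φ.thetaPairing_symm,
    hφ.thetaPairing_eq_thetaValue, one_mul, one_mul]

theorem thetaValue_map_rho (x : TensorAlgebra k H ⊗[k] TensorAlgebra k H) :
    φ.thetaValue (TensorProduct.map (rho k H) (rho k H) x) = φ.thetaValue x := by
  suffices hext : φ.thetaValue ∘ₗ TensorProduct.map (rho k H) (rho k H) = φ.thetaValue from
    LinearMap.congr_fun hext x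
  refine TensorProduct.ext' fun v w => ?_
  exact (hφ.thetaValue_rho_tmul_rho v w).trans (hφ.thetaValue_comm (v ⊗ₜ w))

theorem thetaValue_one_tmul (w : TensorAlgebra k H) : φ.thetaValue (1 ⊗ₜ w) = 0 := by
  suffices hext : φ.thetaValue ∘ₗ TensorProduct.mk k _ _ 1 = 0 from LinearMap.congr_fun hext w
  refine linearMap_ext_word fun w => ?_
  have hzero := hφ.boundary_eq_zero (t₁ := tripod (.edge 0 false) (.edge 1 false) (.edge 1 true))
    (t₂ := (.of (.edge 0 true), comb [] (.edge 2 false) * comb w (.edge 2 true))) (by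
    simp only [tripod, Tree.ends_eq, rootedEnds_mul, rootedEnds_comb, rootedEnds_edge]
    decide) (.loop 0 1 false false (by decide))
  have hcomb := φ.boundary_loop_comb (e := 0) (f := 1) (g := 2) (by decide) (by decide) (by decide)
    false false [] w
  rw [φ.thetaPairing_symm (1 ⊗ₜ word k w), show sgn false * sgn false = 1 from rfl, one_smul,
    ← two_smul k] at hcomb
  exact (isUnit_of_invertible (2 : k)).smul_eq_zero.1 (hcomb.symm.trans hzero)

theorem thetaValue_commRelator (h : H) (v w : TensorAlgebra k H) :
    φ.thetaValue (commRelator k H h v w) = 0 := by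
  have hinv := φ.pairing_ι_mul (0, false) (1, false) (0, true) (1, true) h (v ⊗ₜ 1) (1 ⊗ₜ w)
  simp only [add_mul, Algebra.TensorProduct.tmul_mul_tmul, one_mul, mul_one, map_add,
    LinearMap.add_apply, hφ.thetaPairing_eq_thetaValue, rho_one, rho_ι, mul_neg,
    TensorProduct.neg_tmul, TensorProduct.tmul_neg, map_neg] at hinv
  simp only [commRelator, add_mul, mul_add, Algebra.TensorProduct.tmul_mul_tmul, one_mul, mul_one,
    map_add, map_neg]
  linear_combination (norm := abel) -hinv

theorem thetaValue_triRelator (v w : TensorAlgebra k H) :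
    φ.thetaValue (triRelator k H v w) = 0 := by
  suffices hext : ((triRelatorBilin k H).compr₂ φ.thetaValue) ∘ₗ rho k H = 0 by
    rw [← rho_rho k v]
    exact LinearMap.congr_fun₂ hext (rho k H v) w
  refine linearMap_ext_word fun v => linearMap_ext_word fun w => ?_
  have hzero := hφ.boundary_eq_zero (t₁ := tripod (.edge 0 false) (.edge 1 false) (.edge 2 false))
    (t₂ := (.of (.edge 0 true), comb v (.edge 1 true) * comb w (.edge 2 true))) (by
    simp only [tripod, Tree.ends_eq, rootedEnds_mul, rootedEnds_comb, rootedEnds_edge]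
    decide) (.three 0 1 2 false false false (by decide) (by decide) (by decide))
  have hcomb := φ.boundary_three_comb (e := 0) (f := 1) (g := 2) (by decide) (by decide)
    (by decide) false false false v w
  rw [show sgn false * (sgn false * sgn false) = 1 from rfl, one_smul,
    φ.boundary_three_value (G := φ.thetaValue) _
      (fun x => (hφ.thetaValue_map_rho _).trans (hφ.thetaValue_comm x))] at hcomb
  · exact hcomb.symm.trans hzero
  · intro v w
    rw [hφ.thetaPairing_eq_thetaValue, one_mul, rho_one, mul_one]

theorem isThetaMap_thetaValue : IsThetaMap φ.thetaValue where
  one_left := hφ.thetaValue_one_tmul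
  one_right v := (hφ.thetaValue_comm (1 ⊗ₜ v)).trans (hφ.thetaValue_one_tmul v)
  map_rho := hφ.thetaValue_map_rho
  comm := hφ.thetaValue_comm
  commRelator := hφ.thetaValue_commRelator
  triRelator := hφ.thetaValue_triRelator

theorem toFun_mem_range_thetaValue {s : ℕ} {t : Tree (Leaf H 2)} (ht : IsHairy s t.leaves) :
    φ.toFun t.1 t.2 ∈ LinearMap.range φ.thetaValue := by
  have hmem (p q r l : TensorAlgebra k H) :
      φ.thetaPairing (p ⊗ₜ q) (r ⊗ₜ l) ∈ LinearMap.range φ.thetaValue := by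
    rw [hφ.thetaPairing_eq_thetaValue]
    exact LinearMap.mem_range_self _ _
  have hends : rootedEnds t.1 + rootedEnds t.2 =
      {(0, false), (0, true), (1, false), (1, true)} :=
    t.ends_eq.symm.trans ((isHairy_iff.1 ht).1.trans (by decide))
  refine φ.mem_of_rootedEnds_eq_four _ (fun u v w => ?_) (fun u v w => ?_) hends
  · rw [← comb_nil, φ.toFun_comb]
    exact hmem _ _ _ _
  · rw [← comb_nil, φ.toFun_comb]
    have hcross := φ.pairing_eq_smul_thetaPairing false true
    rw [show φ.pairing (0, false) (1, true) (0, true) (1, false) = _ from hcross,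
      LinearMap.smul_apply, LinearMap.smul_apply]
    exact zsmul_mem (hmem _ _ _ _) _

end Closed

end SymForm

end ThetaValue

theorem IsHairy.unique {H : Type v} {n s s' : ℕ} {m : Multiset (Leaf H n)} (h : IsHairy s m)
    (h' : IsHairy s' m) : s = s' := by
  have hs := (isHairy_iff.1 h).2
  have hs' := (isHairy_iff.1 h').2
  lia

theorem card_rootedLeaves_comb {H : Type v} {n : ℕ} (v : List H) (x : Leaf H n) :
    (rootedLeaves (comb v x)).card = v.length + 1 := by
  induction v with
  | nil => rfl
  | cons h v ih =>
    rw [comb_cons, rootedLeaves_mul, Multiset.card_add, ih, rootedLeaves_of,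
      Multiset.card_singleton, List.length_cons, add_comm]

theorem isHairy_thetaTree {H : Type v} (v w : List H) :
    IsHairy (v.length + w.length) (thetaTree v w).leaves := by
  rw [isHairy_iff]
  constructor
  · rw [← Tree.ends, Tree.ends_eq]
    simp only [thetaTree, rootedEnds_mul, rootedEnds_comb, rootedEnds_edge]
    decide
  · simp only [Tree.leaves, thetaTree, rootedLeaves, Multiset.card_add, card_rootedLeaves_comb,
      Multiset.card_singleton]
    lia

section OmegaForm

variable {k : Type u} [Field k] {H : Type v} [AddCommGroup H] [Module k H]

variable (k H) in
/-- The class of a combination of hairy graphs in `Ω_{s,2}(H)`. -/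
noncomputable def omegaMk (s : ℕ) : (Graph H 2 s →₀ k) →ₗ[k] Omega k H s 2 :=
  toOmega k s 2 ∘ₗ Submodule.mkQ _

theorem omegaMk_surjective (s : ℕ) : Function.Surjective (omegaMk k H s) :=
  (Submodule.mkQ_surjective _).comp (Submodule.mkQ_surjective _)

theorem omegaMk_eq_zero {s : ℕ} {x : Graph H 2 s →₀ k} (hx : ChainRel k 2 s x) :
    omegaMk k H s x = 0 := by
  have hchain : Submodule.mkQ (Submodule.span k {x | ChainRel k 2 s x}) x = 0 :=
    (Submodule.Quotient.mk_eq_zero _).2 (Submodule.subset_span hx)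
  rw [omegaMk, LinearMap.comp_apply, hchain, map_zero]

variable (k H) in
/-- The classes of trees in `Ω_{s,2}(H)`, the universal closed form on hairy graphs with `s`
hairs. -/
noncomputable def omegaForm (s : ℕ) : SymForm k H (Omega k H s 2) where
  toFun A B := omegaMk k H s (gen k 2 s (A, B))
  symm A B := by
    rw [← sub_eq_zero, ← map_sub]
    exact omegaMk_eq_zero (.mark_symm A B)
  move A B C := by
    rw [← sub_eq_zero, ← map_sub]
    exact omegaMk_eq_zero (.mark_move A B C)
  antisymm A B C := by
    rw [← map_add]
    exact omegaMk_eq_zero (.antisymm A B C)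
  ihx A B C D := by
    rw [← map_add, ← map_add]
    exact omegaMk_eq_zero (.ihx A B C D)
  hair_add x x' B := by
    rw [← sub_eq_zero, ← sub_sub, ← map_sub, ← map_sub]
    exact omegaMk_eq_zero (.hair_add x x' B)
  hair_smul c x B := by
    rw [← sub_eq_zero, ← map_smul, ← map_sub]
    exact omegaMk_eq_zero (.hair_smul c x B)
  renumber π A B := by
    rw [← sub_eq_zero, ← map_sub]
    exact omegaMk_eq_zero (.renumber π (A, B))
  reverse e A B := by
    rw [eq_neg_iff_add_eq_zero, ← map_add]
    exact omegaMk_eq_zero (.reverse e (A, B))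

theorem omegaForm_toFun (s : ℕ) (t : Tree (Leaf H 2)) :
    (omegaForm k H s).toFun t.1 t.2 = toOmega k s 2 (chain k 2 s t) := rfl

theorem omegaForm_toFun_eq_zero {s : ℕ} {t : Tree (Leaf H 2)} (ht : ¬ IsHairy s t.leaves) :
    (omegaForm k H s).toFun t.1 t.2 = 0 := by
  change omegaMk k H s (gen k 2 s t) = 0
  rw [gen, dif_neg ht, map_zero]

theorem omegaForm_closed (s : ℕ) : (omegaForm k H s).Closed := by
  intro s' t₁ t₂ ht h₁
  by_cases hs : s' = s
  · subst hs
    rw [← TreeForm.map_boundary (fun t _ => (omegaForm_toFun s' t).symm) ht]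
    exact (Submodule.Quotient.mk_eq_zero _).2 (Submodule.subset_span ⟨t₁, t₂, ht, h₁, rfl⟩)
  · rw [← TreeForm.map_boundary (f := (0 : Chains k H 2 s' →ₗ[k] Omega k H s 2))
      (fun t ht => (omegaForm_toFun_eq_zero fun h => hs (ht.unique h)).symm) ht]
    rfl

variable [Invertible (2 : k)]

theorem thetaValue_omegaForm_word (v w : List H) :
    (omegaForm k H (v.length + w.length)).thetaValue (word k v ⊗ₜ word k w) = theta k v w :=
  ((omegaForm k H _).toFun_thetaTree v w).symm

theorem thetaValue_omegaForm_word_eq_zero {s : ℕ} {v w : List H} (hs : s ≠ v.length + w.length) :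
    (omegaForm k H s).thetaValue (word k v ⊗ₜ word k w) = 0 := by
  rw [← SymForm.toFun_thetaTree]
  exact omegaForm_toFun_eq_zero fun h => hs (h.unique (isHairy_thetaTree v w))

theorem thetaValue_omegaForm_surjective (s : ℕ) :
    Function.Surjective (omegaForm k H s).thetaValue := by
  intro x
  obtain ⟨x, rfl⟩ := omegaMk_surjective s x
  change _ ∈ LinearMap.range (omegaForm k H s).thetaValue
  induction x using Finsupp.induction_linear with
  | zero => rw [map_zero]; exact zero_mem _
  | add x y hx hy => rw [map_add]; exact add_mem hx hy
  | single t c =>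
    have hgen : Finsupp.single t c = c • gen k 2 s t.1 := by
      rw [gen, dif_pos t.2]
      exact (Finsupp.smul_single_one t c).symm
    rw [hgen, map_smul]
    exact Submodule.smul_mem _ c ((omegaForm_closed s).toFun_mem_range_thetaValue t.2)

end OmegaForm

section Isomorphism

variable {k : Type u} [Field k] [Invertible (2 : k)] {H : Type v} [AddCommGroup H] [Module k H]

theorem thetaForm_presentationMk_closed : (thetaForm (presentationMk k H)).Closed :=
  isThetaMap_presentationMk.closed_of_thetaPairing_eq
    isThetaMap_presentationMk.thetaPairing_thetaForm

variable (k H) in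
/-- The map from the spaces `Ω_{s,2}(H)` to the presentation given by the form whose values on
theta graphs are the classes in the presentation. -/
noncomputable def toPresentation : (⨁ s : ℕ, Omega k H s 2) →ₗ[k] Presentation k H :=
  DirectSum.toModule k ℕ _ fun s => thetaForm_presentationMk_closed.evalOmega s

theorem toPresentation_lof_theta (v w : List H) :
    toPresentation k H (DirectSum.lof k ℕ (fun s => Omega k H s 2) (v.length + w.length)
      (theta k v w)) = wordClass k v w := by
  rw [toPresentation, DirectSum.toModule_lof, theta,
    SymForm.Closed.evalOmega_toOmega _ (isHairy_thetaTree v w), SymForm.toFun_thetaTree,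
    SymForm.thetaValue_tmul, isThetaMap_presentationMk.thetaPairing_thetaForm, gluing_tmul,
    rho_one, mul_one, mul_one, presentationMk_word]

variable (k H) in
/-- The component in `Ω_{s,2}(H)` of the inverse of `toPresentation`: the theta values of the
universal closed form. -/
noncomputable def ofPresentation (s : ℕ) : Presentation k H →ₗ[k] Omega k H s 2 :=
  (omegaForm_closed s).isThetaMap_thetaValue.lift

theorem ofPresentation_wordClass (s : ℕ) (v w : List H) :
    ofPresentation k H s (wordClass k v w) =
      (omegaForm k H s).thetaValue (word k v ⊗ₜ word k w) := by
  rw [← presentationMk_word, ofPresentation, IsThetaMap.lift_presentationMk]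

theorem ofPresentation_comp_toPresentation (s : ℕ) :
    ofPresentation k H s ∘ₗ toPresentation k H = DirectSum.component k ℕ _ s := by
  refine DirectSum.linearMap_ext k fun s' => ?_
  rw [← LinearMap.cancel_right (thetaValue_omegaForm_surjective s')]
  refine tensorProduct_ext_word fun v w => ?_
  simp only [LinearMap.comp_apply]
  by_cases hs' : s' = v.length + w.length
  · subst hs'
    rw [thetaValue_omegaForm_word, toPresentation_lof_theta, ofPresentation_wordClass]
    by_cases hs : s = v.length + w.length
    · subst hs
      rw [thetaValue_omegaForm_word, DirectSum.component.lof_self]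
    · rw [thetaValue_omegaForm_word_eq_zero hs, DirectSum.component.of, dif_neg (Ne.symm hs)]
  · rw [thetaValue_omegaForm_word_eq_zero hs', map_zero, map_zero, map_zero, map_zero]

theorem toPresentation_injective : Function.Injective (toPresentation k H) := by
  intro x y hxy
  refine DFinsupp.ext fun s => ?_
  have hcomp (z) := LinearMap.congr_fun (ofPresentation_comp_toPresentation (k := k) (H := H) s) z
  exact (hcomp x).symm.trans ((congrArg (ofPresentation k H s) hxy).trans (hcomp y))

theorem toPresentation_surjective : Function.Surjective (toPresentation k H) := by
  intro y
  obtain ⟨x, rfl⟩ := presentationMk_surjective y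
  have hzero : (LinearMap.range (toPresentation k H)).mkQ ∘ₗ presentationMk k H = 0 :=
    tensorProduct_ext_word fun v w =>
      (Submodule.Quotient.mk_eq_zero _).2 ⟨_, toPresentation_lof_theta v w⟩
  exact (Submodule.Quotient.mk_eq_zero _).1 (LinearMap.congr_fun hzero x)

theorem toPresentation_bijective : Function.Bijective (toPresentation k H) :=
  ⟨toPresentation_injective, toPresentation_surjective⟩

end Isomorphism

end HairyGraph

theorem mainTheorem6_general (k : Type*) [Field k] [NeZero (2 : k)]
    (H : Type*) [AddCommGroup H] [Module k H] :
    ∃ Φ : (⨁ s : ℕ, HairyGraph.Omega k H s 2) ≃ₗ[k] HairyGraph.Presentation k H,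
      ∀ v w : List H,
        Φ (DirectSum.lof k ℕ (fun s : ℕ => HairyGraph.Omega k H s 2) (v.length + w.length)
          (HairyGraph.theta k v w)) = HairyGraph.wordClass k v w := by
  let : Invertible (2 : k) := invertibleOfNonzero two_ne_zero
  exact ⟨.ofBijective _ HairyGraph.toPresentation_bijective, HairyGraph.toPresentation_lof_theta⟩

theorem mainTheorem6 (k : Type*) [Field k] [CharZero k]
    (H : Type*) [AddCommGroup H] [Module k H] :
    ∃ Φ : (⨁ s : ℕ, HairyGraph.Omega k H s 2) ≃ₗ[k] HairyGraph.Presentation k H,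
      ∀ v w : List H,
        Φ (DirectSum.lof k ℕ (fun s : ℕ => HairyGraph.Omega k H s 2) (v.length + w.length)
          (HairyGraph.theta k v w)) = HairyGraph.wordClass k v w :=
  mainTheorem6_general k H
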